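/- **Setting.** Let $a\in[0,1)$, $\sigma>0$, and let $U_0=0$, $U_i=aU_{i-1}+Z_i$ ($i\ge1$) with $Z_i$ i.i.d. $\mathcal N(0,\sigma^2)$ (the Gauss–Markov source). For $n\in\mathbb N$ let $\mathbf U=(U_1,\dots,U_n)^\top$, and let $\mathsf A$ be the $n\times n$ lower bidiagonal matrix with $1$ on the diagonal and $-a$ on the subdiagonal. Let $(\mathsf A^\top\mathsf A)^{-1}=\mathsf S\,\mathrm{diag}(1/\mu_1,\dots,1/\mu_n)\,\mathsf S^\top$ with $\mathsf S$ orthogonal and $0<\mu_1\le\dots\le\mu_n$. Put $\sigma_i^2=\sigma^2/\mu_i$, $\mathbf X=\mathsf S^\top\mathbf U$, and $\mathbf x=\mathsf S^\top\mathbf u$ for $\mathbf u\in\mathbb R^n$. The distortion is $\mathsf d(\mathbf u,\mathbf v)=\frac1n\|\mathbf u-\mathbf v\|_2^2$. With $S(w)=\sigma^2/(1+a^2-2a\cos w)$, let $d_{\max}=\frac1{2\pi}\int_{-\pi}^{\pi}S(w)\,dw$; for $d\in(0,d_{\max})$ let $\theta>0$ be the water level defined by $d=\frac1{2\pi}\int_{-\pi}^{\pi}\min(\theta,S(w))\,dw$.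 The $n$-th order rate-distortion function of a random vector $\mathbf W$ in $\mathbb R^n$ is $\mathbb R_{\mathbf W}(n,d)=\frac1n\inf I(\mathbf W;\mathbf V)$ over all $P_{\mathbf V|\mathbf W}$ with $\mathbb E[\mathsf d(\mathbf W,\mathbf V)]\le d$; a minimizing pair is called RDF-achieving. For random vectors $\mathbf W,\mathbf Y$ let $\mathbb R(\mathbf W,\mathbf Y,d)=\inf\frac1n D(P_{\mathbf F|\mathbf W}\|P_{\mathbf Y}|P_{\mathbf W})$ over all $P_{\mathbf F|\mathbf W}$ with $\mathbb E[\mathsf d(\mathbf W,\mathbf F)]\le d$ (conditional relative entropy minimization, CREM). Logarithms are natural. For $\mathbf u\in\mathbb R^n$ let $\hat a(\mathbf u)=\sum_{i=1}^{n-1}u_iu_{i+1}\big/\sum_{i=1}^{n-1}u_i^2$, let $$\hat\sigma_i^2(\mathbf x)=\frac{\sigma^2}{1+\hat a(\mathbf u)^2-2\hat a(\mathbf u)\cos(i\pi/(n+1))},\qquad 1\le i\le n,$$ and let $\hat{\mathbf X}=\hat{\mathbf X}(\mathbf x)\sim\mathcal N(\mathbf 0,\mathrm{diag}(\hat\sigma_1^2(\mathbf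 x),\dots,\hat\sigma_n^2(\mathbf x)))$. Let $(\mathbf X,\mathbf Y^\star)$ be an RDF-achieving pair in $\mathbb R_{\mathbf X}(n,d)$, let $\hat{\mathbf F}^\star$ be the optimizer of $\mathbb R(\hat{\mathbf X},\mathbf Y^\star,d)$, and let $m_i(\mathbf x)=\mathbb E[(\hat F_i^\star-x_i)^2\mid\hat X_i=x_i]$ (the continuous version of the conditional expectation). For $\alpha,p>0$ let $\eta_n=\sqrt{\alpha\log\log n/n}$, and let the MLE-typical set $\mathcal T(n,\alpha,p)$ be the set of all $\mathbf u\in\mathbb R^n$ with $$|\hat a(\mathbf u)-a|\le\eta_n,\qquad \Big|\frac1n\sum_{i=1}^n m_i(\mathbf x)-d\Big|\le p\,\eta_n,\qquad \Big|\frac1n\sum_{i=1}^n\Big(\frac{x_i^2}{\sigma_i^2}\Big)^k-(2k-1)!!\Big|\le2\quad(k=1,2,3).$$ Finally let $\lambda^\star=-\frac{\partial}{\partial d}\mathbb R_{\mathbf U}(n,d)$, and let $\hat\lambda^\star(\mathbf x)=-\frac{\partial}{\partial t}\mathbb R(\hat{\mathbf X},\mathbf Y^\star,t)\big|_{t=d}$,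 where $\mathbf Y^\star$ (chosen for $d$) is held fixed. **Theorem (Properties of the MLE-typical set).** There is a universal constant $c>0$ such that, with $\kappa=\frac{c}{8(1-a^2)}$, the following holds for all $a\in[0,1)$, $\sigma>0$ and $d\in(0,d_{\max})$. There is a $p_0>0$, depending on $a,\sigma,d$ only, such that for all $\alpha>0$ and $p\ge p_0$: 1. There is a constant $A_1>0$ such that for all $n$ large enough, $\mathbb P[\mathbf U\in\mathcal T(n,\alpha,p)]\ge1-\dfrac{A_1}{(\log n)^{\kappa\alpha}}$. Moreover, there is a constant $A_2>0$ for which both of the following hold: 2. For all $n$ large enough and all $\mathbf u\in\mathcal T(n,\alpha,p)$, $|\hat\sigma_i^2(\mathbf x)-\sigma_i^2|\le A_2\eta_n$ for all $1\le i\le n$. 3. For all $n$ large enough and all $\mathbf u\in\mathcal T(n,\alpha,p)$, the derivatives defining $\lambda^\star$ and $\hat\lambda^\star(\mathbf x)$ exist and $|\hat\lambda^\star(\mathbf x)-\lambda^\star|\le\dfrac{9A_2}{4\theta^2}\,\eta_n$. -/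

import Mathlib

open MeasureTheory ProbabilityTheory Filter Topology
open scoped ENNReal Nat

noncomputable section

namespace GaussMarkov

/-! ### Single-shot informational quantities on `ℝⁿ` -/

/-- Mean squared error distortion `(1/n) ‖u - v‖₂²`. -/
def mse {n : ℕ} (u v : Fin n → ℝ) : ℝ :=
  (1 / (n : ℝ)) * ∑ i, (u i - v i) ^ 2

/-- The conditional distributions `K = P_{Y|X}`, for `X ∼ P`, with `𝔼[d(X, Y)] ≤ d`. -/
def IsFeasible {n : ℕ} (P : Measure (Fin n → ℝ)) (d : ℝ)
    (K : Kernel (Fin n → ℝ) (Fin n → ℝ)) : Prop :=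
  IsMarkovKernel K ∧
    ∫⁻ z, ENNReal.ofReal (mse z.1 z.2) ∂(P ⊗ₘ K) ≤ ENNReal.ofReal d

/-- Mutual information `I(X; Y) = D(P_{XY} ‖ P_X × P_Y)` for `X ∼ P`, `Y | X ∼ K` (in nats). -/
def mutualInfo {n : ℕ} (P : Measure (Fin n → ℝ)) (K : Kernel (Fin n → ℝ) (Fin n → ℝ)) : ℝ≥0∞ :=
  InformationTheory.klDiv (P ⊗ₘ K) (P.prod (K ∘ₘ P))

/-- The `n`-th order rate-distortion function of a random vector with law `P`. -/
def nthRDF {n : ℕ} (P : Measure (Fin n → ℝ)) (d : ℝ) : ℝ≥0∞ :=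
  (n : ℝ≥0∞)⁻¹ * ⨅ (K : Kernel (Fin n → ℝ) (Fin n → ℝ)) (_ : IsFeasible P d K), mutualInfo P K

/-- `Q` is the law of `Y⋆` for a pair `(X, Y⋆)`, `X ∼ P`, that achieves the `n`-th order
rate-distortion function at distortion `d`. -/
def IsRDFAchieving {n : ℕ} (P : Measure (Fin n → ℝ)) (d : ℝ) (Q : Measure (Fin n → ℝ)) : Prop :=
  ∃ K : Kernel (Fin n → ℝ) (Fin n → ℝ), IsFeasible P d K ∧
    (n : ℝ≥0∞)⁻¹ * mutualInfo P K = nthRDF P d ∧ Q = K ∘ₘ P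

/-- Conditional relative entropy `D(P_{F|X} ‖ P_Y | P_X)` for `X ∼ P`, `F | X ∼ K`, `Y ∼ Q`. -/
def condRelEntropy {n : ℕ} (P Q : Measure (Fin n → ℝ))
    (K : Kernel (Fin n → ℝ) (Fin n → ℝ)) : ℝ≥0∞ :=
  ∫⁻ x, InformationTheory.klDiv (K x) Q ∂P

/-- The normalized value of the conditional relative entropy minimization problem
`ℝ(X, Y, d)`, for `X ∼ P` and `Y ∼ Q`. -/
def crem {n : ℕ} (P Q : Measure (Fin n → ℝ)) (d : ℝ) : ℝ≥0∞ :=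
  ⨅ (K : Kernel (Fin n → ℝ) (Fin n → ℝ)) (_ : IsFeasible P d K),
    (n : ℝ≥0∞)⁻¹ * condRelEntropy P Q K

/-- `K = P_{F⋆|X}` is an optimizer of the conditional relative entropy minimization problem. -/
def IsCREMOptimizer {n : ℕ} (P Q : Measure (Fin n → ℝ)) (d : ℝ)
    (K : Kernel (Fin n → ℝ) (Fin n → ℝ)) : Prop :=
  IsFeasible P d K ∧ (n : ℝ≥0∞)⁻¹ * condRelEntropy P Q K = crem P Q d

/-- The extended-valued function `R` is finite near `d` and differentiable at `d`,
with negative slope `lam = - R'(d)`. -/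
def HasNegSlopeAt (R : ℝ → ℝ≥0∞) (d lam : ℝ) : Prop :=
  (∀ᶠ t in 𝓝 d, R t ≠ ⊤) ∧ HasDerivAt (fun t => (R t).toReal) (-lam) d

/-- `g` is the continuous version of the conditional expectation
`t ↦ 𝔼[(F i - X i)² | X i = t]`, where `(X, F) ∼ J`. -/
def IsCondDistortion {n : ℕ} (J : Measure ((Fin n → ℝ) × (Fin n → ℝ))) (i : Fin n)
    (g : ℝ → ℝ) : Prop :=
  Continuous g ∧
    J[fun z => (z.2 i - z.1 i) ^ 2 |
        MeasurableSpace.comap (fun z : (Fin n → ℝ) × (Fin n → ℝ) => z.1 i) inferInstance]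
      =ᵐ[J] fun z => g (z.1 i)

/-! ### The Gauss-Markov source -/

/-- The path of the source driven by the innovations `Z₁, Z₂, …`, where `z k` stands for
`Z_{k+1}`: `U₀ = 0` and `U_{k+1} = a U_k + Z_{k+1}`. -/
def path (a : ℝ) (z : ℕ → ℝ) : ℕ → ℝ
  | 0 => 0
  | k + 1 => a * path a z k + z k

/-- The law of the innovations: i.i.d. `𝒩(0, σ²)`. -/
def innovationLaw (σ : ℝ) : Measure (ℕ → ℝ) :=
  Measure.infinitePi fun _ => gaussianReal 0 (σ ^ 2).toNNReal

/-- The source vector `(U₁, …, U_n)`. -/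
def sourceVec (a : ℝ) (n : ℕ) (z : ℕ → ℝ) : Fin n → ℝ :=
  fun i => path a z (i + 1)

/-- The law of the source vector. -/
def sourceLaw (a σ : ℝ) (n : ℕ) : Measure (Fin n → ℝ) :=
  (innovationLaw σ).map (sourceVec a n)

/-- The lower bidiagonal matrix with `1` on the diagonal and `-a` below it. -/
def matA (a : ℝ) (n : ℕ) : Matrix (Fin n) (Fin n) ℝ :=
  Matrix.of fun i j => if i = j then 1 else if (j : ℕ) + 1 = i then -a else 0

/-- `(AᵀA)⁻¹ = S diag(1/μ₁, …, 1/μ_n) Sᵀ` with `S` orthogonal and `0 < μ₁ ≤ … ≤ μ_n`. -/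
structure IsEigendecomposition (a : ℝ) (n : ℕ) (S : Matrix (Fin n) (Fin n) ℝ)
    (μ : Fin n → ℝ) : Prop where
  orthogonal : S ∈ Matrix.orthogonalGroup (Fin n) ℝ
  pos : ∀ i, 0 < μ i
  mono : Monotone μ
  decomp : ((matA a n).transpose * matA a n)⁻¹ =
    S * Matrix.diagonal (fun i => 1 / μ i) * S.transpose

/-- The decorrelation `x = Sᵀ u`. -/
def decorr {n : ℕ} (S : Matrix (Fin n) (Fin n) ℝ) (u : Fin n → ℝ) : Fin n → ℝ :=
  S.transpose.mulVec u

/-- The law of the decorrelation `X = Sᵀ U` of the source vector. -/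
def decorrLaw (a σ : ℝ) {n : ℕ} (S : Matrix (Fin n) (Fin n) ℝ) : Measure (Fin n → ℝ) :=
  (sourceLaw a σ n).map (decorr S)

/-- The power spectrum `S(w) = σ² / (1 + a² - 2 a cos w)`. -/
def spectrum (a σ w : ℝ) : ℝ :=
  σ ^ 2 / (1 + a ^ 2 - 2 * a * Real.cos w)

/-- The maximum distortion `(1/2π) ∫_{-π}^{π} S(w) dw`. -/
def dMax (a σ : ℝ) : ℝ :=
  (1 / (2 * Real.pi)) * ∫ w in (-Real.pi)..Real.pi, spectrum a σ w

/-- `θ > 0` is a water level matched to `d` via the limiting reverse waterfilling. -/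
def IsWaterLevel (a σ d θ : ℝ) : Prop :=
  0 < θ ∧ d = (1 / (2 * Real.pi)) * ∫ w in (-Real.pi)..Real.pi, min θ (spectrum a σ w)

/-! ### The maximum likelihood estimate and the typical set -/

/-- The maximum likelihood estimate `∑_{i=1}^{n-1} u_i u_{i+1} / ∑_{i=1}^{n-1} u_i²` of `a`. -/
def mle {n : ℕ} (u : Fin n → ℝ) : ℝ :=
  (∑ i : Fin n, if h : (i : ℕ) + 1 < n then u i * u ⟨i + 1, h⟩ else 0) /
    ∑ i : Fin n, if (i : ℕ) + 1 < n then u i ^ 2 else 0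

/-- `η_n = √(α log log n / n)`. -/
def etaSeq (α : ℝ) (n : ℕ) : ℝ :=
  Real.sqrt (α * Real.log (Real.log n) / n)

/-- The exponent `κ = c / (8 (1 - a²))`. -/
def kappa (c a : ℝ) : ℝ :=
  c / (8 * (1 - a ^ 2))

/-- The proxy variances `σ² / (1 + â² - 2 â cos(iπ/(n+1)))`, `1 ≤ i ≤ n`. -/
def proxyVar (σ : ℝ) {n : ℕ} (u : Fin n → ℝ) (i : Fin n) : ℝ :=
  σ ^ 2 / (1 + mle u ^ 2 - 2 * mle u * Real.cos (((i : ℕ) + 1) * Real.pi / (n + 1)))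

/-- The law of the proxy Gaussian vector: independent coordinates with the proxy variances. -/
def proxyLaw (σ : ℝ) {n : ℕ} (u : Fin n → ℝ) : Measure (Fin n → ℝ) :=
  Measure.pi fun i => gaussianReal 0 (proxyVar σ u i).toNNReal

/-- `m i` is the function `t ↦ 𝔼[(F̂⋆_i - t)² | X̂_i = t]`, where `X̂` is the proxy Gaussian vector
of `u` and `F̂⋆` is the optimizer of `ℝ(X̂, Y⋆, d)`, `Y⋆ ∼ Q`. -/
def IsProxyDistortion (σ d : ℝ) {n : ℕ} (Q : Measure (Fin n → ℝ)) (u : Fin n → ℝ)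
    (m : Fin n → ℝ → ℝ) : Prop :=
  ∃ K : Kernel (Fin n → ℝ) (Fin n → ℝ), IsCREMOptimizer (proxyLaw σ u) Q d K ∧
    ∀ i, IsCondDistortion (proxyLaw σ u ⊗ₘ K) i (m i)

/-- The MLE-typical set `𝒯(n, α, p)` of the source with parameters `a`, `σ`, at distortion `d`;
`S` and `μ` are the eigenvectors and eigenvalues that decorrelate the source, so that `X = Sᵀ U`
has coordinate variances `σ² / μ i`. -/
def typicalSet (a σ d α p : ℝ) {n : ℕ} (S : Matrix (Fin n) (Fin n) ℝ) (μ : Fin n → ℝ) :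
    Set (Fin n → ℝ) :=
  {u | |mle u - a| ≤ etaSeq α n ∧
    (∃ (Q : Measure (Fin n → ℝ)) (m : Fin n → ℝ → ℝ),
      IsRDFAchieving (decorrLaw a σ S) d Q ∧ IsProxyDistortion σ d Q u m ∧
      |(1 / (n : ℝ)) * ∑ i, m i (decorr S u i) - d| ≤ p * etaSeq α n) ∧
    ∀ k ∈ Finset.Icc 1 3,
      |(1 / (n : ℝ)) * ∑ i, (decorr S u i ^ 2 / (σ ^ 2 / μ i)) ^ k - ((2 * k - 1)‼ : ℕ)| ≤ 2}

end GaussMarkov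

end

namespace GaussMarkov

/-! ### Exponential tilting of Gaussian measures -/

/-! After decorrelation the source is a vector of independent Gaussians with variances `σ ^ 2 / μ
i`, and everything reduces to one explicit family. Tilting an output law `diagGaussian ν` by `exp
(-l ‖x - y‖²)` gives `testChannel l ν`, whose log-density `tiltExp` depends on the output only
through the distortion. Inserted in a Donsker–Varadhan bound, it yields a line of slope `-l` below
the CREM value, touching it at distortion `avgDist` (`ofReal_le_crem`, `crem_avgDist`). When `ν` is
the water-filling of the input variances, the tilt also has mass at most one in the input variable,
for every output. The same line then bounds mutual information whatever the output law
(`ofReal_le_nthRDF`, `nthRDF_avgDist`). Both functions are therefore envelopes of supporting lines,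
and the two slopes are the parameters `l` and `l'` at which the corresponding `avgDist` equals `d`
(`hasNegSlopeAt_of_supporting`).

The statement on slopes concerns every RDF-achieving output law, so uniqueness is needed. Equality
in Donsker–Varadhan fixes the coupling and makes its reverse channel additive Gaussian noise;
cancelling that noise in characteristic functions determines the output law
(`IsRDFAchieving.eq_diagGaussian`).

The slopes `l` and `l'` solve equations with the same `ν` and slightly different input variances.
Eigenvalue localization (`IsEigendecomposition.exists_angle`) bounds that difference by a multiple
of `η_n`. It also shows that the mean variance exceeds `d` by a margin uniform in `n`, so the mean
of `ν` stays away from zero and `avgDist` decreases in the slope at a uniform rate; hence `|l' - l|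
= O(η_n)` (`exists_uniform_slope`).

For the probability bound, five exceptional events are controlled: an MLE error by a self-normalized
exponential martingale and a lower bound on the energy (`exists_mle_tail`), fluctuations of the
empirical distortion by a Bernstein bound for Gaussian quadratic forms (`quadratic_concentration`),
and three moment deviations by Chebyshev. At scale `η_n` the exponential bounds become powers of
`log n`, which dominate the `O(1/n)` terms. -/

/-- The normalizing constant of the tilt `exp (-A x² + B x)` of `𝒩(0, s)`. -/
theorem gaussianReal_withDensity_exp {s A B : ℝ} (hs : 0 ≤ s) (h : 0 < 1 + 2 * A * s) :
    (gaussianReal 0 s.toNNReal).withDensity (fun x => ENNReal.ofReal (Real.exp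
      (-A * x ^ 2 + B * x + (Real.log (1 + 2 * A * s) / 2 - B ^ 2 * (s / (1 + 2 * A * s)) / 2)))) =
    gaussianReal (B * (s / (1 + 2 * A * s))) (s / (1 + 2 * A * s)).toNNReal := by
  -- The degenerate case must be kept: water-filling switches components off.
  rcases hs.eq_or_lt with rfl | hs
  · rw [Real.toNNReal_zero, gaussianReal_zero_var, dirac_withDensity' (by fun_prop)]
    simp
  have hw : 0 < s / (1 + 2 * A * s) := div_pos hs h
  have h1 : s.toNNReal ≠ 0 := by simpa using hs
  have h2 : (s / (1 + 2 * A * s)).toNNReal ≠ 0 := by simpa using hw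
  rw [gaussianReal_of_var_ne_zero _ h1, gaussianReal_of_var_ne_zero _ h2,
    ← withDensity_mul _ (measurable_gaussianPDF _ _) (by fun_prop)]
  congr 1
  ext x
  simp only [Pi.mul_apply, gaussianPDF]
  rw [← ENNReal.ofReal_mul (gaussianPDFReal_nonneg _ _ _)]
  congr 1
  simp only [gaussianPDFReal, Real.coe_toNNReal _ hs.le, Real.coe_toNNReal _ hw.le]
  have e1 : Real.exp (Real.log (1 + 2 * A * s) / 2) = √(1 + 2 * A * s) := by
    rw [Real.sqrt_eq_rpow, Real.rpow_def_of_pos h]; congr 1; ring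
  have e2 : (√(2 * Real.pi * (s / (1 + 2 * A * s))))⁻¹ =
      (√(2 * Real.pi * s))⁻¹ * √(1 + 2 * A * s) := by
    rw [← mul_div_assoc, Real.sqrt_div' _ h.le, inv_div, div_eq_mul_inv, mul_comm]
  rw [e2, ← e1, mul_assoc (√(2 * Real.pi * s))⁻¹, mul_assoc (√(2 * Real.pi * s))⁻¹,
    ← Real.exp_add, ← Real.exp_add]
  congr 2
  generalize Real.log (1 + 2 * A * s) = l
  obtain ⟨r, hr⟩ : ∃ r, r = 1 + 2 * A * s := ⟨_, rfl⟩
  -- Trading `A` for the gain `r` makes the remaining identity rational with monomial denominators.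
  have hA : A = (r - 1) / (2 * s) := by rw [hr]; field_simp; ring
  rw [← hr] at h ⊢
  rw [hA]
  field_simp
  ring

/-- The tilted law has total mass one, so its normalizing constant is the value of the integral. All
Gaussian exponential moments below come from this formula. -/
theorem lintegral_exp_gaussianReal {s A B C : ℝ} (hs : 0 ≤ s) (h : 0 < 1 + 2 * A * s) :
    ∫⁻ x, ENNReal.ofReal (Real.exp (-A * x ^ 2 + B * x + C)) ∂(gaussianReal 0 s.toNNReal) =
    ENNReal.ofReal (Real.exp
      (C - Real.log (1 + 2 * A * s) / 2 + B ^ 2 * (s / (1 + 2 * A * s)) / 2)) := by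
  have key := congrArg (fun m : Measure ℝ => m Set.univ)
    (gaussianReal_withDensity_exp (B := B) hs h)
  simp only [withDensity_apply _ MeasurableSet.univ, Measure.restrict_univ, measure_univ] at key
  rw [← mul_one (ENNReal.ofReal _), ← key, ← lintegral_const_mul _ (by fun_prop)]
  refine lintegral_congr fun x => ?_
  rw [← ENNReal.ofReal_mul (Real.exp_nonneg _), ← Real.exp_add]
  congr 2
  ring

theorem lintegral_pi_prod {ι : Type*} [Fintype ι] {E : ι → Type*} [∀ i, MeasurableSpace (E i)]
    (μ : ∀ i, Measure (E i)) [∀ i, IsProbabilityMeasure (μ i)] {f : ∀ i, E i → ℝ≥0∞}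
    (hf : ∀ i, Measurable (f i)) :
    ∫⁻ x, ∏ i, f i (x i) ∂(Measure.pi μ) = ∏ i, ∫⁻ x, f i x ∂(μ i) := by
  rw [lintegral_prod_eq_prod_lintegral_of_indepFun Finset.univ (fun i (x : ∀ i, E i) => f i (x i))
    (iIndepFun_pi (X := f) fun i => (hf i).aemeasurable)
    (fun i => (hf i).comp (measurable_pi_apply i))]
  exact Finset.prod_congr rfl fun i _ => by
    rw [← (measurePreserving_eval μ i).lintegral_comp (hf i)]

theorem pi_withDensity {ι : Type*} [Fintype ι] {E : ι → Type*} [∀ i, MeasurableSpace (E i)]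
    (μ : ∀ i, Measure (E i)) [∀ i, IsProbabilityMeasure (μ i)] {f : ∀ i, E i → ℝ≥0∞}
    (hf : ∀ i, Measurable (f i)) [∀ i, SigmaFinite ((μ i).withDensity (f i))] :
    Measure.pi (fun i => (μ i).withDensity (f i)) =
      (Measure.pi μ).withDensity (fun x => ∏ i, f i (x i)) := by
  refine Measure.pi_eq fun s hs => ?_
  rw [withDensity_apply _ (MeasurableSet.univ_pi hs),
    ← lintegral_indicator (MeasurableSet.univ_pi hs)]
  have : ((Set.univ.pi s).indicator fun x : ∀ i, E i => ∏ i, f i (x i)) =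
      fun x => ∏ i, (s i).indicator (f i) (x i) := by
    classical
    ext x
    by_cases hx : x ∈ Set.univ.pi s
    · rw [Set.indicator_of_mem hx]
      exact Finset.prod_congr rfl fun i _ => (Set.indicator_of_mem (hx i trivial) _).symm
    · rw [Set.indicator_of_notMem hx]
      obtain ⟨i, hi⟩ : ∃ i, x i ∉ s i := by simpa using hx
      exact (Finset.prod_eq_zero (Finset.mem_univ i) (Set.indicator_of_notMem hi _)).symm
  rw [this, lintegral_pi_prod μ fun i => (hf i).indicator (hs i)]
  exact Finset.prod_congr rfl fun i _ => by
    rw [lintegral_indicator (hs i), withDensity_apply _ (hs i)]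

/-! ### Lower bounds for relative entropy -/

section KL
variable {Ω : Type*} [MeasurableSpace Ω] {μ ν : Measure Ω} [IsProbabilityMeasure μ]
  [IsProbabilityMeasure ν] {f : Ω → ℝ}

/-- Reweighting the reference by `exp f` subtracts `f` from the log-likelihood ratio; the mass term
appears because `klDiv` of finite measures includes the difference of total masses. Nonnegativity of
the left side gives Donsker–Varadhan, and its vanishing gives the equality case. -/
theorem toReal_klDiv_withDensity_exp (hf : Measurable f) (hfi : Integrable f μ)
    (hmass : ∫⁻ x, ENNReal.ofReal (Real.exp (f x)) ∂ν ≤ 1)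
    (hfin : InformationTheory.klDiv μ ν ≠ ∞) :
    (InformationTheory.klDiv μ (ν.withDensity fun x => ENNReal.ofReal (Real.exp (f x)))).toReal =
      (InformationTheory.klDiv μ ν).toReal - ∫ x, f x ∂μ
        + (∫⁻ x, ENNReal.ofReal (Real.exp (f x)) ∂ν).toReal - 1 ∧
    InformationTheory.klDiv μ (ν.withDensity fun x => ENNReal.ofReal (Real.exp (f x))) ≠ ∞ := by
  obtain ⟨hac, hint⟩ := InformationTheory.klDiv_ne_top_iff.1 hfin
  set g : Ω → ℝ≥0∞ := fun x => ENNReal.ofReal (Real.exp (f x)) with hg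
  have hgm : Measurable g := by fun_prop
  have hg0 : ∀ x, g x ≠ 0 := fun x => by simp [hg, Real.exp_pos]
  have hgt : ∀ x, g x ≠ ∞ := fun x => ENNReal.ofReal_ne_top
  have hfinm : IsFiniteMeasure (ν.withDensity g) :=
    isFiniteMeasure_withDensity (ne_top_of_le_ne_top ENNReal.one_ne_top hmass)
  have hac' : μ ≪ ν.withDensity g :=
    hac.trans (withDensity_absolutelyContinuous' hgm.aemeasurable (ae_of_all _ hg0))
  have hllr : llr μ (ν.withDensity g) =ᵐ[μ] fun x => llr μ ν x - f x := by
    have h1 := hac.ae_le (Measure.rnDeriv_withDensity_right μ ν hgm.aemeasurable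
      (ae_of_all _ hg0) (ae_of_all _ hgt))
    filter_upwards [h1, Measure.rnDeriv_pos hac,
      hac.ae_le (Measure.rnDeriv_lt_top μ ν)] with x hx hpos hlt
    replace hpos := ENNReal.toReal_pos hpos.ne' hlt.ne
    simp only [llr_def] at *
    rw [hx, ENNReal.toReal_mul, ENNReal.toReal_inv, hg, ENNReal.toReal_ofReal (Real.exp_nonneg _),
      Real.log_mul (by simp [Real.exp_ne_zero]) hpos.ne', Real.log_inv, Real.log_exp]
    ring
  have hint' : Integrable (llr μ (ν.withDensity g)) μ :=
    (hint.sub hfi).congr (hllr.mono fun x hx => hx.symm)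
  refine ⟨?_, InformationTheory.klDiv_ne_top hac' hint'⟩
  rw [InformationTheory.toReal_klDiv hac' hint', InformationTheory.toReal_klDiv hac hint,
    integral_congr_ae hllr, integral_sub hint hfi]
  simp only [measureReal_def, withDensity_apply _ MeasurableSet.univ,
    Measure.restrict_univ, measure_univ, ENNReal.toReal_one]
  ring

/-- A one-sided Donsker–Varadhan bound. -/
theorem ofReal_integral_le_klDiv (hf : Measurable f) (hfi : Integrable f μ)
    (hmass : ∫⁻ x, ENNReal.ofReal (Real.exp (f x)) ∂ν ≤ 1) :
    ENNReal.ofReal (∫ x, f x ∂μ) ≤ InformationTheory.klDiv μ ν := by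
  by_cases hfin : InformationTheory.klDiv μ ν = ∞
  · simp [hfin]
  obtain ⟨h, -⟩ := toReal_klDiv_withDensity_exp hf hfi hmass hfin
  refine ENNReal.ofReal_le_of_le_toReal ?_
  have h0 := ENNReal.toReal_nonneg (a := InformationTheory.klDiv μ
    (ν.withDensity fun x => ENNReal.ofReal (Real.exp (f x))))
  have h1 := ENNReal.toReal_mono ENNReal.one_ne_top hmass
  rw [ENNReal.toReal_one] at h1
  linarith

/-- The equality case of `ofReal_integral_le_klDiv`. -/
theorem eq_withDensity_of_klDiv_eq (hf : Measurable f) (hfi : Integrable f μ)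
    (hmass : ∫⁻ x, ENNReal.ofReal (Real.exp (f x)) ∂ν ≤ 1)
    (hfin : InformationTheory.klDiv μ ν ≠ ∞)
    (heq : (InformationTheory.klDiv μ ν).toReal ≤ ∫ x, f x ∂μ) :
    μ = ν.withDensity fun x => ENNReal.ofReal (Real.exp (f x)) := by
  obtain ⟨h, h'⟩ := toReal_klDiv_withDensity_exp hf hfi hmass hfin
  have hfinm : IsFiniteMeasure (ν.withDensity fun x => ENNReal.ofReal (Real.exp (f x))) :=
    isFiniteMeasure_withDensity (ne_top_of_le_ne_top ENNReal.one_ne_top hmass)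
  rw [← InformationTheory.klDiv_eq_zero_iff]
  have h0 := ENNReal.toReal_nonneg (a := InformationTheory.klDiv μ
    (ν.withDensity fun x => ENNReal.ofReal (Real.exp (f x))))
  have h1 := ENNReal.toReal_mono ENNReal.one_ne_top hmass
  rw [ENNReal.toReal_one] at h1
  exact ((ENNReal.toReal_eq_zero_iff _).1 (by linarith)).resolve_right h'

/-- Here the log-likelihood ratio is `f` itself. The sign of the integral ensures that
`ENNReal.ofReal` loses nothing. -/
theorem klDiv_withDensity_exp_left (hf : Measurable f)
    (hμ : μ = ν.withDensity fun x => ENNReal.ofReal (Real.exp (f x))) (hfi : Integrable f μ) :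
    InformationTheory.klDiv μ ν = ENNReal.ofReal (∫ x, f x ∂μ) ∧ 0 ≤ ∫ x, f x ∂μ := by
  have hac : μ ≪ ν := hμ ▸ withDensity_absolutelyContinuous _ _
  have hllr : llr μ ν =ᵐ[μ] f := by
    have h1 := hac.ae_le (Measure.rnDeriv_withDensity ν
      (f := fun x => ENNReal.ofReal (Real.exp (f x))) (by fun_prop))
    rw [← hμ] at h1
    filter_upwards [h1] with x hx
    simp only [llr_def]
    rw [hx, ENNReal.toReal_ofReal (Real.exp_nonneg _), Real.log_exp]
  have hint : Integrable (llr μ ν) μ := hfi.congr (hllr.mono fun x hx => hx.symm)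
  have := InformationTheory.toReal_klDiv_of_measure_eq hac (by simp)
  rw [integral_congr_ae hllr] at this
  exact ⟨by rw [← this, ENNReal.ofReal_toReal (InformationTheory.klDiv_ne_top hac hint)],
    this ▸ ENNReal.toReal_nonneg⟩

end KL

/-! ### The Gaussian test channel -/

/-- The law `𝒩(0, diag s)`. -/
noncomputable def diagGaussian {n : ℕ} (s : Fin n → ℝ) : Measure (Fin n → ℝ) :=
  Measure.pi fun i => gaussianReal 0 (s i).toNNReal

instance {n : ℕ} (s : Fin n → ℝ) : IsProbabilityMeasure (diagGaussian s) := by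
  unfold diagGaussian; infer_instance

/-- The tilted information density of the channel at slope `l`, for the output law
`𝒩(0, diag ν)`. -/
noncomputable def tiltExp {n : ℕ} (l : ℝ) (ν x y : Fin n → ℝ) : ℝ :=
  ∑ i, (l * x i ^ 2 / (1 + 2 * l * ν i) + Real.log (1 + 2 * l * ν i) / 2 - l * (x i - y i) ^ 2)

/-- The channel obtained by tilting `𝒩(0, diag ν)` by `exp (-l ‖x - y‖²)`. -/
noncomputable def testChannel {n : ℕ} (l : ℝ) (ν : Fin n → ℝ) :
    Kernel (Fin n → ℝ) (Fin n → ℝ) :=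
  (Kernel.const _ (diagGaussian ν)).withDensity
    fun x y => ENNReal.ofReal (Real.exp (tiltExp l ν x y))

/-- The coordinatewise distortion of the test channel, given the input. -/
noncomputable def condDist (l ν x : ℝ) : ℝ := x ^ 2 / (1 + 2 * l * ν) ^ 2 + ν / (1 + 2 * l * ν)

/-- The distortion of the test channel for the input law `𝒩(0, diag s)`. -/
noncomputable def avgDist {n : ℕ} (s ν : Fin n → ℝ) (l : ℝ) : ℝ :=
  (1 / (n : ℝ)) * ∑ i, (s i / (1 + 2 * l * ν i) ^ 2 + ν i / (1 + 2 * l * ν i))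

/-- The intercept of the supporting line of slope `-l`. -/
noncomputable def intercept {n : ℕ} (s ν : Fin n → ℝ) (l : ℝ) : ℝ :=
  (1 / (n : ℝ)) * ∑ i, (l * s i / (1 + 2 * l * ν i) + Real.log (1 + 2 * l * ν i) / 2)

section
variable {n : ℕ} {l : ℝ} {s ν : Fin n → ℝ}

theorem gain_pos (hl : 0 ≤ l) {v : ℝ} (hv : 0 ≤ v) : 0 < 1 + 2 * l * v := by positivity

@[fun_prop]
theorem measurable_tiltExp (l : ℝ) (ν : Fin n → ℝ) :
    Measurable (Function.uncurry (tiltExp l ν)) := by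
  unfold tiltExp Function.uncurry; fun_prop

theorem measurable_tiltExp_right (l : ℝ) (ν x : Fin n → ℝ) : Measurable (tiltExp l ν x) :=
  by unfold tiltExp; fun_prop

theorem testChannel_apply' (l : ℝ) (ν x : Fin n → ℝ) :
    testChannel l ν x = (diagGaussian ν).withDensity
      fun y => ENNReal.ofReal (Real.exp (tiltExp l ν x y)) := by
  rw [testChannel, Kernel.withDensity_apply _ (by
    exact (Real.measurable_exp.comp (measurable_tiltExp l ν)).ennreal_ofReal)]
  rfl

/-- Completing the square in `y`, with `A = l` and `B = 2 * l * x`; the terms of the tilt free of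
`y` are exactly the normalization. -/
theorem gaussianReal_withDensity_tilt (hl : 0 ≤ l) {v : ℝ} (hv : 0 ≤ v) (x : ℝ) :
    (gaussianReal 0 v.toNNReal).withDensity (fun y => ENNReal.ofReal (Real.exp
      (l * x ^ 2 / (1 + 2 * l * v) + Real.log (1 + 2 * l * v) / 2 - l * (x - y) ^ 2))) =
    gaussianReal (2 * l * x * (v / (1 + 2 * l * v))) (v / (1 + 2 * l * v)).toNNReal := by
  have hr := gain_pos hl hv
  rw [← gaussianReal_withDensity_exp hv hr]
  congr 1
  ext y
  congr 2
  generalize Real.log (1 + 2 * l * v) = L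
  have := hr.ne'
  field_simp
  ring

theorem testChannel_apply (hl : 0 ≤ l) (hν : ∀ i, 0 ≤ ν i) (x : Fin n → ℝ) :
    testChannel l ν x = Measure.pi fun i =>
      gaussianReal (2 * l * x i * (ν i / (1 + 2 * l * ν i))) (ν i / (1 + 2 * l * ν i)).toNNReal := by
  have h := fun i => gaussianReal_withDensity_tilt hl (hν i) (x i)
  simp_rw [← h]
  have : ∀ i, SigmaFinite ((gaussianReal 0 (ν i).toNNReal).withDensity
      (fun y => ENNReal.ofReal (Real.exp (l * x i ^ 2 / (1 + 2 * l * ν i) +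
        Real.log (1 + 2 * l * ν i) / 2 - l * (x i - y) ^ 2)))) := fun i => by
    rw [h]; infer_instance
  rw [pi_withDensity _ (fun i => by fun_prop), testChannel_apply', diagGaussian]
  congr 1
  ext y
  rw [tiltExp, Real.exp_sum, ENNReal.ofReal_prod_of_nonneg fun i _ => (Real.exp_nonneg _)]

theorem isMarkovKernel_testChannel (hl : 0 ≤ l) (hν : ∀ i, 0 ≤ ν i) :
    IsMarkovKernel (testChannel l ν) :=
  ⟨fun x => by rw [testChannel_apply hl hν]; infer_instance⟩

theorem integrable_sq_sub_gaussianReal (m x : ℝ) (w : NNReal) :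
    Integrable (fun y => (y - x) ^ 2) (gaussianReal m w) := by
  have := ((memLp_id_gaussianReal (μ := m) (v := w) 2).sub (memLp_const x)).integrable_sq
  simpa using this

theorem integral_sq_sub_gaussianReal (m x : ℝ) (w : NNReal) :
    ∫ y, (y - x) ^ 2 ∂(gaussianReal m w) = (m - x) ^ 2 + w := by
  have h1 := variance_fun_id_gaussianReal (μ := m) (v := w)
  rw [variance_eq_integral (by fun_prop)] at h1
  simp only [integral_id_gaussianReal] at h1
  have hi : Integrable (fun y : ℝ => y) (gaussianReal m w) :=
    (memLp_id_gaussianReal (μ := m) (v := w) 1).integrable (by simp)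
  have h2 : ∀ y : ℝ, (y - x) ^ 2 = (y - m) ^ 2 + (2 * (m - x) * y - (m - x) * (m + x)) :=
    fun y => by ring
  simp_rw [h2]
  have hi2 : Integrable (fun y : ℝ => 2 * (m - x) * y - (m - x) * (m + x)) (gaussianReal m w) :=
    (hi.const_mul _).sub (integrable_const _)
  rw [integral_add (integrable_sq_sub_gaussianReal m m w) hi2, integral_sub (hi.const_mul _)
    (integrable_const _), integral_const_mul, h1, integral_id_gaussianReal]
  simp
  ring

theorem integrable_testChannel_sq (hl : 0 ≤ l) (hν : ∀ i, 0 ≤ ν i) (x : Fin n → ℝ) (i : Fin n) :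
    Integrable (fun y => (y i - x i) ^ 2) (testChannel l ν x) := by
  rw [testChannel_apply hl hν]
  exact integrable_comp_eval (i := i) (X := fun _ => ℝ) (f := fun y : ℝ => (y - x i) ^ 2)
    (integrable_sq_sub_gaussianReal _ (x i) _)

theorem integral_testChannel_sq (hl : 0 ≤ l) (hν : ∀ i, 0 ≤ ν i) (x : Fin n → ℝ) (i : Fin n) :
    ∫ y, (y i - x i) ^ 2 ∂(testChannel l ν x) = condDist l (ν i) (x i) := by
  rw [testChannel_apply hl hν]
  have hr := gain_pos hl (hν i)
  rw [integral_comp_eval (i := i) (X := fun _ => ℝ) (f := fun y : ℝ => (y - x i) ^ 2) (by fun_prop),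
    integral_sq_sub_gaussianReal, Real.coe_toNNReal _ (div_nonneg (hν i) hr.le), condDist]
  field_simp
  ring

theorem integrable_sq_diagGaussian (s : Fin n → ℝ) (i : Fin n) :
    Integrable (fun x => x i ^ 2) (diagGaussian s) := by
  have := integrable_sq_sub_gaussianReal 0 0 (s i).toNNReal
  simp only [sub_zero] at this
  exact integrable_comp_eval (i := i) (X := fun _ => ℝ) (f := fun y : ℝ => y ^ 2) this

theorem integral_sq_diagGaussian (hs : ∀ i, 0 ≤ s i) (i : Fin n) :
    ∫ x, x i ^ 2 ∂(diagGaussian s) = s i := by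
  have h0 := integral_sq_sub_gaussianReal 0 0 (s i).toNNReal
  simp only [sub_zero] at h0
  rw [diagGaussian, integral_comp_eval (i := i) (X := fun _ => ℝ) (f := fun y : ℝ => y ^ 2) (by fun_prop), h0]
  simp [hs i]

theorem mse_nonneg (x y : Fin n → ℝ) : 0 ≤ mse x y := by unfold mse; positivity

theorem measurable_mse : Measurable fun z : (Fin n → ℝ) × (Fin n → ℝ) => mse z.1 z.2 := by
  unfold mse; fun_prop

/-- This isolates the dependence on `y`: it enters only through the distortion, linearly. -/
theorem tiltExp_eq (hn : 0 < n) (l : ℝ) (ν x y : Fin n → ℝ) :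
    tiltExp l ν x y = ∑ i, (l / (1 + 2 * l * ν i) * x i ^ 2 + Real.log (1 + 2 * l * ν i) / 2)
      - l * n * mse x y := by
  have : (n : ℝ) ≠ 0 := by positivity
  rw [tiltExp, mse, Finset.sum_sub_distrib, ← Finset.mul_sum]
  congr 1
  · exact Finset.sum_congr rfl fun i _ => by ring
  · field_simp

theorem lintegral_mse_testChannel (hl : 0 ≤ l) (hs : ∀ i, 0 ≤ s i) (hν : ∀ i, 0 ≤ ν i) :
    Integrable (fun z => mse z.1 z.2) (diagGaussian s ⊗ₘ testChannel l ν) ∧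
    ∫ z, mse z.1 z.2 ∂(diagGaussian s ⊗ₘ testChannel l ν) = avgDist s ν l := by
  have := isMarkovKernel_testChannel hl hν
  have h1 : ∀ x : Fin n → ℝ, ∫ y, mse x y ∂(testChannel l ν x) =
      (1 / (n : ℝ)) * ∑ i, condDist l (ν i) (x i) := fun x => by
    simp only [mse]
    rw [integral_const_mul, integral_finsetSum]
    · simp_rw [← integral_testChannel_sq hl hν x, sub_sq_comm]
    · intro i _
      simp_rw [sub_sq_comm (x i)]
      exact integrable_testChannel_sq hl hν x i
  have hci : ∀ i, Integrable (fun x : Fin n → ℝ => condDist l (ν i) (x i)) (diagGaussian s) :=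
    fun i => ((integrable_sq_diagGaussian s i).div_const _).add (integrable_const _)
  have hint : Integrable (fun z => mse z.1 z.2) (diagGaussian s ⊗ₘ testChannel l ν) := by
    rw [Measure.integrable_compProd_iff measurable_mse.aestronglyMeasurable]
    constructor
    · refine ae_of_all _ fun x => ?_
      refine (integrable_finsetSum _ fun i _ => ?_).const_mul _
      simp_rw [sub_sq_comm (x i)]
      exact integrable_testChannel_sq hl hν x i
    · simp_rw [Real.norm_of_nonneg (mse_nonneg _ _), h1]
      exact (integrable_finsetSum _ fun i _ => hci i).const_mul _
  refine ⟨hint, ?_⟩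
  rw [Measure.integral_compProd hint]
  simp_rw [h1]
  rw [integral_const_mul, integral_finsetSum _ fun i _ => hci i, avgDist]
  congr 1
  refine Finset.sum_congr rfl fun i _ => ?_
  simp only [condDist]
  rw [integral_add ((integrable_sq_diagGaussian s i).div_const _) (integrable_const _),
    integral_div, integral_sq_diagGaussian hs]
  simp

/-- The input marginal is fixed, so the mean tilt sees the channel only through its mean distortion.
This is what turns Donsker–Varadhan into an affine bound in the distortion level. -/
theorem integral_tiltExp (hn : 0 < n) (hs : ∀ i, 0 ≤ s i) {K : Kernel (Fin n → ℝ) (Fin n → ℝ)}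
    [IsMarkovKernel K] (hK : Integrable (fun z => mse z.1 z.2) (diagGaussian s ⊗ₘ K)) :
    Integrable (fun z => tiltExp l ν z.1 z.2) (diagGaussian s ⊗ₘ K) ∧
    ∫ z, tiltExp l ν z.1 z.2 ∂(diagGaussian s ⊗ₘ K) =
      n * (intercept s ν l - l * ∫ z, mse z.1 z.2 ∂(diagGaussian s ⊗ₘ K)) := by
  have hfst : (diagGaussian s ⊗ₘ K).map Prod.fst = diagGaussian s := Measure.fst_compProd _ _
  have hi : ∀ i, Integrable (fun z : (Fin n → ℝ) × (Fin n → ℝ) =>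
      l / (1 + 2 * l * ν i) * z.1 i ^ 2 + Real.log (1 + 2 * l * ν i) / 2)
      (diagGaussian s ⊗ₘ K) := fun i => by
    refine (Integrable.const_mul ?_ _).add (integrable_const _)
    have := integrable_sq_diagGaussian s i
    rw [← hfst] at this
    exact this.comp_measurable measurable_fst
  have hv : ∀ i, ∫ z : (Fin n → ℝ) × (Fin n → ℝ), z.1 i ^ 2 ∂(diagGaussian s ⊗ₘ K) = s i :=
    fun i => by
    rw [← integral_sq_diagGaussian hs i]
    conv_rhs => rw [← hfst]
    rw [integral_map (by fun_prop)
      (by exact ((measurable_pi_apply i).pow_const 2).aestronglyMeasurable)]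
  simp_rw [tiltExp_eq hn]
  have hsum := integrable_finsetSum (μ := diagGaussian s ⊗ₘ K) Finset.univ fun i _ => hi i
  refine ⟨hsum.sub (hK.const_mul _), ?_⟩
  rw [integral_sub hsum (hK.const_mul _), integral_const_mul,
    integral_finsetSum _ fun i _ => hi i, intercept]
  have : (n : ℝ) ≠ 0 := by positivity
  have h2 : ∀ i, ∫ z : (Fin n → ℝ) × (Fin n → ℝ),
      (l / (1 + 2 * l * ν i) * z.1 i ^ 2 + Real.log (1 + 2 * l * ν i) / 2)
      ∂(diagGaussian s ⊗ₘ K) = l * s i / (1 + 2 * l * ν i) + Real.log (1 + 2 * l * ν i) / 2 :=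
    fun i => by
    have h3 : Integrable (fun z : (Fin n → ℝ) × (Fin n → ℝ) => z.1 i ^ 2)
      (diagGaussian s ⊗ₘ K) := by
      have := integrable_sq_diagGaussian s i
      rw [← hfst] at this
      exact this.comp_measurable measurable_fst
    rw [integral_add (h3.const_mul _) (integrable_const _), integral_const_mul, hv]
    simp
    ring
  simp_rw [h2]
  rw [mul_sub, ← mul_assoc, mul_one_div_cancel this, one_mul]
  ring

theorem IsFeasible.integrable_mse {P : Measure (Fin n → ℝ)} [IsProbabilityMeasure P] {t : ℝ}
    (ht : 0 ≤ t) {K : Kernel (Fin n → ℝ) (Fin n → ℝ)} (hK : IsFeasible P t K) :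
    Integrable (fun z => mse z.1 z.2) (P ⊗ₘ K) ∧ ∫ z, mse z.1 z.2 ∂(P ⊗ₘ K) ≤ t := by
  have h0 : 0 ≤ᵐ[P ⊗ₘ K] fun z => mse z.1 z.2 := ae_of_all _ fun z => mse_nonneg _ _
  constructor
  · refine ⟨measurable_mse.aestronglyMeasurable, ?_⟩
    rw [hasFiniteIntegral_iff_ofReal h0]
    exact hK.2.trans_lt ENNReal.ofReal_lt_top
  · rw [integral_eq_lintegral_of_nonneg_ae h0 measurable_mse.aestronglyMeasurable]
    exact ENNReal.toReal_le_of_le_ofReal ht hK.2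

theorem isFeasible_of_integral_le {P : Measure (Fin n → ℝ)} {t : ℝ}
    {K : Kernel (Fin n → ℝ) (Fin n → ℝ)} [IsMarkovKernel K]
    (hi : Integrable (fun z => mse z.1 z.2) (P ⊗ₘ K)) (h : ∫ z, mse z.1 z.2 ∂(P ⊗ₘ K) ≤ t) :
    IsFeasible P t K := by
  refine ⟨inferInstance, ?_⟩
  rw [← ofReal_integral_eq_lintegral_ofReal hi (ae_of_all _ fun z => mse_nonneg _ _)]
  exact ENNReal.ofReal_le_ofReal h

theorem inv_natCast_mul_ofReal (hn : 0 < n) (x : ℝ) :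
    (n : ℝ≥0∞)⁻¹ * ENNReal.ofReal (n * x) = ENNReal.ofReal x := by
  rw [ENNReal.ofReal_mul (by positivity), ENNReal.ofReal_natCast, ← mul_assoc,
    ENNReal.inv_mul_cancel (by positivity) (by simp), one_mul]

theorem lintegral_exp_tiltExp (hl : 0 ≤ l) (hν : ∀ i, 0 ≤ ν i) (x : Fin n → ℝ) :
    ∫⁻ y, ENNReal.ofReal (Real.exp (tiltExp l ν x y)) ∂(diagGaussian ν) = 1 := by
  have := isMarkovKernel_testChannel hl hν
  have h : testChannel l ν x Set.univ = 1 := measure_univ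
  rwa [testChannel_apply', withDensity_apply _ MeasurableSet.univ, Measure.restrict_univ] at h

/-! ### Conditional relative entropy minimization -/

theorem ofReal_le_condRelEntropy (hn : 0 < n) (hl : 0 ≤ l) (hs : ∀ i, 0 ≤ s i)
    (hν : ∀ i, 0 ≤ ν i) {t : ℝ} (ht : 0 ≤ t) {K : Kernel (Fin n → ℝ) (Fin n → ℝ)}
    (hK : IsFeasible (diagGaussian s) t K) :
    ENNReal.ofReal (n * (intercept s ν l - l * t)) ≤
      condRelEntropy (diagGaussian s) (diagGaussian ν) K := by
  have := hK.1
  obtain ⟨h1, h2⟩ := hK.integrable_mse ht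
  obtain ⟨h3, h4⟩ := integral_tiltExp (l := l) (ν := ν) hn hs h1
  have hx3 : Integrable (fun x => ∫ y, tiltExp l ν x y ∂(K x)) (diagGaussian s) :=
    h3.integral_compProd
  calc ENNReal.ofReal (n * (intercept s ν l - l * t))
      ≤ ENNReal.ofReal (∫ z, tiltExp l ν z.1 z.2 ∂(diagGaussian s ⊗ₘ K)) := by
        rw [h4]; gcongr
    _ = ENNReal.ofReal (∫ x, ∫ y, tiltExp l ν x y ∂(K x) ∂(diagGaussian s)) := by
        rw [Measure.integral_compProd h3]
    -- The inner integral may be negative for some `x`; dropping its negative part only increases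
    -- the right side.
    _ ≤ ∫⁻ x, ENNReal.ofReal (∫ y, tiltExp l ν x y ∂(K x)) ∂(diagGaussian s) := by
        rw [integral_eq_lintegral_pos_part_sub_lintegral_neg_part hx3]
        exact (ENNReal.ofReal_le_ofReal (sub_le_self _ ENNReal.toReal_nonneg)).trans
          ENNReal.ofReal_toReal_le
    _ ≤ _ := by
        refine lintegral_mono_ae ?_
        filter_upwards [((Measure.integrable_compProd_iff h3.1).1 h3).1] with x hx
        exact ofReal_integral_le_klDiv (measurable_tiltExp_right _ _ _) hx
          (lintegral_exp_tiltExp hl hν x).le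

/-- For almost every input the channel is the tilt of the reference, so the Donsker–Varadhan bound
is attained pointwise. -/
theorem condRelEntropy_testChannel (hn : 0 < n) (hl : 0 ≤ l) (hs : ∀ i, 0 ≤ s i)
    (hν : ∀ i, 0 ≤ ν i) :
    condRelEntropy (diagGaussian s) (diagGaussian ν) (testChannel l ν) =
      ENNReal.ofReal (n * (intercept s ν l - l * avgDist s ν l)) ∧
    0 ≤ intercept s ν l - l * avgDist s ν l := by
  have := isMarkovKernel_testChannel hl hν
  obtain ⟨h1, h2⟩ := lintegral_mse_testChannel hl hs hν
  obtain ⟨h3, h4⟩ := integral_tiltExp (l := l) (ν := ν) hn hs h1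
  have hx3 : Integrable (fun x => ∫ y, tiltExp l ν x y ∂(testChannel l ν x)) (diagGaussian s) :=
    h3.integral_compProd
  rw [h2, Measure.integral_compProd h3] at h4
  have hk : ∀ᵐ x ∂(diagGaussian s), InformationTheory.klDiv (testChannel l ν x) (diagGaussian ν) =
      ENNReal.ofReal (∫ y, tiltExp l ν x y ∂(testChannel l ν x)) ∧
      0 ≤ ∫ y, tiltExp l ν x y ∂(testChannel l ν x) := by
    filter_upwards [((Measure.integrable_compProd_iff h3.1).1 h3).1] with x hx
    exact klDiv_withDensity_exp_left (measurable_tiltExp_right _ _ _) (testChannel_apply' l ν x) hx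
  have h5 : 0 ≤ᵐ[diagGaussian s] fun x => ∫ y, tiltExp l ν x y ∂(testChannel l ν x) :=
    hk.mono fun x hx => hx.2
  constructor
  · rw [condRelEntropy, lintegral_congr_ae (hk.mono fun x hx => hx.1),
      ← ofReal_integral_eq_lintegral_ofReal hx3 h5]
    exact congrArg _ h4
  · have := integral_nonneg_of_ae h5
    rw [show ∫ x, ∫ y, tiltExp l ν x y ∂(testChannel l ν x) ∂(diagGaussian s) = _ from h4] at this
    exact nonneg_of_mul_nonneg_right this (by positivity)

theorem ofReal_le_crem (hn : 0 < n) (hl : 0 ≤ l) (hs : ∀ i, 0 ≤ s i)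
    (hν : ∀ i, 0 ≤ ν i) {t : ℝ} (ht : 0 ≤ t) :
    ENNReal.ofReal (intercept s ν l - l * t) ≤ crem (diagGaussian s) (diagGaussian ν) t := by
  refine le_iInf₂ fun K hK => ?_
  rw [← inv_natCast_mul_ofReal hn]
  gcongr
  exact ofReal_le_condRelEntropy hn hl hs hν ht hK

theorem avgDist_nonneg (hl : 0 ≤ l) (hs : ∀ i, 0 ≤ s i) (hν : ∀ i, 0 ≤ ν i) :
    0 ≤ avgDist s ν l := by
  have := fun i => hs i
  unfold avgDist
  refine mul_nonneg (by positivity) (Finset.sum_nonneg fun i _ => ?_)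
  exact add_nonneg (div_nonneg (hs i) (by positivity))
    (div_nonneg (hν i) (gain_pos hl (hν i)).le)

theorem isFeasible_testChannel (hl : 0 ≤ l) (hs : ∀ i, 0 ≤ s i) (hν : ∀ i, 0 ≤ ν i) :
    IsFeasible (diagGaussian s) (avgDist s ν l) (testChannel l ν) := by
  have := isMarkovKernel_testChannel hl hν
  obtain ⟨h1, h2⟩ := lintegral_mse_testChannel hl hs hν
  exact isFeasible_of_integral_le h1 h2.le

theorem crem_avgDist (hn : 0 < n) (hl : 0 ≤ l) (hs : ∀ i, 0 ≤ s i) (hν : ∀ i, 0 ≤ ν i) :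
    crem (diagGaussian s) (diagGaussian ν) (avgDist s ν l) =
      ENNReal.ofReal (intercept s ν l - l * avgDist s ν l) ∧
    IsCREMOptimizer (diagGaussian s) (diagGaussian ν) (avgDist s ν l) (testChannel l ν) := by
  have hf := isFeasible_testChannel hl hs hν
  have h1 : (n : ℝ≥0∞)⁻¹ * condRelEntropy (diagGaussian s) (diagGaussian ν) (testChannel l ν) =
      ENNReal.ofReal (intercept s ν l - l * avgDist s ν l) := by
    rw [(condRelEntropy_testChannel hn hl hs hν).1, inv_natCast_mul_ofReal hn]
  have h2 : crem (diagGaussian s) (diagGaussian ν) (avgDist s ν l) =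
      ENNReal.ofReal (intercept s ν l - l * avgDist s ν l) :=
    le_antisymm ((iInf₂_le _ hf).trans_eq h1)
      (ofReal_le_crem hn hl hs hν (avgDist_nonneg hl hs hν))
  exact ⟨h2, hf, by rw [h1, h2]⟩

/-- Given the whole input, the mean squared error of coordinate `i` depends on `x i` alone. It
therefore has the right integrals over events determined by `x i`, and it is continuous. -/
theorem isCondDistortion_testChannel (hl : 0 ≤ l) (hν : ∀ i, 0 ≤ ν i)
    (i : Fin n) :
    IsCondDistortion (diagGaussian s ⊗ₘ testChannel l ν) i (condDist l (ν i)) := by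
  have := isMarkovKernel_testChannel hl hν
  have hc : Continuous (condDist l (ν i)) := by unfold condDist; fun_prop
  refine ⟨hc, ?_⟩
  set J := diagGaussian s ⊗ₘ testChannel l ν
  have hm : MeasurableSpace.comap (fun z : (Fin n → ℝ) × (Fin n → ℝ) => z.1 i) inferInstance
      ≤ (inferInstance : MeasurableSpace ((Fin n → ℝ) × (Fin n → ℝ))) :=
    Measurable.comap_le (by fun_prop)
  have hci : Integrable (fun x : Fin n → ℝ => condDist l (ν i) (x i)) (diagGaussian s) :=
    ((integrable_sq_diagGaussian s i).div_const _).add (integrable_const _)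
  have hint : Integrable (fun z : (Fin n → ℝ) × (Fin n → ℝ) => (z.2 i - z.1 i) ^ 2) J := by
    rw [Measure.integrable_compProd_iff (by fun_prop)]
    refine ⟨ae_of_all _ fun x => integrable_testChannel_sq hl hν x i, ?_⟩
    simp_rw [Real.norm_of_nonneg (sq_nonneg _), integral_testChannel_sq hl hν]
    exact hci
  have hcJ : Integrable (fun z : (Fin n → ℝ) × (Fin n → ℝ) => condDist l (ν i) (z.1 i)) J := by
    have hfst : J.map Prod.fst = diagGaussian s := Measure.fst_compProd _ _
    rw [← hfst] at hci
    exact hci.comp_measurable measurable_fst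
  refine (ae_eq_condExp_of_forall_setIntegral_eq hm hint (fun _ _ _ => hcJ.integrableOn) ?_ ?_).symm
  · rintro B ⟨A, hA, rfl⟩ -
    have hA' : MeasurableSet ((fun x : Fin n → ℝ => x i) ⁻¹' A) := hA.preimage (by fun_prop)
    have hB : (fun z : (Fin n → ℝ) × (Fin n → ℝ) => z.1 i) ⁻¹' A =
        ((fun x : Fin n → ℝ => x i) ⁻¹' A) ×ˢ Set.univ := by ext; simp
    rw [hB, Measure.setIntegral_compProd hA' MeasurableSet.univ hint.integrableOn,
      Measure.setIntegral_compProd hA' MeasurableSet.univ hcJ.integrableOn]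
    simp [integral_testChannel_sq hl hν]
  · exact (hc.stronglyMeasurable.comp_measurable (comap_measurable _)).aestronglyMeasurable

end

/-! ### Characteristic functions of diagonal Gaussians. -/

theorem charFunDual_gaussianReal (v : NNReal) (L : StrongDual ℝ ℝ) :
    charFunDual (gaussianReal 0 v) L = Complex.exp (-(v * (L 1) ^ 2 : ℝ) / 2) := by
  rw [IsGaussian.charFunDual_eq, integral_complex_ofReal, integral_continuousLinearMap_gaussianReal,
    variance_continuousLinearMap_gaussianReal]
  congr 1
  simp only [map_zero, Real.coe_toNNReal _ (sq_nonneg _)]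
  simp [mul_comm, neg_div]

theorem charFunDual_diagGaussian {n : ℕ} {s : Fin n → ℝ} (hs : ∀ i, 0 ≤ s i)
    (L : StrongDual ℝ (Fin n → ℝ)) :
    charFunDual (diagGaussian s) L =
      Complex.exp (-(∑ i, s i * (L (Pi.single i 1)) ^ 2 : ℝ) / 2) := by
  rw [diagGaussian, charFunDual_pi]
  simp_rw [charFunDual_gaussianReal]
  rw [← Complex.exp_sum]
  congr 1
  push_cast
  rw [← Finset.sum_div, Finset.sum_neg_distrib]
  congr 2
  refine Finset.sum_congr rfl fun i _ => ?_
  simp [hs i]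

/-! ### The rate-distortion function of a Gaussian vector -/

/-- Reverse waterfilling at the water level `1 / (2 l)`. -/
noncomputable def waterfill {n : ℕ} (s : Fin n → ℝ) (l : ℝ) (i : Fin n) : ℝ :=
  max (s i - 1 / (2 * l)) 0

theorem waterfill_nonneg {n : ℕ} (s : Fin n → ℝ) (l : ℝ) (i : Fin n) : 0 ≤ waterfill s l i :=
  le_max_right _ _

/-- Above the water level, `1 + 2 * l * ν = 2 * l * s` and the tilt is normalized in the input too.
Below it `ν = 0`, and mass is lost by the factor `exp (-l (1 - 2 l s) y²)`. The `min` covers both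
cases. -/
theorem lintegral_reverse {s l : ℝ} (hs : 0 ≤ s) (hl : 0 < l) (y : ℝ) :
    ∫⁻ x, ENNReal.ofReal (Real.exp (l * x ^ 2 / (1 + 2 * l * max (s - 1 / (2 * l)) 0) +
      Real.log (1 + 2 * l * max (s - 1 / (2 * l)) 0) / 2 - l * (x - y) ^ 2))
      ∂(gaussianReal 0 s.toNNReal) =
    ENNReal.ofReal (Real.exp (-(l * (1 - min (2 * l * s) 1) * y ^ 2))) := by
  rcases le_or_gt (s - 1 / (2 * l)) 0 with h | h
  · have h1 : 2 * l * s ≤ 1 := by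
      rw [sub_nonpos, le_div_iff₀ (by positivity)] at h; linarith
    rw [max_eq_right h, min_eq_left h1]
    have e : ∀ x : ℝ, l * x ^ 2 / (1 + 2 * l * 0) + Real.log (1 + 2 * l * 0) / 2 - l * (x - y) ^ 2 =
        -0 * x ^ 2 + (2 * l * y) * x + (-l * y ^ 2) := fun x => by simp; ring
    simp_rw [e]
    rw [lintegral_exp_gaussianReal hs (by norm_num)]
    congr 2
    simp
    ring
  · have h1 : 1 < 2 * l * s := by
      rw [sub_pos, div_lt_iff₀ (by positivity)] at h; linarith
    have hs0 : 0 < s := (show (0:ℝ) < 1 / (2 * l) by positivity).trans (sub_pos.1 h)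
    have hr : 1 + 2 * l * (s - 1 / (2 * l)) = 2 * l * s := by field_simp; ring
    rw [max_eq_left h.le, min_eq_right h1.le, hr]
    have hA : 1 + 2 * (l - 1 / (2 * s)) * s = 2 * l * s := by field_simp; ring
    have e : ∀ x : ℝ, l * x ^ 2 / (2 * l * s) + Real.log (2 * l * s) / 2 - l * (x - y) ^ 2 =
        -(l - 1 / (2 * s)) * x ^ 2 + (2 * l * y) * x + (Real.log (2 * l * s) / 2 - l * y ^ 2) :=
      fun x => by field_simp; ring
    simp_rw [e]
    rw [lintegral_exp_gaussianReal hs (by rw [hA]; linarith), hA]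
    congr 2
    field_simp
    ring

/-- When no mass is lost, the reverse channel is a translate by `y` of noise whose law does not
depend on `y`. This makes deconvolution possible. -/
theorem withDensity_reverse {s l y : ℝ} (hs : 0 ≤ s) (hl : 0 < l)
    (hy : (1 - min (2 * l * s) 1) * y ^ 2 = 0) :
    (gaussianReal 0 s.toNNReal).withDensity (fun x => ENNReal.ofReal (Real.exp
      (l * x ^ 2 / (1 + 2 * l * max (s - 1 / (2 * l)) 0) +
      Real.log (1 + 2 * l * max (s - 1 / (2 * l)) 0) / 2 - l * (x - y) ^ 2))) =
    gaussianReal y (min s (1 / (2 * l))).toNNReal := by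
  rcases le_or_gt (s - 1 / (2 * l)) 0 with h | h
  · have h1 : 2 * l * s ≤ 1 := by
      rw [sub_nonpos, le_div_iff₀ (by positivity)] at h; linarith
    rw [min_eq_left h1] at hy
    rw [max_eq_right h, min_eq_left (sub_nonpos.1 h)]
    have e := gaussianReal_withDensity_exp (s := s) (A := 0) (B := 2 * l * y) hs (by norm_num)
    have e1 : 2 * l * y * (s / (1 + 2 * 0 * s)) = y := by
      rcases mul_eq_zero.1 hy with h2 | h2
      · simp; linear_combination -y * h2
      · simp [pow_eq_zero_iff two_ne_zero |>.1 h2]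
    rw [e1, show s / (1 + 2 * 0 * s) = s by simp] at e
    rw [← e]
    congr 1
    ext x
    congr 2
    simp
    linear_combination -l * hy
  · have hs0 : 0 < s := (show (0:ℝ) < 1 / (2 * l) by positivity).trans (sub_pos.1 h)
    have hr : 1 + 2 * l * (s - 1 / (2 * l)) = 2 * l * s := by field_simp; ring
    rw [max_eq_left h.le, hr, min_eq_right (sub_pos.1 h).le]
    have hA : 1 + 2 * (l - 1 / (2 * s)) * s = 2 * l * s := by field_simp; ring
    have e := gaussianReal_withDensity_exp (s := s) (A := l - 1 / (2 * s)) (B := 2 * l * y) hs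
      (by rw [hA]; positivity)
    rw [hA] at e
    rw [show 2 * l * y * (s / (2 * l * s)) = y by field_simp,
      show s / (2 * l * s) = 1 / (2 * l) by field_simp] at e
    rw [← e]
    congr 1
    ext x
    congr 2
    field_simp
    ring

section
variable {n : ℕ} {l : ℝ} {s : Fin n → ℝ}

theorem lintegral_tiltExp_left (hl : 0 < l) (hs : ∀ i, 0 ≤ s i) (y : Fin n → ℝ) :
    ∫⁻ x, ENNReal.ofReal (Real.exp (tiltExp l (waterfill s l) x y)) ∂(diagGaussian s) =
      ∏ i, ENNReal.ofReal (Real.exp (-(l * (1 - min (2 * l * s i) 1) * y i ^ 2))) := by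
  simp_rw [← fun i => lintegral_reverse (hs i) hl (y i)]
  rw [← lintegral_pi_prod _ fun i => by fun_prop, diagGaussian]
  refine lintegral_congr fun x => ?_
  rw [tiltExp, Real.exp_sum, ENNReal.ofReal_prod_of_nonneg fun i _ => (Real.exp_nonneg _)]
  rfl

theorem reverse_factor_le_one (hl : 0 < l) (i : Fin n) (y : ℝ) :
    ENNReal.ofReal (Real.exp (-(l * (1 - min (2 * l * s i) 1) * y ^ 2))) ≤ 1 := by
  have : 0 ≤ 1 - min (2 * l * s i) 1 := sub_nonneg.2 (min_le_right _ _)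
  rw [← ENNReal.ofReal_one]
  refine ENNReal.ofReal_le_ofReal (Real.exp_le_one_iff.2 ?_)
  have : 0 ≤ l * (1 - min (2 * l * s i) 1) * y ^ 2 := by positivity
  linarith

theorem lintegral_tiltExp_left_le (hl : 0 < l) (hs : ∀ i, 0 ≤ s i) (y : Fin n → ℝ) :
    ∫⁻ x, ENNReal.ofReal (Real.exp (tiltExp l (waterfill s l) x y)) ∂(diagGaussian s) ≤ 1 := by
  rw [lintegral_tiltExp_left hl hs]
  exact Finset.prod_le_one' fun i _ => reverse_factor_le_one hl i _

/-- A product of factors at most one equals one only if each does; this forces the coordinates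
strictly below the water level to vanish. -/
theorem lintegral_tiltExp_left_eq_one_iff (hl : 0 < l) (hs : ∀ i, 0 ≤ s i) (y : Fin n → ℝ) :
    ∫⁻ x, ENNReal.ofReal (Real.exp (tiltExp l (waterfill s l) x y)) ∂(diagGaussian s) = 1 ↔
      ∀ i, (1 - min (2 * l * s i) 1) * y i ^ 2 = 0 := by
  rw [lintegral_tiltExp_left hl hs,
    Finset.prod_eq_one_iff_of_le_one' fun i _ => reverse_factor_le_one hl i _]
  refine ⟨fun h i => ?_, fun h i _ => ?_⟩
  · have := h i (Finset.mem_univ i)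
    rw [ENNReal.ofReal_eq_one, Real.exp_eq_one_iff, neg_eq_zero, mul_assoc] at this
    exact (mul_eq_zero.1 this).resolve_left hl.ne'
  · rw [mul_assoc, h i]; simp

theorem withDensity_tiltExp_left (hl : 0 < l) (hs : ∀ i, 0 ≤ s i) {y : Fin n → ℝ}
    (hy : ∀ i, (1 - min (2 * l * s i) 1) * y i ^ 2 = 0) :
    (diagGaussian s).withDensity
      (fun x => ENNReal.ofReal (Real.exp (tiltExp l (waterfill s l) x y))) =
    (diagGaussian fun i => min (s i) (1 / (2 * l))).map (fun x => y + x) := by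
  have h := fun i => withDensity_reverse (hs i) hl (hy i)
  have hm : (diagGaussian fun i => min (s i) (1 / (2 * l))).map (fun x => y + x) =
      Measure.pi fun i => gaussianReal (y i) (min (s i) (1 / (2 * l))).toNNReal := by
    have := fun i => gaussianReal_map_const_add (μ := 0) (v := (min (s i) (1 / (2 * l))).toNNReal)
      (y i)
    simp only [zero_add] at this
    have hsf : ∀ i, SigmaFinite ((gaussianReal 0 (min (s i) (1 / (2 * l))).toNNReal).map
      (fun x => y i + x)) := fun i => by rw [this]; infer_instance
    simp_rw [← this]
    rw [← Measure.pi_map_pi (fun i => by fun_prop)]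
    rfl
  rw [hm]
  simp_rw [← h]
  have : ∀ i, SigmaFinite ((gaussianReal 0 (s i).toNNReal).withDensity
      (fun x => ENNReal.ofReal (Real.exp (l * x ^ 2 / (1 + 2 * l * max (s i - 1 / (2 * l)) 0) +
      Real.log (1 + 2 * l * max (s i - 1 / (2 * l)) 0) / 2 - l * (x - y i) ^ 2)))) := fun i => by
    rw [h]; infer_instance
  rw [pi_withDensity _ (fun i => by fun_prop), diagGaussian]
  congr 1
  ext x
  rw [tiltExp, Real.exp_sum, ENNReal.ofReal_prod_of_nonneg fun i _ => (Real.exp_nonneg _)]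
  rfl

theorem measurable_exp_tiltExp (l : ℝ) (ν : Fin n → ℝ) :
    Measurable fun z : (Fin n → ℝ) × (Fin n → ℝ) =>
      ENNReal.ofReal (Real.exp (tiltExp l ν z.1 z.2)) :=
  (Real.measurable_exp.comp (measurable_tiltExp l ν)).ennreal_ofReal

/-- Exchanging the integrals, the output law is `diagGaussian (waterfill s l)` weighted by the
reverse mass. That mass is one almost surely, since coordinates not above the water level are almost
surely zero. -/
theorem comp_testChannel (hl : 0 < l) (hs : ∀ i, 0 ≤ s i) :
    testChannel l (waterfill s l) ∘ₘ diagGaussian s = diagGaussian (waterfill s l) := by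
  have hm := measurable_exp_tiltExp l (waterfill s l)
  have h1 : ∀ᵐ y ∂(diagGaussian (waterfill s l)),
      ∫⁻ x, ENNReal.ofReal (Real.exp (tiltExp l (waterfill s l) x y)) ∂(diagGaussian s) = 1 := by
    simp_rw [lintegral_tiltExp_left_eq_one_iff hl hs]
    refine ae_all_iff.2 fun i => ?_
    rcases le_or_gt (s i - 1 / (2 * l)) 0 with h | h
    · have h2 : ∀ᵐ t ∂(gaussianReal 0 (waterfill s l i).toNNReal), t = 0 := by
        rw [waterfill, max_eq_right h]
        simp
      have := (measurePreserving_eval (fun i => gaussianReal 0 (waterfill s l i).toNNReal)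
        i).quasiMeasurePreserving.ae h2
      exact this.mono fun y hy => by
        rw [show y i = 0 from hy]; simp
    · refine ae_of_all _ fun y => ?_
      rw [min_eq_right]
      · simp
      · rw [sub_pos, div_lt_iff₀ (by positivity)] at h; linarith
  ext B hB
  rw [Measure.bind_apply hB (Kernel.aemeasurable _)]
  simp_rw [testChannel_apply', withDensity_apply _ hB]
  rw [lintegral_lintegral_swap (by exact hm.aemeasurable)]
  rw [lintegral_congr_ae (ae_restrict_of_ae h1)]
  simp

theorem compProd_testChannel (hl : 0 ≤ l) {ν : Fin n → ℝ} (hν : ∀ i, 0 ≤ ν i) :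
    diagGaussian s ⊗ₘ testChannel l ν = ((diagGaussian s).prod (diagGaussian ν)).withDensity
      fun z => ENNReal.ofReal (Real.exp (tiltExp l ν z.1 z.2)) := by
  have h := isMarkovKernel_testChannel hl hν
  rw [testChannel] at h ⊢
  rw [Measure.compProd_withDensity (measurable_exp_tiltExp l ν), Measure.compProd_const]

/-- `Q` is arbitrary: in mutual information the output law varies with the channel, and one tilt
must serve all of them. -/
theorem lintegral_prod_tiltExp_le (hl : 0 < l) (hs : ∀ i, 0 ≤ s i) (Q : Measure (Fin n → ℝ))
    [IsProbabilityMeasure Q] :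
    ∫⁻ z, ENNReal.ofReal (Real.exp (tiltExp l (waterfill s l) z.1 z.2)) ∂((diagGaussian s).prod Q)
      ≤ 1 := by
  rw [lintegral_prod_symm _ (measurable_exp_tiltExp l _).aemeasurable]
  exact (lintegral_mono fun y => lintegral_tiltExp_left_le hl hs y).trans (by simp)

theorem ofReal_le_mutualInfo (hn : 0 < n) (hl : 0 < l) (hs : ∀ i, 0 ≤ s i) {t : ℝ} (ht : 0 ≤ t)
    {K : Kernel (Fin n → ℝ) (Fin n → ℝ)} (hK : IsFeasible (diagGaussian s) t K) :
    ENNReal.ofReal (n * (intercept s (waterfill s l) l - l * t)) ≤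
      mutualInfo (diagGaussian s) K := by
  have := hK.1
  obtain ⟨h1, h2⟩ := hK.integrable_mse ht
  obtain ⟨h3, h4⟩ := integral_tiltExp (l := l) (ν := waterfill s l) hn hs h1
  refine le_trans ?_ (ofReal_integral_le_klDiv (measurable_tiltExp l (waterfill s l)) h3
    (lintegral_prod_tiltExp_le hl hs _))
  refine ENNReal.ofReal_le_ofReal ?_
  refine le_trans ?_ h4.ge
  gcongr

theorem ofReal_le_nthRDF (hn : 0 < n) (hl : 0 < l) (hs : ∀ i, 0 ≤ s i) {t : ℝ} (ht : 0 ≤ t) :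
    ENNReal.ofReal (intercept s (waterfill s l) l - l * t) ≤ nthRDF (diagGaussian s) t := by
  rw [← inv_natCast_mul_ofReal hn, nthRDF]
  gcongr
  exact le_iInf₂ fun K hK => ofReal_le_mutualInfo hn hl hs ht hK

theorem mutualInfo_testChannel (hn : 0 < n) (hl : 0 < l) (hs : ∀ i, 0 ≤ s i) :
    mutualInfo (diagGaussian s) (testChannel l (waterfill s l)) = ENNReal.ofReal
      (n * (intercept s (waterfill s l) l - l * avgDist s (waterfill s l) l)) := by
  have hν := waterfill_nonneg s l
  have := isMarkovKernel_testChannel hl.le hν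
  obtain ⟨h1, h2⟩ := lintegral_mse_testChannel hl.le hs hν
  obtain ⟨h3, h4⟩ := integral_tiltExp (l := l) (ν := waterfill s l) hn hs h1
  rw [mutualInfo, comp_testChannel hl hs, (klDiv_withDensity_exp_left
    (measurable_tiltExp l (waterfill s l)) (compProd_testChannel hl.le hν) h3).1, ← h2]
  exact congrArg _ h4

theorem nthRDF_avgDist (hn : 0 < n) (hl : 0 < l) (hs : ∀ i, 0 ≤ s i) :
    nthRDF (diagGaussian s) (avgDist s (waterfill s l) l) = ENNReal.ofReal
      (intercept s (waterfill s l) l - l * avgDist s (waterfill s l) l) ∧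
    IsRDFAchieving (diagGaussian s) (avgDist s (waterfill s l) l)
      (diagGaussian (waterfill s l)) := by
  have hf := isFeasible_testChannel hl.le hs (waterfill_nonneg s l)
  have h1 := congrArg ((n : ℝ≥0∞)⁻¹ * ·) (mutualInfo_testChannel hn hl hs)
  simp only [inv_natCast_mul_ofReal hn] at h1
  have h2 := le_antisymm ((mul_le_mul_right (iInf₂_le _ hf) _).trans_eq h1)
      (ofReal_le_nthRDF hn hl hs (avgDist_nonneg hl.le hs (waterfill_nonneg s l)))
  exact ⟨h2, _, hf, h1.trans h2.symm, (comp_testChannel hl hs).symm⟩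

/-- The reverse channel of a tilted product coupling is additive noise. -/
theorem diagGaussian_eq_conv (hl : 0 < l) (hs : ∀ i, 0 ≤ s i) {Q : Measure (Fin n → ℝ)}
    [IsProbabilityMeasure Q]
    (h : (((diagGaussian s).prod Q).withDensity
      fun z => ENNReal.ofReal (Real.exp (tiltExp l (waterfill s l) z.1 z.2))).map Prod.fst =
      diagGaussian s) :
    diagGaussian s = Q ∗ diagGaussian fun i => min (s i) (1 / (2 * l)) := by
  have hm := measurable_exp_tiltExp l (waterfill s l)
  have hB : ∀ B, MeasurableSet B → ∫⁻ y, ∫⁻ x in B,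
      ENNReal.ofReal (Real.exp (tiltExp l (waterfill s l) x y)) ∂(diagGaussian s) ∂Q =
      diagGaussian s B := fun B hB => by
    conv_rhs => rw [← h]
    rw [Measure.map_apply measurable_fst hB, withDensity_apply _ (measurable_fst hB),
      show Prod.fst ⁻¹' B = B ×ˢ (Set.univ : Set (Fin n → ℝ)) by ext; simp,
      ← Measure.prod_restrict, Measure.restrict_univ, lintegral_prod_symm _ hm.aemeasurable]
  have h1 : ∀ᵐ y ∂Q,
      ∫⁻ x, ENNReal.ofReal (Real.exp (tiltExp l (waterfill s l) x y)) ∂(diagGaussian s) = 1 := by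
    -- A function at most one whose integral against a probability measure is one equals one almost
    -- everywhere.
    refine ae_eq_of_ae_le_of_lintegral_le
      (ae_of_all _ fun y => lintegral_tiltExp_left_le hl hs y) ?_ (by fun_prop) ?_
    · exact ne_top_of_le_ne_top ENNReal.one_ne_top
        ((lintegral_mono fun y => lintegral_tiltExp_left_le hl hs y).trans (by simp))
    · have := hB _ MeasurableSet.univ
      rw [Measure.restrict_univ] at this
      rw [this]
      simp
  ext B hB'
  rw [← hB B hB', Measure.conv, Measure.map_apply (by fun_prop) hB',
    Measure.prod_apply (by measurability)]
  refine lintegral_congr_ae ?_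
  filter_upwards [h1] with y hy
  rw [lintegral_tiltExp_left_eq_one_iff hl hs] at hy
  rw [← withDensity_apply _ hB', withDensity_tiltExp_left hl hs hy,
    Measure.map_apply (by fun_prop) hB']
  rfl

/-- The characteristic function of a Gaussian never vanishes, so the noise factor cancels. -/
theorem eq_of_conv_diagGaussian_eq {Q Q' : Measure (Fin n → ℝ)} [IsProbabilityMeasure Q]
    [IsProbabilityMeasure Q'] {w : Fin n → ℝ} (hw : ∀ i, 0 ≤ w i)
    (h : Q ∗ diagGaussian w = Q' ∗ diagGaussian w) : Q = Q' := by
  refine Measure.ext_of_charFunDual (funext fun L => ?_)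
  have := congrArg (fun m => charFunDual m L) h
  simp only [charFunDual_conv] at this
  refine mul_right_cancel₀ ?_ this
  rw [charFunDual_diagGaussian hw]
  exact Complex.exp_ne_zero _

/-- An achieving channel attains the Donsker–Varadhan bound, so its coupling is the tilt of the
product of its marginals. The source law is then its output law convolved with a noise common to all
achieving channels, and the water-filled output satisfies the same equation. -/
theorem IsRDFAchieving.eq_diagGaussian (hn : 0 < n) (hl : 0 < l) (hs : ∀ i, 0 ≤ s i)
    {Q : Measure (Fin n → ℝ)}
    (hQ : IsRDFAchieving (diagGaussian s) (avgDist s (waterfill s l) l) Q) :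
    Q = diagGaussian (waterfill s l) := by
  obtain ⟨K, hK, hR, rfl⟩ := hQ
  have hν := waterfill_nonneg s l
  have := hK.1
  have := isMarkovKernel_testChannel hl.le hν
  obtain ⟨h1, h2⟩ := hK.integrable_mse (avgDist_nonneg hl.le hs hν)
  obtain ⟨h3, h4⟩ := integral_tiltExp (l := l) (ν := waterfill s l) hn hs h1
  have hpos := (condRelEntropy_testChannel hn hl.le hs hν).2
  have hn0 : (n : ℝ≥0∞) ≠ 0 := by positivity
  rw [(nthRDF_avgDist hn hl hs).1, ← inv_natCast_mul_ofReal hn,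
    ENNReal.mul_right_inj (by simp) (by simp [hn0])] at hR
  have key : diagGaussian s ⊗ₘ K = ((diagGaussian s).prod (K ∘ₘ diagGaussian s)).withDensity
      fun z => ENNReal.ofReal (Real.exp (tiltExp l (waterfill s l) z.1 z.2)) := by
    refine eq_withDensity_of_klDiv_eq (measurable_tiltExp l (waterfill s l)) h3
      (lintegral_prod_tiltExp_le hl hs _) ?_ ?_
    · rw [mutualInfo] at hR; rw [hR]; exact ENNReal.ofReal_ne_top
    · rw [mutualInfo] at hR
      rw [hR, ENNReal.toReal_ofReal (by positivity)]
      refine le_trans ?_ h4.ge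
      gcongr
  have e1 := diagGaussian_eq_conv hl hs (Q := K ∘ₘ diagGaussian s)
    (by rw [← key]; exact Measure.fst_compProd _ _)
  have e2 := diagGaussian_eq_conv hl hs (Q := diagGaussian (waterfill s l))
    (by rw [← compProd_testChannel hl.le hν]; exact Measure.fst_compProd _ _)
  exact eq_of_conv_diagGaussian_eq
    (fun i => le_min (hs i) (by positivity)) (e1.symm.trans e2)

end

/-! ### Slopes from supporting lines -/

/-- A function that is the upper envelope of a strictly ordered continuous family of supporting
lines is differentiable, with derivative the slope of the supporting line. -/
theorem hasNegSlopeAt_of_supporting {R : ℝ → ℝ≥0∞} {T V : ℝ → ℝ} {a b l d : ℝ}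
    (hal : a < l) (hlb : l < b) (hT : ContinuousOn T (Set.Icc a b))
    (hanti : StrictAntiOn T (Set.Icc a b)) (hTl : T l = d) (hd : 0 < d)
    (hge : ∀ m ∈ Set.Icc a b, ∀ t, 0 ≤ t → ENNReal.ofReal (V m - m * t) ≤ R t)
    (heq : ∀ m ∈ Set.Icc a b, R (T m) = ENNReal.ofReal (V m - m * T m) ∧ 0 ≤ V m - m * T m) :
    HasNegSlopeAt R d l := by
  have hl : l ∈ Set.Icc a b := ⟨hal.le, hlb.le⟩
  -- By strict monotonicity and the intermediate value theorem, every `t` near `d` is the contact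
  -- point of a line whose slope parameter is near `l`.
  have key : ∀ ε > 0, ∀ᶠ t in 𝓝 d, ∃ m ∈ Set.Icc a b, |m - l| ≤ ε ∧ T m = t := by
    intro ε hε
    set a' := max a (l - ε)
    set b' := min b (l + ε)
    have ha' : a' < l := max_lt hal (by linarith)
    have hb' : l < b' := lt_min hlb (by linarith)
    have hsub : Set.Icc a' b' ⊆ Set.Icc a b := Set.Icc_subset_Icc (le_max_left _ _) (min_le_left _ _)
    have h1 : T b' < d := hTl ▸ hanti hl (hsub ⟨(ha'.trans hb').le, le_rfl⟩) hb'
    have h2 : d < T a' := hTl ▸ hanti (hsub ⟨le_rfl, (ha'.trans hb').le⟩) hl ha'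
    filter_upwards [Ioo_mem_nhds h1 h2] with t ht
    obtain ⟨m, hm, rfl⟩ := intermediate_value_Icc' (ha'.trans hb').le (hT.mono hsub)
      ⟨ht.1.le, ht.2.le⟩
    refine ⟨m, hsub hm, abs_le.2 ⟨?_, ?_⟩, rfl⟩
    · linarith [(le_max_right a (l - ε)).trans hm.1]
    · linarith [hm.2.trans (min_le_right b (l + ε))]
  constructor
  · filter_upwards [key 1 one_pos] with t ⟨m, hm, _, hmt⟩
    rw [← hmt, (heq m hm).1]
    exact ENNReal.ofReal_ne_top
  · rw [hasDerivAt_iff_isLittleO, Asymptotics.isLittleO_iff]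
    intro ε hε
    filter_upwards [key ε hε, lt_mem_nhds hd] with t ⟨m, hm, hml, hmt⟩ ht
    have hval : ∀ m ∈ Set.Icc a b, (R (T m)).toReal = V m - m * T m := fun m hm => by
      rw [(heq m hm).1, ENNReal.toReal_ofReal (heq m hm).2]
    have e1 := hval m hm
    have e2 := hval l hl
    rw [hTl] at e2
    rw [hmt] at e1
    -- Testing the line touching at `t` against `d`, and the one touching at `d` against `t`,
    -- sandwiches `R t - R d + l * (t - d)` between `0` and `(l - m) * (t - d)`.
    have i1 := hge m hm d hd.le
    have i2 := hge l hl t ht.le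
    rw [ENNReal.ofReal_le_iff_le_toReal (by rw [← hTl, (heq l hl).1]; exact ENNReal.ofReal_ne_top)]
      at i1
    rw [ENNReal.ofReal_le_iff_le_toReal (by rw [← hmt, (heq m hm).1]; exact ENNReal.ofReal_ne_top)]
      at i2
    simp only [smul_eq_mul, Real.norm_eq_abs]
    rw [e1, e2] at *
    have i3 : |(l - m) * (t - d)| ≤ ε * |t - d| := by
      rw [abs_mul, abs_sub_comm l m]; gcongr
    rw [abs_of_nonneg (by linarith)]
    refine le_trans ?_ ((le_abs_self _).trans i3)
    linarith

section
variable {n : ℕ} {s ν : Fin n → ℝ} {l d : ℝ}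

/-- In a component above the water level, the shrinkage error and the channel noise add up to
exactly `1 / (2 * l)`. -/
theorem avgDist_waterfill (hl : 0 < l) :
    avgDist s (waterfill s l) l = (1 / (n : ℝ)) * ∑ i, min (s i) (1 / (2 * l)) := by
  rw [avgDist]
  congr 1
  refine Finset.sum_congr rfl fun i _ => ?_
  rw [waterfill]
  rcases le_or_gt (s i - 1 / (2 * l)) 0 with h | h
  · rw [max_eq_right h, min_eq_left (sub_nonpos.1 h)]; simp
  · have hs0 : 0 < s i := (show (0:ℝ) < 1 / (2 * l) by positivity).trans (sub_pos.1 h)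
    have hr : 1 + 2 * l * (s i - 1 / (2 * l)) = 2 * l * s i := by field_simp; ring
    rw [max_eq_left h.le, min_eq_right (sub_pos.1 h).le, hr]
    field_simp
    ring

theorem mean_waterfill (hl : 0 < l) :
    (1 / (n : ℝ)) * ∑ i, waterfill s l i =
      (1 / (n : ℝ)) * ∑ i, s i - avgDist s (waterfill s l) l := by
  rw [avgDist_waterfill hl, ← mul_sub, ← Finset.sum_sub_distrib]
  congr 1
  refine Finset.sum_congr rfl fun i _ => ?_
  rw [waterfill]
  rcases le_or_gt (s i - 1 / (2 * l)) 0 with h | h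
  · rw [max_eq_right h, min_eq_left (sub_nonpos.1 h)]; simp
  · rw [max_eq_left h.le, min_eq_right (sub_pos.1 h).le]

/-- The distortion is continuous in the water level `w = 1 / (2 * l)`, so `w` exists by the
intermediate value theorem. The bounds `d ≤ w ≤ M` confine `l` to a range independent of `n`. -/
theorem exists_waterLevel (hn : 0 < n) {M : ℝ} (hs : ∀ i, 0 ≤ s i) (hM : ∀ i, s i ≤ M)
    (hd : 0 < d) (hds : d < (1 / (n : ℝ)) * ∑ i, s i) :
    ∃ l, 0 < l ∧ avgDist s (waterfill s l) l = d ∧ d ≤ 1 / (2 * l) ∧ 1 / (2 * l) ≤ M ∧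
      HasNegSlopeAt (nthRDF (diagGaussian s)) d l := by
  have hn' : (0 : ℝ) < n := by exact_mod_cast hn
  have hM0 : 0 ≤ M := (hs ⟨0, hn⟩).trans (hM _)
  set G : ℝ → ℝ := fun w => (1 / (n : ℝ)) * ∑ i, min (s i) w with hG
  have hGc : Continuous G := by fun_prop
  have hGM : G M = (1 / (n : ℝ)) * ∑ i, s i := by simp [hG, hM]
  have hG0 : G 0 = 0 := by simp [hG, hs]
  obtain ⟨w, hw, hwd⟩ := intermediate_value_Icc hM0 hGc.continuousOn
    (show d ∈ Set.Icc (G 0) (G M) from ⟨hG0.trans_le hd.le, hds.le.trans_eq hGM.symm⟩)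
  have hw0 : 0 < w := hw.1.lt_of_ne (by rintro rfl; linarith)
  have hT : ∀ m, 0 < m → avgDist s (waterfill s m) m = G (1 / (2 * m)) :=
    fun m hm => avgDist_waterfill hm
  have hlw : 1 / (2 * (1 / (2 * w))) = w := by field_simp
  have hl0 : 0 < 1 / (2 * w) := by positivity
  have hmean : ∀ x : ℝ, G x ≤ x := fun x => by
    calc G x ≤ (1 / (n : ℝ)) * ∑ i : Fin n, x := by
          simp only [hG]; gcongr; exact min_le_right _ _
      _ = x := by simp; field_simp
  -- Because `d` is below the mean variance, some component lies strictly above the water level; it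
  -- supplies strict monotonicity.
  obtain ⟨i, hi⟩ : ∃ i, w < s i := by
    by_contra! hcon
    have : G w = (1 / (n : ℝ)) * ∑ i, s i := by simp [hG, hcon]
    linarith
  refine ⟨1 / (2 * w), hl0, by rw [hT _ hl0, hlw, hwd], by rw [hlw, ← hwd]; exact hmean w,
    by rw [hlw]; exact hw.2, ?_⟩
  have ha : 0 < 1 / (2 * s i) := by have := hw0.trans hi; positivity
  have hpos : ∀ m ∈ Set.Icc (1 / (2 * s i)) (1 / w), 0 < m := fun m hm => ha.trans_le hm.1
  -- On this interval the water level runs from `s i` down to `w / 2`, so component `i` is never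
  -- below it.
  refine hasNegSlopeAt_of_supporting (T := fun m => avgDist s (waterfill s m) m)
    (V := fun m => intercept s (waterfill s m) m)
    (a := 1 / (2 * s i)) (b := 1 / w) ?_ ?_ ?_ ?_ (by rw [hT _ hl0, hlw, hwd]) hd ?_ ?_
  · exact one_div_lt_one_div_of_lt (by positivity) (by linarith)
  · exact one_div_lt_one_div_of_lt (by positivity) (by linarith)
  · have : ContinuousOn (fun m => G (1 / (2 * m))) (Set.Icc (1 / (2 * s i)) (1 / w)) := by
      refine hGc.comp_continuousOn ?_
      exact continuousOn_const.div (by fun_prop) fun m hm => by have := hpos m hm; positivity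
    exact this.congr fun m hm => hT m (hpos m hm)
  · intro m hm m' hm' hmm
    have h1 := hpos m hm
    have h2 := hpos m' hm'
    simp only [hT m h1, hT m' h2, hG]
    have hlt : 1 / (2 * m') < 1 / (2 * m) :=
      one_div_lt_one_div_of_lt (by positivity) (by linarith)
    refine mul_lt_mul_of_pos_left ?_ (by positivity)
    refine Finset.sum_lt_sum (fun j _ => min_le_min_left _ hlt.le) ⟨i, Finset.mem_univ _, ?_⟩
    have h3 : 1 / (2 * m) ≤ s i := by
      have := hm.1
      rw [div_le_iff₀ (by have := hw0.trans hi; positivity)] at this ⊢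
      linarith
    rw [min_eq_right h3, min_eq_right (hlt.le.trans h3)]
    exact hlt
  · exact fun m hm t ht => ofReal_le_nthRDF hn (hpos m hm) hs ht
  · exact fun m hm => ⟨(nthRDF_avgDist hn (hpos m hm) hs).1,
      (condRelEntropy_testChannel hn (hpos m hm).le hs (waterfill_nonneg s m)).2⟩

/-! ### Quantitative monotonicity and perturbation of the slope. -/

/-- The noise term alone gives the rate, of order `ν i ^ 2`; the shrinkage term also decreases and
is discarded, so the bound holds for every nonnegative `s`. Cauchy–Schwarz passes from the mean of
`ν` to the mean of its squares. -/
theorem avgDist_sub_ge (hn : 0 < n) {M L c : ℝ} (hs : ∀ i, 0 ≤ s i) (hν : ∀ i, 0 ≤ ν i)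
    (hM : ∀ i, ν i ≤ M) (hc : 0 ≤ c) (hcν : c ≤ (1 / (n : ℝ)) * ∑ i, ν i) {m m' : ℝ} (hm : 0 ≤ m)
    (hmm : m ≤ m') (hL : m' ≤ L) :
    2 * c ^ 2 / (1 + 2 * L * M) ^ 2 * (m' - m) ≤ avgDist s ν m - avgDist s ν m' := by
  have hn' : (0 : ℝ) < n := by exact_mod_cast hn
  have hL0 : 0 ≤ L := hm.trans (hmm.trans hL)
  have hm'0 : 0 ≤ m' := hm.trans hmm
  have hM0 : 0 ≤ M := (hν ⟨0, hn⟩).trans (hM _)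
  have h1 : ∀ i, 2 * ν i ^ 2 / (1 + 2 * L * M) ^ 2 * (m' - m) ≤
      (s i / (1 + 2 * m * ν i) ^ 2 + ν i / (1 + 2 * m * ν i)) -
      (s i / (1 + 2 * m' * ν i) ^ 2 + ν i / (1 + 2 * m' * ν i)) := fun i => by
    have hr := gain_pos hm (hν i)
    have hr' := gain_pos hm'0 (hν i)
    have hνi := hν i
    have e1 : s i / (1 + 2 * m' * ν i) ^ 2 ≤ s i / (1 + 2 * m * ν i) ^ 2 := by
      have := hs i
      gcongr
    have e2 : ν i / (1 + 2 * m * ν i) - ν i / (1 + 2 * m' * ν i) =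
        2 * ν i ^ 2 * (m' - m) / ((1 + 2 * m * ν i) * (1 + 2 * m' * ν i)) := by
      field_simp; ring
    have e3 : 2 * ν i ^ 2 * (m' - m) / (1 + 2 * L * M) ^ 2 ≤
        2 * ν i ^ 2 * (m' - m) / ((1 + 2 * m * ν i) * (1 + 2 * m' * ν i)) := by
      have : 0 ≤ m' - m := sub_nonneg.2 hmm
      have hmL := hmm.trans hL
      rw [sq (1 + 2 * L * M)]
      have := hM i
      gcongr
    rw [div_mul_eq_mul_div]
    linarith
  have h2 : c ^ 2 ≤ (1 / (n : ℝ)) * ∑ i, ν i ^ 2 := by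
    have := sq_sum_le_card_mul_sum_sq (s := (Finset.univ : Finset (Fin n))) (f := ν)
    simp only [Finset.card_univ, Fintype.card_fin] at this
    calc c ^ 2 ≤ ((1 / (n : ℝ)) * ∑ i, ν i) ^ 2 := by gcongr
      _ = (1 / (n : ℝ)) ^ 2 * (∑ i, ν i) ^ 2 := by ring
      _ ≤ (1 / (n : ℝ)) ^ 2 * (n * ∑ i, ν i ^ 2) := by gcongr
      _ = _ := by field_simp
  rw [avgDist, avgDist, ← mul_sub, ← Finset.sum_sub_distrib]
  have hK : 0 ≤ 2 / (1 + 2 * L * M) ^ 2 * (m' - m) :=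
    mul_nonneg (by positivity) (sub_nonneg.2 hmm)
  calc 2 * c ^ 2 / (1 + 2 * L * M) ^ 2 * (m' - m)
      = c ^ 2 * (2 / (1 + 2 * L * M) ^ 2 * (m' - m)) := by ring
    _ ≤ ((1 / (n : ℝ)) * ∑ i, ν i ^ 2) * (2 / (1 + 2 * L * M) ^ 2 * (m' - m)) := by gcongr
    _ = (1 / (n : ℝ)) * ∑ i, 2 * ν i ^ 2 / (1 + 2 * L * M) ^ 2 * (m' - m) := by
        rw [mul_assoc, Finset.sum_mul]
        congr 1
        exact Finset.sum_congr rfl fun i _ => by ring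
    _ ≤ _ := by gcongr with i; exact h1 i

theorem continuousOn_avgDist (hν : ∀ i, 0 ≤ ν i) : ContinuousOn (avgDist s ν) (Set.Ici 0) := by
  unfold avgDist
  refine continuousOn_const.mul (continuousOn_finsetSum _ fun i _ => ?_)
  have h : ∀ m ∈ Set.Ici (0 : ℝ), 1 + 2 * m * ν i ≠ 0 := fun m hm => (gain_pos hm (hν i)).ne'
  exact (continuousOn_const.div (by fun_prop) fun m hm => pow_ne_zero 2 (h m hm)).add
    (continuousOn_const.div (by fun_prop) h)

/-- The output law is frozen while the slope varies, so strict monotonicity comes from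
`avgDist_sub_ge` and needs only that `ν` has positive mean. -/
theorem hasNegSlopeAt_crem (hn : 0 < n) (hs : ∀ i, 0 ≤ s i) (hν : ∀ i, 0 ≤ ν i)
    (hpos : 0 < (1 / (n : ℝ)) * ∑ i, ν i) (hl : 0 < l) (hT : avgDist s ν l = d) (hd : 0 < d) :
    HasNegSlopeAt (crem (diagGaussian s) (diagGaussian ν)) d l := by
  obtain ⟨M, hM⟩ : ∃ M, ∀ i, ν i ≤ M :=
    ⟨∑ i, ν i, fun i => Finset.single_le_sum (fun j _ => hν j) (Finset.mem_univ i)⟩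
  have hM0 : 0 ≤ M := (hν ⟨0, hn⟩).trans (hM _)
  have h0 : ∀ m ∈ Set.Icc (l / 2) (2 * l), 0 ≤ m := fun m hm => by linarith [hm.1]
  refine hasNegSlopeAt_of_supporting (T := avgDist s ν) (V := intercept s ν)
    (a := l / 2) (b := 2 * l) (by linarith) (by linarith)
    ((continuousOn_avgDist hν).mono h0) ?_ hT hd ?_ ?_
  · intro m hm m' hm' hmm
    have := avgDist_sub_ge hn hs hν hM hpos.le le_rfl (h0 m hm) hmm.le hm'.2
    have h2 : 0 < 2 * ((1 / (n : ℝ)) * ∑ i, ν i) ^ 2 / (1 + 2 * (2 * l) * M) ^ 2 * (m' - m) :=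
      mul_pos (by positivity) (sub_pos.2 hmm)
    linarith
  · exact fun m hm t ht => ofReal_le_crem hn (h0 m hm) hs hν ht
  · exact fun m hm => ⟨(crem_avgDist hn (h0 m hm) hs hν).1,
      (condRelEntropy_testChannel hn (h0 m hm) hs hν).2⟩

/-- Perturbing the input variances perturbs the slope of the test channel proportionally. -/
theorem exists_slope_perturbation (hn : 0 < n) {s' : Fin n → ℝ} {M L c ε : ℝ}
    (hs' : ∀ i, 0 ≤ s' i) (hν : ∀ i, 0 ≤ ν i) (hM : ∀ i, ν i ≤ M) (hc : 0 < c)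
    (hcν : c ≤ (1 / (n : ℝ)) * ∑ i, ν i) (hl : 0 < l) (hlL : 2 * l ≤ L)
    (hss : ∀ i, |s' i - s i| ≤ ε)
    (hε : ε / (2 * c ^ 2 / (1 + 2 * L * M) ^ 2) ≤ l / 2) :
    ∃ l', 0 < l' ∧ avgDist s' ν l' = avgDist s ν l ∧
      |l' - l| ≤ ε / (2 * c ^ 2 / (1 + 2 * L * M) ^ 2) := by
  have hn' : (0 : ℝ) < n := by exact_mod_cast hn
  have hM0 : 0 ≤ M := (hν ⟨0, hn⟩).trans (hM _)
  have hL0 : 0 < L := by linarith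
  have hε0 : 0 ≤ ε := (abs_nonneg _).trans (hss ⟨0, hn⟩)
  set k := 2 * c ^ 2 / (1 + 2 * L * M) ^ 2 with hk
  have hk0 : 0 < k := by positivity
  -- Moving the slope by `δ` changes the distortion by at least `ε`, enough to offset the
  -- perturbation; `δ ≤ l / 2` keeps `l - δ` positive and `l + δ` below `L`.
  set δ := ε / k with hδ
  have hδ0 : 0 ≤ δ := by positivity
  have hkδ : k * δ = ε := by rw [hδ]; field_simp
  have h1 : |avgDist s' ν l - avgDist s ν l| ≤ ε := by
    rw [avgDist, avgDist, ← mul_sub, ← Finset.sum_sub_distrib, abs_mul, abs_of_pos (by positivity)]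
    calc (1 / (n : ℝ)) * |∑ i, ((s' i / (1 + 2 * l * ν i) ^ 2 + ν i / (1 + 2 * l * ν i)) -
          (s i / (1 + 2 * l * ν i) ^ 2 + ν i / (1 + 2 * l * ν i)))|
        ≤ (1 / (n : ℝ)) * ∑ i : Fin n, ε := by
          gcongr
          refine (Finset.abs_sum_le_sum_abs _ _).trans (Finset.sum_le_sum fun i _ => ?_)
          have hr : 1 ≤ (1 + 2 * l * ν i) ^ 2 := by
            have : 0 ≤ 2 * l * ν i := by have := hν i; positivity
            exact one_le_pow₀ (by linarith)
          rw [add_sub_add_right_eq_sub, ← sub_div, abs_div, abs_of_pos (zero_lt_one.trans_le hr)]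
          exact (div_le_self (abs_nonneg _) hr).trans (hss i)
      _ = ε := by simp; field_simp
  obtain ⟨h2, h3⟩ := abs_le.1 h1
  have h4 := avgDist_sub_ge hn hs' hν hM hc.le hcν (m := l - δ) (m' := l) (L := L)
    (by linarith) (by linarith) (by linarith)
  have h5 := avgDist_sub_ge hn hs' hν hM hc.le hcν (m := l) (m' := l + δ) (L := L)
    hl.le (by linarith) (by linarith)
  rw [← hk, sub_sub_cancel, hkδ] at h4
  rw [← hk, add_sub_cancel_left, hkδ] at h5
  obtain ⟨l', hl', he⟩ := intermediate_value_Icc' (show l - δ ≤ l + δ by linarith)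
    ((continuousOn_avgDist (s := s') hν).mono fun m hm => by
      simp only [Set.mem_Ici]; linarith [hm.1])
    (show avgDist s ν l ∈ Set.Icc (avgDist s' ν (l + δ)) (avgDist s' ν (l - δ)) from
      ⟨by linarith, by linarith⟩)
  exact ⟨l', by linarith [hl'.1], he, abs_le.2 ⟨by linarith [hl'.1], by linarith [hl'.2]⟩⟩

/-- With `g = 1 / (1 + 2 * l * v)` the distortion is `x² g² + v g`, and `g ≤ 1` is Lipschitz in `l`
with constant `2 * M`. -/
theorem abs_condDist_sub_le {M l l' v x : ℝ} (hl : 0 ≤ l) (hl' : 0 ≤ l') (hv : 0 ≤ v)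
    (hvM : v ≤ M) :
    |condDist l' v x - condDist l v x| ≤ |l' - l| * (4 * M * x ^ 2 + 2 * M ^ 2) := by
  have hM0 := hv.trans hvM
  have hr := gain_pos hl hv
  have hr' := gain_pos hl' hv
  have h1 : |1 / (1 + 2 * l' * v) - 1 / (1 + 2 * l * v)| ≤ 2 * M * |l' - l| := by
    have e : 1 / (1 + 2 * l' * v) - 1 / (1 + 2 * l * v) =
        2 * v * (l - l') / ((1 + 2 * l' * v) * (1 + 2 * l * v)) := by field_simp; ring
    rw [e, abs_div, abs_mul, abs_sub_comm l l', abs_of_nonneg (by positivity : 0 ≤ 2 * v),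
      abs_of_pos (mul_pos hr' hr)]
    refine (div_le_self (by positivity) ?_).trans (by gcongr)
    have h3 : 0 ≤ 2 * l' * v := by positivity
    have h4 : 0 ≤ 2 * l * v := by positivity
    nlinarith
  have hb : ∀ m : ℝ, 0 ≤ m → 0 ≤ 1 / (1 + 2 * m * v) ∧ 1 / (1 + 2 * m * v) ≤ 1 := fun m hm => by
    have := gain_pos hm hv
    have h3 : 0 ≤ 2 * m * v := by positivity
    exact ⟨by positivity, by rw [div_le_one this]; linarith⟩
  obtain ⟨a1, a2⟩ := hb l hl
  obtain ⟨b1, b2⟩ := hb l' hl'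
  have e : condDist l' v x - condDist l v x =
      (1 / (1 + 2 * l' * v) - 1 / (1 + 2 * l * v)) *
      (x ^ 2 * (1 / (1 + 2 * l' * v) + 1 / (1 + 2 * l * v)) + v) := by
    simp only [condDist, div_eq_mul_inv, ← inv_pow]; ring
  rw [e, abs_mul, abs_of_nonneg (by positivity :
    0 ≤ x ^ 2 * (1 / (1 + 2 * l' * v) + 1 / (1 + 2 * l * v)) + v)]
  calc _ ≤ (2 * M * |l' - l|) * (x ^ 2 * (1 + 1) + M) := by gcongr
    _ = _ := by ring

end

/-! ### Isometry invariance of the rate-distortion function -/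

section
variable {n : ℕ}

theorem compProd_map_equiv {P : Measure (Fin n → ℝ)} [IsProbabilityMeasure P]
    (K : Kernel (Fin n → ℝ) (Fin n → ℝ)) [IsMarkovKernel K]
    (e : (Fin n → ℝ) ≃ᵐ (Fin n → ℝ)) :
    P.map e ⊗ₘ ((K.map e).comap e.symm e.symm.measurable) =
      (P ⊗ₘ K).map (Prod.map e e) := by
  have := Kernel.IsMarkovKernel.map K e.measurable
  have : IsProbabilityMeasure (P.map e) := Measure.isProbabilityMeasure_map (by fun_prop)
  ext B hB
  have hpm : Measurable (Prod.map e e) := e.measurable.prodMap e.measurable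
  rw [Measure.compProd_apply hB, Measure.map_apply hpm hB, Measure.compProd_apply (hpm hB),
    lintegral_map_equiv]
  refine lintegral_congr fun x => ?_
  rw [Kernel.comap_apply, MeasurableEquiv.symm_apply_apply, Kernel.map_apply _ e.measurable,
    Measure.map_apply e.measurable (measurable_prodMk_left hB)]
  rfl

/-- Conjugating a channel by the isometry keeps its distortion, and data processing shows that
mutual information does not grow. The inverse isometry gives the converse. -/
theorem nthRDF_map_le {P : Measure (Fin n → ℝ)} [IsProbabilityMeasure P]
    (e : (Fin n → ℝ) ≃ᵐ (Fin n → ℝ)) (he : ∀ x y, mse (e x) (e y) = mse x y) (t : ℝ) :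
    nthRDF (P.map e) t ≤ nthRDF P t := by
  rw [nthRDF, nthRDF]
  refine mul_le_mul_right (le_iInf₂ fun K hK => ?_) _
  have := hK.1
  have hpm : Measurable (Prod.map e e) := e.measurable.prodMap e.measurable
  have hMK := Kernel.IsMarkovKernel.map K e.measurable
  have hP : IsProbabilityMeasure (P.map e) := Measure.isProbabilityMeasure_map (by fun_prop)
  set K' := (K.map e).comap e.symm e.symm.measurable with hK'
  have h1 := compProd_map_equiv (P := P) K e
  rw [← hK'] at h1
  have h2 : K' ∘ₘ P.map e = (K ∘ₘ P).map e := by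
    rw [← Measure.snd_compProd, h1, ← Measure.snd_compProd, Measure.snd, Measure.snd,
      Measure.map_map measurable_snd hpm, Measure.map_map e.measurable measurable_snd]
    rfl
  have hf : IsFeasible (P.map e) t K' := by
    refine ⟨inferInstance, ?_⟩
    rw [h1, lintegral_map (by exact measurable_mse.ennreal_ofReal) hpm]
    simpa only [Prod.map_fst, Prod.map_snd, he] using hK.2
  refine (iInf₂_le K' hf).trans ?_
  rw [mutualInfo, mutualInfo, h1, h2, Measure.map_prod_map _ _ e.measurable e.measurable]
  exact InformationTheory.klDiv_map_le _ _ hpm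

theorem nthRDF_map_equiv {P : Measure (Fin n → ℝ)} [IsProbabilityMeasure P]
    (e : (Fin n → ℝ) ≃ᵐ (Fin n → ℝ)) (he : ∀ x y, mse (e x) (e y) = mse x y) (t : ℝ) :
    nthRDF (P.map e) t = nthRDF P t := by
  have hP : IsProbabilityMeasure (P.map e) := Measure.isProbabilityMeasure_map (by fun_prop)
  refine le_antisymm (nthRDF_map_le e he t) ?_
  have := nthRDF_map_le (P := P.map e) e.symm (fun x y => by rw [← he]; simp) t
  rwa [MeasurableEquiv.map_symm_map] at this

/-! ### The law of the decorrelated source -/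

variable {a σ : ℝ}

/-- Padding by `g 0 = 0` encodes the boundary row, so the matrix acts as a difference operator on
sequences; `h n = 0` plays this role for the transpose. -/
theorem matA_mulVec (a : ℝ) {v : Fin n → ℝ} {g : ℕ → ℝ} (h0 : g 0 = 0)
    (hv : ∀ j : Fin n, v j = g (j + 1)) (i : Fin n) :
    (matA a n).mulVec v i = g (i + 1) - a * g i := by
  have h1 : ∀ j : Fin n, matA a n i j * v j =
      (if i = j then g (j + 1) else 0) + (if (j : ℕ) + 1 = i then -a * g i else 0) := fun j => by
    rw [hv, matA, Matrix.of_apply]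
    by_cases hij : i = j
    · subst hij; simp
    · by_cases hij' : (j : ℕ) + 1 = i <;> simp [hij, hij']
  simp only [Matrix.mulVec, dotProduct, h1, Finset.sum_add_distrib]
  rw [Finset.sum_ite_eq, if_pos (Finset.mem_univ i), sub_eq_add_neg, ← neg_mul]
  congr 1
  obtain ⟨i, hi⟩ := i
  rcases i with _ | i
  · simp [h0]
  · rw [Finset.sum_eq_single ⟨i, by omega⟩]
    · simp
    · rintro ⟨j, hj⟩ - hne
      rw [if_neg]
      simp only [ne_eq, Fin.mk.injEq] at hne
      simpa using hne
    · simp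

theorem matA_transpose_mulVec (a : ℝ) {w : Fin n → ℝ} {h : ℕ → ℝ} (hn : h n = 0)
    (hw : ∀ j : Fin n, w j = h j) (i : Fin n) :
    (matA a n).transpose.mulVec w i = h i - a * h (i + 1) := by
  have h1 : ∀ j : Fin n, (matA a n).transpose i j * w j =
      (if i = j then h j else 0) + (if (i : ℕ) + 1 = j then -a * h (i + 1) else 0) := fun j => by
    rw [hw, matA, Matrix.transpose_apply, Matrix.of_apply]
    by_cases hij : i = j
    · subst hij; simp
    · by_cases hij' : (i : ℕ) + 1 = j <;> simp [hij, hij', Ne.symm hij]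
  simp only [Matrix.mulVec, dotProduct, h1, Finset.sum_add_distrib]
  rw [Finset.sum_ite_eq, if_pos (Finset.mem_univ i), sub_eq_add_neg, ← neg_mul]
  congr 1
  by_cases hi : (i : ℕ) + 1 < n
  · rw [Finset.sum_eq_single ⟨i + 1, hi⟩]
    · simp
    · rintro ⟨j, hj⟩ - hne
      rw [if_neg]
      simp only [ne_eq, Fin.mk.injEq] at hne
      simpa using Ne.symm hne
    · simp
  · have : (i : ℕ) + 1 = n := by omega
    rw [this, hn]
    simp

theorem det_matA (a : ℝ) (n : ℕ) : (matA a n).det = 1 := by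
  rw [Matrix.det_of_isLowerTriangular]
  · simp [matA]
  · intro i j hij
    have hij' : i < j := hij
    have h1 : i ≠ j := hij'.ne
    have h2 : ¬ ((j : ℕ) + 1 = i) := by
      have : (i : ℕ) < j := hij'
      omega
    simp [matA, h1, h2]

theorem matA_mulVec_sourceVec (a : ℝ) (n : ℕ) (z : ℕ → ℝ) :
    (matA a n).mulVec (sourceVec a n z) = fun i : Fin n => z i := by
  ext i
  rw [matA_mulVec a (v := sourceVec a n z) (g := path a z) rfl (fun j => rfl)]
  simp [path]

theorem sourceVec_eq (a : ℝ) (n : ℕ) (z : ℕ → ℝ) :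
    sourceVec a n z = (matA a n)⁻¹.mulVec fun i : Fin n => z i := by
  rw [← matA_mulVec_sourceVec a n z, Matrix.mulVec_mulVec,
    Matrix.nonsing_inv_mul _ (by rw [det_matA]; exact isUnit_one), Matrix.one_mulVec]

instance (σ : ℝ) : IsProbabilityMeasure (innovationLaw σ) := by
  unfold innovationLaw; infer_instance

theorem innovationLaw_map_fin (σ : ℝ) (n : ℕ) :
    (innovationLaw σ).map (fun z (i : Fin n) => z i) = diagGaussian fun _ => σ ^ 2 := by
  have h : iIndepFun (fun (i : ℕ) (z : ℕ → ℝ) => z i) (innovationLaw σ) :=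
    iIndepFun_infinitePi (X := fun _ x => x) (fun i => by fun_prop)
  have h2 := h.precomp (g := fun i : Fin n => (i : ℕ)) Fin.val_injective
  rw [iIndepFun_iff_map_fun_eq_pi_map fun i => (measurable_pi_apply _).aemeasurable] at h2
  rw [h2, diagGaussian]
  congr 1
  ext i : 1
  exact Measure.infinitePi_map_eval _ _

@[fun_prop]
theorem measurable_decorr (S : Matrix (Fin n) (Fin n) ℝ) : Measurable (decorr S) := by
  unfold decorr Matrix.mulVec dotProduct
  fun_prop

theorem measurable_path (a : ℝ) (k : ℕ) : Measurable fun z => path a z k := by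
  induction k with
  | zero => exact measurable_const
  | succ k ih => exact (ih.const_mul a).add (measurable_pi_apply k)

@[fun_prop]
theorem measurable_sourceVec (a : ℝ) (n : ℕ) : Measurable (sourceVec a n) :=
  measurable_pi_lambda _ fun _ => measurable_path a _

variable {S : Matrix (Fin n) (Fin n) ℝ} {μ : Fin n → ℝ}

theorem IsEigendecomposition.transpose_mul_self (h : IsEigendecomposition a n S μ) :
    S.transpose * S = 1 := by
  have := (Matrix.mem_orthogonalGroup_iff' (Fin n) ℝ).1 h.orthogonal
  simpa [Matrix.star_eq_conjTranspose] using this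

theorem IsEigendecomposition.mul_transpose_self (h : IsEigendecomposition a n S μ) :
    S * S.transpose = 1 := by
  have := (Matrix.mem_orthogonalGroup_iff (Fin n) ℝ).1 h.orthogonal
  simpa [Matrix.star_eq_conjTranspose] using this

/-- Up to the factor `σ ^ 2`, this is the covariance of the decorrelated source. -/
theorem IsEigendecomposition.conj_inv (h : IsEigendecomposition a n S μ) :
    (S.transpose * (matA a n)⁻¹) * (S.transpose * (matA a n)⁻¹).transpose =
      Matrix.diagonal fun i => 1 / μ i := by
  have h1 := h.decomp
  rw [Matrix.mul_inv_rev, ← Matrix.transpose_nonsing_inv] at h1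
  rw [Matrix.transpose_mul, Matrix.transpose_transpose,
    show S.transpose * (matA a n)⁻¹ * ((matA a n)⁻¹.transpose * S) =
      S.transpose * ((matA a n)⁻¹ * (matA a n)⁻¹.transpose) * S by simp only [Matrix.mul_assoc],
    h1, show S.transpose * (S * Matrix.diagonal (fun i => 1 / μ i) * S.transpose) * S =
      (S.transpose * S) * Matrix.diagonal (fun i => 1 / μ i) * (S.transpose * S) by
        simp only [Matrix.mul_assoc], h.transpose_mul_self, Matrix.one_mul, Matrix.mul_one]

/-- A linear image of a white Gaussian vector with uncorrelated coordinates. -/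
theorem map_mulVec_diagGaussian (B : Matrix (Fin n) (Fin n) ℝ) {v : ℝ} (hv : 0 ≤ v)
    {r : Fin n → ℝ} (hr : ∀ i, 0 ≤ r i) (hB : B * B.transpose = Matrix.diagonal r) :
    (diagGaussian fun _ : Fin n => v).map B.mulVec = diagGaussian fun i => v * r i := by
  set T : (Fin n → ℝ) →L[ℝ] (Fin n → ℝ) := LinearMap.toContinuousLinearMap B.mulVecLin with hT
  have hTB : ⇑T = B.mulVec := by ext; simp [hT]
  rw [← hTB]
  have : IsProbabilityMeasure ((diagGaussian fun _ : Fin n => v).map T) :=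
    Measure.isProbabilityMeasure_map (by fun_prop)
  refine Measure.ext_of_charFunDual (funext fun L => ?_)
  rw [charFunDual_map, charFunDual_diagGaussian fun _ => hv,
    charFunDual_diagGaussian fun i => mul_nonneg hv (hr i)]
  congr 3
  congr 1
  simp_rw [mul_assoc]
  rw [← Finset.mul_sum, ← Finset.mul_sum]
  congr 1
  set c : Fin n → ℝ := fun i => L (Pi.single i 1) with hc
  have hL : ∀ x, L x = ∑ i, x i * c i := fun x => by
    conv_lhs => rw [pi_eq_sum_univ' x]
    rw [map_sum]
    refine Finset.sum_congr rfl fun i _ => ?_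
    rw [map_smul, smul_eq_mul, hc]
  have h1 : ∀ j, (L.comp T) (Pi.single j 1) = ∑ i, B i j * c i := fun j => by
    rw [ContinuousLinearMap.comp_apply, hL, hTB]
    simp
  simp_rw [h1]
  have h2 : ∀ i k, ∑ j, B i j * B k j = if i = k then r i else 0 := fun i k => by
    have := congrFun (congrFun hB i) k
    rwa [Matrix.mul_apply, Matrix.diagonal_apply] at this
  calc ∑ j, (∑ i, B i j * c i) ^ 2 = ∑ j, ∑ i, ∑ k, (B i j * B k j) * (c i * c k) := by
        refine Finset.sum_congr rfl fun j _ => ?_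
        rw [sq, Finset.sum_mul_sum]
        exact Finset.sum_congr rfl fun i _ => Finset.sum_congr rfl fun k _ => by ring
    _ = ∑ i, ∑ k, (∑ j, B i j * B k j) * (c i * c k) := by
        rw [Finset.sum_comm]
        refine Finset.sum_congr rfl fun i _ => ?_
        rw [Finset.sum_comm]
        exact Finset.sum_congr rfl fun k _ => by rw [Finset.sum_mul]
    _ = ∑ i, r i * (L (Pi.single i 1)) ^ 2 := by
        simp_rw [h2, ite_mul, zero_mul]
        refine Finset.sum_congr rfl fun i _ => ?_
        rw [Finset.sum_ite_eq, if_pos (Finset.mem_univ i), hc, sq]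

theorem innovationLaw_map_decorr (h : IsEigendecomposition a n S μ) :
    (innovationLaw σ).map (fun z => decorr S (sourceVec a n z)) =
      diagGaussian fun i => σ ^ 2 / μ i := by
  have h1 : (fun z => decorr S (sourceVec a n z)) =
      (S.transpose * (matA a n)⁻¹).mulVec ∘ fun z (i : Fin n) => z i := by
    ext z i
    rw [decorr, sourceVec_eq, Matrix.mulVec_mulVec]
    rfl
  have h2 : Measurable (S.transpose * (matA a n)⁻¹).mulVec := by
    unfold Matrix.mulVec dotProduct; fun_prop
  rw [h1, ← Measure.map_map h2 (by fun_prop), innovationLaw_map_fin,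
    map_mulVec_diagGaussian _ (sq_nonneg σ) (fun i => (one_div_pos.2 (h.pos i)).le) h.conj_inv]
  simp_rw [mul_one_div]

theorem decorrLaw_eq (h : IsEigendecomposition a n S μ) :
    decorrLaw a σ S = diagGaussian fun i => σ ^ 2 / μ i := by
  rw [decorrLaw, sourceLaw, Measure.map_map (by fun_prop) (by fun_prop)]
  exact innovationLaw_map_decorr h

instance (a σ : ℝ) (n : ℕ) : IsProbabilityMeasure (sourceLaw a σ n) :=
  Measure.isProbabilityMeasure_map (by fun_prop)

/-- The decorrelation, as an equivalence. -/
noncomputable def IsEigendecomposition.equiv (h : IsEigendecomposition a n S μ) :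
    (Fin n → ℝ) ≃ᵐ (Fin n → ℝ) where
  toFun := decorr S
  invFun := decorr S.transpose
  left_inv x := by
    rw [decorr, decorr, Matrix.mulVec_mulVec, Matrix.transpose_transpose, h.mul_transpose_self,
      Matrix.one_mulVec]
  right_inv x := by
    rw [decorr, decorr, Matrix.mulVec_mulVec, Matrix.transpose_transpose, h.transpose_mul_self,
      Matrix.one_mulVec]
  measurable_toFun := measurable_decorr S
  measurable_invFun := measurable_decorr S.transpose

theorem IsEigendecomposition.mse_decorr (h : IsEigendecomposition a n S μ) (x y : Fin n → ℝ) :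
    mse (decorr S x) (decorr S y) = mse x y := by
  have key : ∀ v : Fin n → ℝ, ∑ i, decorr S v i ^ 2 = ∑ i, v i ^ 2 := fun v => by
    have : ∀ w : Fin n → ℝ, ∑ i, w i ^ 2 = dotProduct w w := fun w => by
      simp only [dotProduct, sq]
    rw [this, this, decorr, Matrix.dotProduct_mulVec, Matrix.vecMul_transpose,
      Matrix.mulVec_mulVec, h.mul_transpose_self, Matrix.one_mulVec]
  have h2 : ∀ i, decorr S x i - decorr S y i = decorr S (x - y) i := fun i => by
    simp only [decorr, Matrix.mulVec_sub, Pi.sub_apply]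
  simp only [mse, h2, key, Pi.sub_apply]

theorem nthRDF_sourceLaw (h : IsEigendecomposition a n S μ) (t : ℝ) :
    nthRDF (sourceLaw a σ n) t = nthRDF (diagGaussian fun i => σ ^ 2 / μ i) t := by
  rw [← decorrLaw_eq h, decorrLaw]
  exact (nthRDF_map_equiv h.equiv h.mse_decorr t).symm

end

/-! ### The spectrum of the source -/

section
variable {n : ℕ} {a σ : ℝ} {S : Matrix (Fin n) (Fin n) ℝ} {μ : Fin n → ℝ}

theorem IsEigendecomposition.mul_eq (h : IsEigendecomposition a n S μ) :
    (matA a n).transpose * matA a n = S * Matrix.diagonal μ * S.transpose := by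
  have hdet : IsUnit ((matA a n).transpose * matA a n).det := by
    rw [Matrix.det_mul, Matrix.det_transpose, det_matA]; simp
  have h1 : (S * Matrix.diagonal μ * S.transpose) *
      ((matA a n).transpose * matA a n)⁻¹ = 1 := by
    rw [h.decomp, show S * Matrix.diagonal μ * S.transpose *
      (S * Matrix.diagonal (fun i => 1 / μ i) * S.transpose) =
      S * (Matrix.diagonal μ * (S.transpose * S) * Matrix.diagonal (fun i => 1 / μ i)) *
        S.transpose by simp only [Matrix.mul_assoc], h.transpose_mul_self, Matrix.mul_one,
      Matrix.diagonal_mul_diagonal]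
    have : (fun i => μ i * (1 / μ i)) = fun _ => 1 := by
      ext i; exact mul_one_div_cancel (h.pos i).ne'
    rw [this, Matrix.diagonal_one, Matrix.mul_one, h.mul_transpose_self]
  calc (matA a n).transpose * matA a n
      = 1 * ((matA a n).transpose * matA a n) := (Matrix.one_mul _).symm
    _ = _ := by rw [← h1, Matrix.nonsing_inv_mul_cancel_right _ _ hdet]

/-- Any nonzero coordinate of the eigenvector in the basis `S` names a suitable index. -/
theorem IsEigendecomposition.exists_eq_of_mulVec (h : IsEigendecomposition a n S μ) {e : ℝ}
    {v : Fin n → ℝ} (hv : v ≠ 0)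
    (he : (matA a n).transpose.mulVec ((matA a n).mulVec v) = e • v) : ∃ j, μ j = e := by
  have h1 : (Matrix.diagonal μ).mulVec (S.transpose.mulVec v) = e • S.transpose.mulVec v := by
    have := congrArg S.transpose.mulVec he
    rwa [Matrix.mulVec_mulVec v, h.mul_eq, Matrix.mulVec_mulVec, Matrix.mulVec_smul,
      ← Matrix.mul_assoc, ← Matrix.mul_assoc, h.transpose_mul_self, Matrix.one_mul,
      ← Matrix.mulVec_mulVec] at this
  have h2 : S.transpose.mulVec v ≠ 0 := fun h0 => hv (by
    have := congrArg S.mulVec h0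
    rwa [Matrix.mulVec_mulVec, h.mul_transpose_self, Matrix.one_mulVec, Matrix.mulVec_zero] at this)
  obtain ⟨j, hj⟩ := Function.ne_iff.1 h2
  refine ⟨j, ?_⟩
  have := congrFun h1 j
  rw [Matrix.mulVec_diagonal, Pi.smul_apply, smul_eq_mul] at this
  exact mul_right_cancel₀ hj this

/-- The angles of the eigenvalues of the inverse covariance of the source. -/
theorem exists_root_sin (ha0 : 0 < a) (ha1 : a < 1) (i : Fin n) :
    ∃ w : ℝ, ((i : ℕ) + 1 / 2) * Real.pi / (n + 1) < w ∧ w < ((i : ℕ) + 1) * Real.pi / (n + 1) ∧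
      Real.sin ((n + 1) * w) - a * Real.sin (n * w) = 0 := by
  have hn : (0 : ℝ) < n + 1 := by positivity
  have hpi := Real.pi_pos
  set x := ((i : ℕ) + 1 / 2) * Real.pi / ((n : ℝ) + 1)
  set y := ((i : ℕ) + 1) * Real.pi / ((n : ℝ) + 1)
  have hxy : x < y := by simp only [x, y]; gcongr; norm_num
  -- The factor `(-1) ^ i` fixes the signs. At `x` the first sine is extremal and dominates because
  -- `a < 1`; at `y` it vanishes and the second term is negative because `a > 0`.
  set G : ℝ → ℝ := fun w => (-1) ^ (i : ℕ) * (Real.sin ((n + 1) * w) - a * Real.sin (n * w)) with hG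
  have hGc : Continuous G := by fun_prop
  have hsq : ((-1 : ℝ) ^ (i : ℕ)) * (-1) ^ (i : ℕ) = 1 := by rw [← mul_pow]; simp
  have hGx : 0 < G x := by
    have h1 : (n + 1) * x = Real.pi / 2 + (i : ℕ) * Real.pi := by simp only [x]; field_simp; ring
    have h2 : a * ((-1) ^ (i : ℕ) * Real.sin (n * x)) < 1 := by
      have : |(-1) ^ (i : ℕ) * Real.sin (n * x)| ≤ 1 := by
        rw [abs_mul, abs_pow]; simpa using Real.abs_sin_le_one _
      nlinarith [(abs_le.1 this).2]
    simp only [hG]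
    rw [h1, Real.sin_add_nat_mul_pi, Real.sin_pi_div_two]
    nlinarith
  have hGy : G y < 0 := by
    have h1 : (n + 1) * y = ((i : ℕ) + 1 : ℕ) * Real.pi := by
      simp only [y]; field_simp; push_cast; ring
    have h2 : (n : ℝ) * y = ((i : ℕ) + 1 : ℕ) * Real.pi - y := by rw [← h1]; ring
    have h3 : 0 < Real.sin y := by
      refine Real.sin_pos_of_pos_of_lt_pi (by positivity) ?_
      simp only [y]
      rw [div_lt_iff₀ hn, mul_comm]
      have : ((i : ℕ) : ℝ) + 1 ≤ n := by exact_mod_cast i.2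
      nlinarith
    simp only [hG]
    rw [h1, h2, Real.sin_nat_mul_pi, Real.sin_nat_mul_pi_sub]
    have : (-1 : ℝ) ^ (i : ℕ) * (0 - a * -((-1) ^ ((i : ℕ) + 1) * Real.sin y)) =
        -(a * Real.sin y) := by
      rw [pow_succ]; linear_combination -(a * Real.sin y) * hsq
    rw [this]
    have := mul_pos ha0 h3
    linarith
  obtain ⟨w, hw, h0⟩ := intermediate_value_Ioo' hxy.le hGc.continuousOn
    (show (0 : ℝ) ∈ Set.Ioo (G y) (G x) from ⟨hGy, hGx⟩)
  refine ⟨w, hw.1, hw.2, ?_⟩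
  simp only [hG] at h0
  exact (mul_eq_zero.1 h0).resolve_left (pow_ne_zero _ (by norm_num))

/-- The sine addition formulas give the eigenvalue equation; `sin 0 = 0` settles the left boundary,
and the hypothesis is exactly the right boundary condition. -/
theorem mulVec_sin {w : ℝ} (hw : Real.sin ((n + 1) * w) - a * Real.sin (n * w) = 0) :
    (matA a n).transpose.mulVec ((matA a n).mulVec fun i => Real.sin (((i : ℕ) + 1) * w)) =
      (1 + a ^ 2 - 2 * a * Real.cos w) • fun i : Fin n => Real.sin (((i : ℕ) + 1) * w) := by
  have h1 := fun i => matA_mulVec (n := n) a (v := fun i => Real.sin (((i : ℕ) + 1) * w))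
    (g := fun k => Real.sin (k * w)) (by simp) (fun j => by push_cast; rfl) i
  ext i
  rw [matA_transpose_mulVec a (h := fun k => Real.sin ((k + 1) * w) - a * Real.sin (k * w)) hw
    (fun j => by rw [h1]; push_cast; rfl)]
  simp only [Pi.smul_apply, smul_eq_mul]
  push_cast
  have e1 : Real.sin (((i : ℕ) + 1 + 1) * w) = Real.sin (((i : ℕ) + 1) * w) * Real.cos w +
      Real.cos (((i : ℕ) + 1) * w) * Real.sin w := by rw [← Real.sin_add]; congr 1; ring
  have e2 : Real.sin ((i : ℕ) * w) = Real.sin (((i : ℕ) + 1) * w) * Real.cos w -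
      Real.cos (((i : ℕ) + 1) * w) * Real.sin w := by rw [← Real.sin_sub]; congr 1; ring
  rw [e1, e2]
  ring

/-- For `a > 0`, the `n` roots lie in disjoint intervals and give `n` distinct eigenvalues,
increasing with the angle. For `a = 0` every eigenvalue is one and any angle works. -/
theorem IsEigendecomposition.exists_angle (h : IsEigendecomposition a n S μ) (ha0 : 0 ≤ a)
    (ha1 : a < 1) (i : Fin n) : ∃ w : ℝ, (i : ℕ) * Real.pi / (n + 1) ≤ w ∧
      w ≤ ((i : ℕ) + 1) * Real.pi / (n + 1) ∧ μ i = 1 + a ^ 2 - 2 * a * Real.cos w := by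
  have hn : (0 : ℝ) < n + 1 := by positivity
  have hpi := Real.pi_pos
  rcases ha0.eq_or_lt with rfl | ha
  · refine ⟨((i : ℕ) + 1) * Real.pi / (n + 1), by gcongr; linarith, le_rfl, ?_⟩
    have h1 : matA 0 n = 1 := by
      ext i j; simp [matA, Matrix.one_apply]
    have h2 := h.mul_eq
    rw [h1, Matrix.transpose_one, Matrix.one_mul] at h2
    have h3 : Matrix.diagonal μ = 1 := by
      calc Matrix.diagonal μ = (S.transpose * S) * Matrix.diagonal μ * (S.transpose * S) := by
            rw [h.transpose_mul_self, Matrix.one_mul, Matrix.mul_one]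
        _ = S.transpose * (S * Matrix.diagonal μ * S.transpose) * S := by
            simp only [Matrix.mul_assoc]
        _ = 1 := by rw [← h2, Matrix.mul_one, h.transpose_mul_self]
    have := congrFun (congrFun h3 i) i
    simpa using this
  · choose w hw1 hw2 hw0 using fun i : Fin n => exists_root_sin ha ha1 i
    have hwpos : ∀ i, 0 < w i := fun i => lt_of_le_of_lt (by positivity) (hw1 i)
    have hwpi : ∀ i, w i < Real.pi := fun i => (hw2 i).trans_le (by
      rw [div_le_iff₀ hn, mul_comm]
      have : ((i : ℕ) : ℝ) + 1 ≤ n := by exact_mod_cast i.2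
      nlinarith)
    have hmono : StrictMono w := fun i j hij => (hw2 i).trans_le (le_trans (by
      have : ((i : ℕ) : ℝ) + 1 ≤ (j : ℕ) := by exact_mod_cast hij
      refine div_le_div_of_nonneg_right (mul_le_mul_of_nonneg_right ?_ hpi.le) hn.le
      linarith) (hw1 j).le)
    have hev : ∀ i, ∃ j, μ j = 1 + a ^ 2 - 2 * a * Real.cos (w i) := fun i => by
      refine h.exists_eq_of_mulVec (v := fun k => Real.sin (((k : ℕ) + 1) * w i)) ?_
        (mulVec_sin (hw0 i))
      refine Function.ne_iff.2 ⟨⟨0, i.pos⟩, ?_⟩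
      simpa using (Real.sin_pos_of_pos_of_lt_pi (hwpos i) (hwpi i)).ne'
    choose j hj using hev
    have hjm : StrictMono j := fun i i' hii => by
      have h1 : Real.cos (w i') < Real.cos (w i) :=
        Real.strictAntiOn_cos ⟨(hwpos i).le, (hwpi i).le⟩ ⟨(hwpos i').le, (hwpi i').le⟩ (hmono hii)
      have h2 : μ (j i) < μ (j i') := by rw [hj, hj]; nlinarith
      exact lt_of_not_ge fun hle => absurd (h.mono hle) (not_le.2 h2)
    -- A strictly increasing self-map of `Fin n` is the identity, so the ordering of `μ` agrees with
    -- that of the angles.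
    have hji : j = id := StrictMono.range_inj hjm strictMono_id |>.1 (by
      rw [Set.range_id]
      exact Set.range_eq_univ.2 (Finite.surjective_of_injective hjm.injective))
    refine ⟨w i, le_trans ?_ (hw1 i).le, (hw2 i).le, ?_⟩
    · gcongr; linarith
    · rw [← hj, hji]; rfl

theorem one_sub_sq_le (ha0 : 0 ≤ a) (w : ℝ) : (1 - a) ^ 2 ≤ 1 + a ^ 2 - 2 * a * Real.cos w := by
  nlinarith [Real.cos_le_one w]

theorem IsEigendecomposition.le_eigenvalue (h : IsEigendecomposition a n S μ) (ha0 : 0 ≤ a)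
    (ha1 : a < 1) (i : Fin n) : (1 - a) ^ 2 ≤ μ i := by
  obtain ⟨w, -, -, h⟩ := h.exists_angle ha0 ha1 i
  rw [h]; exact one_sub_sq_le ha0 w

theorem spectrum_antitone (ha0 : 0 ≤ a) (ha1 : a < 1) :
    AntitoneOn (spectrum a σ) (Set.Icc 0 Real.pi) := by
  intro x hx y hy hxy
  have h1 : Real.cos y ≤ Real.cos x := Real.strictAntiOn_cos.antitoneOn hx hy hxy
  have h2 : 0 < (1 - a) ^ 2 := by have := sub_pos.2 ha1; positivity
  unfold spectrum
  have h3 := one_sub_sq_le ha0 x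
  refine div_le_div_of_nonneg_left (sq_nonneg σ) (by linarith) ?_
  nlinarith

theorem continuous_spectrum (ha0 : 0 ≤ a) (ha1 : a < 1) : Continuous (spectrum a σ) := by
  unfold spectrum
  refine continuous_const.div (by fun_prop) fun x => ?_
  have h2 : 0 < (1 - a) ^ 2 := by have := sub_pos.2 ha1; positivity
  exact (h2.trans_le (one_sub_sq_le ha0 x)).ne'

theorem dMax_eq (ha0 : 0 ≤ a) (ha1 : a < 1) :
    dMax a σ = (1 / Real.pi) * ∫ w in (0 : ℝ)..Real.pi, spectrum a σ w := by
  have hc := continuous_spectrum (σ := σ) ha0 ha1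
  have h1 : ∫ w in (-Real.pi)..0, spectrum a σ w = ∫ w in (0 : ℝ)..Real.pi, spectrum a σ w := by
    have := intervalIntegral.integral_comp_neg (a := 0) (b := Real.pi) (spectrum a σ)
    rw [neg_zero] at this
    rw [← this]
    congr 1
    ext w
    simp [spectrum]
  rw [dMax, ← intervalIntegral.integral_add_adjacent_intervals (hc.intervalIntegrable _ 0)
    (hc.intervalIntegrable _ _), h1]
  field_simp
  ring

/-- The average of the variances is asymptotically at least `dMax`. -/
theorem IsEigendecomposition.dMax_le (h : IsEigendecomposition a n S μ) (ha0 : 0 ≤ a)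
    (ha1 : a < 1) (hn : 0 < n) :
    dMax a σ - σ ^ 2 / (1 - a) ^ 2 / n ≤ (1 / (n : ℝ)) * ∑ i, σ ^ 2 / μ i := by
  have hn' : (0 : ℝ) < n := by exact_mod_cast hn
  have hpi := Real.pi_pos
  have hn1 : (0 : ℝ) < n + 1 := by positivity
  set f : ℝ → ℝ := fun x => spectrum a σ (x * (Real.pi / (n + 1))) with hf
  have hfa : AntitoneOn f (Set.Icc (0 : ℝ) (0 + (n + 1 : ℕ))) := by
    intro x hx y hy hxy
    have hb : ∀ x ∈ Set.Icc (0 : ℝ) (0 + (n + 1 : ℕ)),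
        x * (Real.pi / (n + 1)) ∈ Set.Icc 0 Real.pi := fun x hx => by
      refine ⟨mul_nonneg hx.1 (by positivity), ?_⟩
      have := hx.2
      push_cast at this
      rw [zero_add] at this
      calc x * (Real.pi / (n + 1)) ≤ (n + 1) * (Real.pi / (n + 1)) := by gcongr
        _ = Real.pi := by field_simp
    refine spectrum_antitone ha0 ha1 (hb x hx) (hb y hy) ?_
    gcongr
  have h1 := hfa.integral_le_sum
  have h2 : ∫ x in (0 : ℝ)..(0 + (n + 1 : ℕ)), f x = (n + 1) * dMax a σ := by
    simp only [hf]
    rw [intervalIntegral.integral_comp_mul_right _ (by positivity), dMax_eq ha0 ha1]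
    push_cast
    rw [zero_mul, zero_add, mul_div_cancel₀ _ hn1.ne', smul_eq_mul]
    field_simp
  -- In the left Riemann sum over `n + 1` cells, node zero has no eigenvalue and causes the error `σ
  -- ^ 2 / (1 - a) ^ 2`; node `i + 1` lies to the right of the angle of `μ i`.
  rw [h2, Finset.sum_range_succ'] at h1
  have hf0 : f (0 + (0 : ℕ)) = σ ^ 2 / (1 - a) ^ 2 := by
    simp only [hf, spectrum]; norm_num; ring_nf
  rw [hf0, Finset.sum_range] at h1
  have h3 : ∀ i : Fin n, f (0 + ((i : ℕ) + 1 : ℕ)) ≤ σ ^ 2 / μ i := fun i => by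
    obtain ⟨w, h4, h5, h6⟩ := h.exists_angle ha0 ha1 i
    rw [h6]
    have hy : ((i : ℕ) + 1) * Real.pi / ((n : ℝ) + 1) ≤ Real.pi := by
      rw [div_le_iff₀ hn1, mul_comm]
      have : ((i : ℕ) : ℝ) + 1 ≤ n := by exact_mod_cast i.2
      nlinarith
    have h0 : 0 ≤ (i : ℕ) * Real.pi / ((n : ℝ) + 1) := by positivity
    have := spectrum_antitone (σ := σ) ha0 ha1 ⟨h0.trans h4, h5.trans hy⟩
      ⟨h0.trans (h4.trans h5), hy⟩ h5
    simp only [hf]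
    push_cast
    rw [zero_add, ← mul_div_assoc]
    exact this
  have h4 : 0 ≤ dMax a σ := by
    rw [dMax_eq ha0 ha1]
    refine mul_nonneg (by positivity) (intervalIntegral.integral_nonneg hpi.le fun w _ => ?_)
    exact div_nonneg (sq_nonneg σ) ((sq_nonneg _).trans (one_sub_sq_le ha0 w))
  have h5 := Finset.sum_le_sum fun i (_ : i ∈ Finset.univ) => h3 i
  rw [one_div, inv_mul_eq_div, le_div_iff₀ hn', sub_mul, div_mul_cancel₀ _ hn'.ne']
  linarith

/-- The proxy variances are close to the true variances. -/
theorem IsEigendecomposition.abs_proxyVar_sub_le (h : IsEigendecomposition a n S μ) (ha0 : 0 ≤ a)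
    (ha1 : a < 1) {u : Fin n → ℝ} (hu : |mle u - a| ≤ (1 - a) / 2) (i : Fin n) :
    0 ≤ proxyVar σ u i ∧ |proxyVar σ u i - σ ^ 2 / μ i| ≤
      σ ^ 2 * 4 / (1 - a) ^ 4 * (4 * |mle u - a| + 2 * Real.pi / (n + 1)) := by
  have hn : (0 : ℝ) < n + 1 := by positivity
  have ha : 0 < 1 - a := sub_pos.2 ha1
  obtain ⟨w, h1, h2, h3⟩ := h.exists_angle ha0 ha1 i
  have hμ := h.le_eigenvalue ha0 ha1 i
  set b := mle u with hb
  set w₀ := ((i : ℕ) + 1) * Real.pi / ((n : ℝ) + 1) with hw₀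
  obtain ⟨hu1, hu2⟩ := abs_le.1 hu
  have hb1 : |b| ≤ (1 + a) / 2 := abs_le.2 ⟨by linarith, by linarith⟩
  -- The denominator is at least `(1 - |b|) ^ 2`, and `|b| ≤ (1 + a) / 2`.
  have hD : (1 - a) ^ 2 / 4 ≤ 1 + b ^ 2 - 2 * b * Real.cos w₀ := by
    have h4 : b * Real.cos w₀ ≤ |b| := by
      calc b * Real.cos w₀ ≤ |b * Real.cos w₀| := le_abs_self _
        _ = |b| * |Real.cos w₀| := abs_mul _ _
        _ ≤ |b| * 1 := by gcongr; exact Real.abs_cos_le_one w₀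
        _ = |b| := mul_one _
    have h5 : b ^ 2 = |b| ^ 2 := (sq_abs b).symm
    nlinarith [abs_nonneg b]
  have hD0 : 0 < 1 + b ^ 2 - 2 * b * Real.cos w₀ := lt_of_lt_of_le (by positivity) hD
  have hμ0 : 0 < μ i := h.pos i
  refine ⟨div_nonneg (sq_nonneg σ) hD0.le, ?_⟩
  have hw₀w : |Real.cos w - Real.cos w₀| ≤ Real.pi / (n + 1) := by
    refine (Real.abs_cos_sub_cos_le w w₀).trans ?_
    have : w₀ = (i : ℕ) * Real.pi / (n + 1) + Real.pi / (n + 1) := by rw [hw₀]; ring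
    rw [abs_sub_comm]
    exact abs_le.2 ⟨by have : 0 ≤ Real.pi / ((n : ℝ) + 1) := by positivity
                       linarith, by linarith⟩
  have hnum : |μ i - (1 + b ^ 2 - 2 * b * Real.cos w₀)| ≤
      4 * |b - a| + 2 * Real.pi / (n + 1) := by
    have e : μ i - (1 + b ^ 2 - 2 * b * Real.cos w₀) =
        (b - a) * (2 * Real.cos w₀ - (a + b)) + -(2 * a) * (Real.cos w - Real.cos w₀) := by
      rw [h3]; ring
    rw [e]
    have i1 : |2 * Real.cos w₀ - (a + b)| ≤ 4 := by
      have := abs_le.1 hb1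
      exact abs_le.2 ⟨by linarith [Real.neg_one_le_cos w₀], by linarith [Real.cos_le_one w₀]⟩
    calc _ ≤ |(b - a) * (2 * Real.cos w₀ - (a + b))| + |-(2 * a) * (Real.cos w - Real.cos w₀)| :=
          abs_add_le _ _
      _ = |b - a| * |2 * Real.cos w₀ - (a + b)| + 2 * a * |Real.cos w - Real.cos w₀| := by
          rw [abs_mul, abs_mul, abs_neg, abs_of_nonneg (by positivity : 0 ≤ 2 * a)]
      _ ≤ |b - a| * 4 + 2 * 1 * (Real.pi / (n + 1)) := by gcongr
      _ = _ := by ring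
  rw [proxyVar, ← hb, ← hw₀, div_sub_div _ _ hD0.ne' hμ0.ne', abs_div,
    abs_of_pos (mul_pos hD0 hμ0), ← mul_comm (σ ^ 2) (1 + b ^ 2 - 2 * b * Real.cos w₀), ← mul_sub,
    abs_mul, abs_of_nonneg (sq_nonneg σ)]
  calc _ ≤ σ ^ 2 * (4 * |b - a| + 2 * Real.pi / (n + 1)) / ((1 - a) ^ 2 / 4 * (1 - a) ^ 2) := by
        gcongr
    _ = _ := by field_simp

end

/-! ### Concentration for Gaussian vectors -/

theorem integral_pow_gaussianReal (k : ℕ) :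
    ∫ x, x ^ (2 * k) ∂(gaussianReal 0 1) = ((2 * k - 1)‼ : ℕ) := by
  rw [integral_gaussianReal_eq_integral_smul one_ne_zero]
  simp only [gaussianPDFReal, NNReal.coe_one, mul_one, sub_zero, smul_eq_mul]
  have h1 : ∀ x : ℝ, (√(2 * Real.pi))⁻¹ * Real.exp (-x ^ 2 / 2) * x ^ (2 * k) =
      (√(2 * Real.pi))⁻¹ * (fun y => y ^ (2 * k) * Real.exp (-(1 / 2) * y ^ (2 : ℕ))) |x| := by
    intro x
    simp only [pow_mul, sq_abs]
    ring_nf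
  simp_rw [h1]
  rw [integral_const_mul,
    integral_comp_abs (f := fun y => y ^ (2 * k) * Real.exp (-(1 / 2) * y ^ (2 : ℕ)))]
  have h2 := integral_rpow_mul_exp_neg_mul_rpow (p := 2) (q := 2 * k) (b := 1 / 2)
    two_pos (by have : (0 : ℝ) ≤ k := by positivity
                linarith) (by norm_num)
  have h3 : ∫ x in Set.Ioi (0 : ℝ), x ^ (2 * k) * Real.exp (-(1 / 2) * x ^ (2 : ℕ)) =
      ∫ x in Set.Ioi (0 : ℝ), x ^ (2 * k : ℝ) * Real.exp (-(1 / 2) * x ^ (2 : ℝ)) := by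
    congr 1
    ext x
    rw [← Real.rpow_natCast, ← Real.rpow_natCast]
    push_cast
    rfl
  rw [h3, h2, show ((2 : ℝ) * k + 1) / 2 = k + 1 / 2 by ring, Real.Gamma_nat_add_half,
    show -((2 : ℝ) * k + 1) / 2 = -(k + 1 / 2) by ring, one_div, Real.inv_rpow two_pos.le,
    Real.rpow_neg two_pos.le, inv_inv, Real.rpow_add two_pos, Real.rpow_natCast,
    show (2 : ℝ) ^ (2⁻¹ : ℝ) = √2 by rw [Real.sqrt_eq_rpow, one_div],
    Real.sqrt_mul two_pos.le]
  have : √2 ≠ 0 := by positivity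
  have : √Real.pi ≠ 0 := by have := Real.pi_pos; positivity
  field_simp

section
variable {n : ℕ}

theorem diagGaussian_eq_map {s : Fin n → ℝ} (hs : ∀ i, 0 < s i) :
    diagGaussian s = (diagGaussian fun _ => 1).map fun x i => √(s i) * x i := by
  have h : ∀ i, (gaussianReal 0 (1 : ℝ).toNNReal).map (fun x => √(s i) * x) =
      gaussianReal 0 (s i).toNNReal := fun i => by
    rw [gaussianReal_map_const_mul, mul_zero]
    congr 1
    ext
    simp [(hs i).le]
  have hsf : ∀ i, SigmaFinite ((gaussianReal 0 (1 : ℝ).toNNReal).map (fun x => √(s i) * x)) :=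
    fun i => by rw [h]; infer_instance
  rw [diagGaussian, diagGaussian, Measure.pi_map_pi fun i => by fun_prop]
  simp_rw [h]

/-- Reducing to unit variances makes the moment constants independent of the spectrum and of `n`. -/
theorem diagGaussian_real_normalized {s : Fin n → ℝ} (hs : ∀ i, 0 < s i)
    {p : (Fin n → ℝ) → Prop} (hp : MeasurableSet {w | p w}) :
    (diagGaussian s).real {x | p fun i => x i ^ 2 / s i} =
      (diagGaussian fun _ : Fin n => 1).real {x | p fun i => x i ^ 2} := by
  have hm : MeasurableSet {x : Fin n → ℝ | p fun i => x i ^ 2 / s i} :=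
    hp.preimage (f := fun x : Fin n → ℝ => fun i => x i ^ 2 / s i) (by fun_prop)
  rw [diagGaussian_eq_map hs, measureReal_def, Measure.map_apply (by fun_prop) hm, measureReal_def]
  refine congrArg (fun A => (diagGaussian fun _ : Fin n => (1 : ℝ)) A |>.toReal) (Set.ext fun x => ?_)
  have : (fun i => (√(s i) * x i) ^ 2 / s i) = fun i => x i ^ 2 := by
    ext i
    rw [mul_pow, Real.sq_sqrt (hs i).le]
    have := (hs i).ne'
    field_simp
  change p (fun i => (√(s i) * x i) ^ 2 / s i) ↔ p _
  rw [this]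

/-- A Chebyshev bound for even moments. -/
theorem exists_moment_concentration (k : ℕ) : ∃ C : ℝ, 0 ≤ C ∧ ∀ (n : ℕ) (s : Fin n → ℝ),
    (∀ i, 0 < s i) → ∀ ε : ℝ, 0 < ε → 0 < n →
    (diagGaussian s).real {x | ε ≤ |(1 / (n : ℝ)) * ∑ i, (x i ^ 2 / s i) ^ k -
      ((2 * k - 1)‼ : ℕ)|} ≤ C / (n * ε ^ 2) := by
  refine ⟨Var[fun x => x ^ (2 * k); gaussianReal 0 1], variance_nonneg _ _, ?_⟩
  intro n s hs ε hε hn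
  have hn' : (0 : ℝ) < n := by exact_mod_cast hn
  rw [diagGaussian_real_normalized hs (p := fun w => ε ≤ |(1 / (n : ℝ)) * ∑ i, w i ^ k -
      ((2 * k - 1)‼ : ℕ)|) (measurableSet_le measurable_const (by fun_prop))]
  have hL : MemLp (fun x : ℝ => x ^ (2 * k)) 2 (gaussianReal 0 1) := by
    have h0 : MemLp (fun x : ℝ => x) ((2 * (2 * k) : ℕ) : ℝ≥0∞) (gaussianReal 0 1) :=
      memLp_id_gaussianReal' _ (ENNReal.natCast_ne_top _)
    rcases Nat.eq_zero_or_pos k with rfl | hk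
    · simpa using memLp_const (1 : ℝ)
    rw [memLp_two_iff_integrable_sq (by fun_prop)]
    have := h0.integrable_norm_pow (by omega)
    refine this.congr (ae_of_all _ fun x => ?_)
    simp only [Real.norm_eq_abs]
    rw [mul_comm 2 (2 * k), pow_mul, pow_mul, sq_abs, ← pow_mul x 2 k]
  have h1 : (1 : ℝ).toNNReal = 1 := by simp
  have hLi : ∀ i : Fin n, MemLp (fun x : Fin n → ℝ => x i ^ (2 * k)) 2
      (diagGaussian fun _ : Fin n => 1) := fun i => by
    refine MemLp.comp_measurePreserving (g := fun x : ℝ => x ^ (2 * k)) (p := 2) ?_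
      (measurePreserving_eval (fun _ : Fin n => gaussianReal 0 (1 : ℝ).toNNReal) i)
    rwa [h1]
  have hvar : Var[fun x : Fin n → ℝ => ∑ i, x i ^ (2 * k); diagGaussian fun _ : Fin n => 1] =
      n * Var[fun x => x ^ (2 * k); gaussianReal 0 1] := by
    have := variance_sum_pi (μ := fun _ : Fin n => gaussianReal 0 (1 : ℝ).toNNReal)
      (X := fun _ x => x ^ (2 * k)) (fun i => by rwa [h1])
    rw [diagGaussian]
    simp only [h1] at this ⊢
    convert this using 1
    · congr 1
      ext x
      simp
    · simp
  have hint : ∫ x, ∑ i, x i ^ (2 * k) ∂(diagGaussian fun _ : Fin n => 1) =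
      n * ((2 * k - 1)‼ : ℕ) := by
    rw [integral_finsetSum _ fun i _ => (hLi i).integrable one_le_two]
    have : ∀ i : Fin n, ∫ x, x i ^ (2 * k) ∂(diagGaussian fun _ : Fin n => 1) =
        ((2 * k - 1)‼ : ℕ) := fun i => by
      rw [diagGaussian, integral_comp_eval (i := i) (X := fun _ => ℝ)
        (f := fun y : ℝ => y ^ (2 * k)) (by fun_prop), h1, integral_pow_gaussianReal]
    simp [this]
  have hcheb := meas_ge_le_variance_div_sq (memLp_finsetSum' Finset.univ fun i _ => hLi i)
    (c := n * ε) (by positivity)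
  simp only [Finset.sum_fn] at hcheb
  rw [hvar, hint] at hcheb
  rw [measureReal_def]
  refine ENNReal.toReal_le_of_le_ofReal
    (div_nonneg (variance_nonneg _ _) (by positivity)) ?_
  refine le_trans (measure_mono fun x hx => ?_) (hcheb.trans (ENNReal.ofReal_le_ofReal ?_))
  · simp only [Set.mem_ofPred_eq, ← pow_mul] at hx ⊢
    calc (n : ℝ) * ε ≤ n * |(1 / (n : ℝ)) * ∑ i, x i ^ (2 * k) - ((2 * k - 1)‼ : ℕ)| := by gcongr
      _ = |n * ((1 / (n : ℝ)) * ∑ i, x i ^ (2 * k) - ((2 * k - 1)‼ : ℕ))| := by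
          rw [abs_mul, abs_of_pos hn']
      _ = _ := by congr 1; field_simp
  · refine le_of_eq ?_
    field_simp

theorem neg_log_one_sub_le {v : ℝ} (hv : v ≤ 1 / 2) : -Real.log (1 - v) ≤ v + 2 * v ^ 2 := by
  have h0 : 0 < 1 - v := by linarith
  have h1 := Real.one_sub_inv_le_log_of_pos h0
  have h2 : (1 - v)⁻¹ - 1 ≤ v + 2 * v ^ 2 := by
    have : (1 - v)⁻¹ - 1 = v / (1 - v) := by field_simp; ring
    rw [this, div_le_iff₀ h0]
    nlinarith [mul_nonneg (sq_nonneg v) (show 0 ≤ 1 - 2 * v by linarith)]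
  linarith

/-- Each factor has exponent `-t b - log (1 - 2 t b) / 2`, at most `4 t² b²` when `2 t b ≤ 1 / 2`.
-/
theorem lintegral_exp_quadratic_le {s b : Fin n → ℝ} {B t : ℝ} (hs : ∀ i, 0 < s i)
    (hb : ∀ i, |b i| ≤ B) (ht : 0 ≤ t) (htB : t * B ≤ 1 / 4) :
    ∫⁻ x, ENNReal.ofReal (Real.exp (t * ∑ i, b i * (x i ^ 2 / s i - 1))) ∂(diagGaussian s) ≤
      ENNReal.ofReal (Real.exp (4 * n * t ^ 2 * B ^ 2)) := by
  have h1 : ∀ x : Fin n → ℝ, ENNReal.ofReal (Real.exp (t * ∑ i, b i * (x i ^ 2 / s i - 1))) =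
      ∏ i, ENNReal.ofReal (Real.exp (-(-(t * b i / s i)) * x i ^ 2 + 0 * x i + -(t * b i))) := by
    intro x
    rw [← ENNReal.ofReal_prod_of_nonneg fun i _ => Real.exp_nonneg _, ← Real.exp_sum,
      Finset.mul_sum]
    congr 2
    exact Finset.sum_congr rfl fun i _ => by ring
  simp_rw [h1]
  rw [diagGaussian, lintegral_pi_prod _ (f := fun i y => ENNReal.ofReal (Real.exp
    (-(-(t * b i / s i)) * y ^ 2 + 0 * y + -(t * b i)))) fun i => by fun_prop]
  have h2 : ∀ i, ∫⁻ y, ENNReal.ofReal (Real.exp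
      (-(-(t * b i / s i)) * y ^ 2 + 0 * y + -(t * b i))) ∂(gaussianReal 0 (s i).toNNReal) ≤
      ENNReal.ofReal (Real.exp (4 * t ^ 2 * B ^ 2)) := fun i => by
    have hsi := (hs i).ne'
    have htb : |t * b i| ≤ 1 / 4 := by
      rw [abs_mul, abs_of_nonneg ht]
      exact (mul_le_mul_of_nonneg_left (hb i) ht).trans htB
    have e : 1 + 2 * -(t * b i / s i) * s i = 1 - 2 * (t * b i) := by field_simp; ring
    have hv : 2 * (t * b i) ≤ 1 / 2 := by linarith [(abs_le.1 htb).2]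
    rw [lintegral_exp_gaussianReal (hs i).le (by rw [e]; linarith), e]
    refine ENNReal.ofReal_le_ofReal (Real.exp_le_exp.2 ?_)
    have h3 := neg_log_one_sub_le hv
    have h4 : (t * b i) ^ 2 ≤ t ^ 2 * B ^ 2 := by
      rw [mul_pow]
      gcongr ?_ * ?_
      rw [← sq_abs (b i)]
      exact pow_le_pow_left₀ (abs_nonneg _) (hb i) 2
    nlinarith
  refine (Finset.prod_le_prod' fun i _ => h2 i).trans ?_
  rw [Finset.prod_const, ← ENNReal.ofReal_pow (Real.exp_nonneg _), ← Real.exp_nat_mul]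
  simp only [Finset.card_univ, Fintype.card_fin]
  exact le_of_eq (by congr 2; ring)

theorem measureReal_le_of_exp_lintegral {Ω : Type*} [MeasurableSpace Ω] {P : Measure Ω}
    {f : Ω → ℝ} (hf : Measurable f) {c r : ℝ}
    (h : ∫⁻ x, ENNReal.ofReal (Real.exp (f x)) ∂P ≤ ENNReal.ofReal (Real.exp c)) {E : Set Ω}
    (hE : ∀ x ∈ E, r ≤ f x) : P.real E ≤ Real.exp (c - r) := by
  refine ENNReal.toReal_le_of_le_ofReal (Real.exp_nonneg _) ?_
  have h1 := mul_meas_ge_le_lintegral (μ := P) (f := fun x => ENNReal.ofReal (Real.exp (f x)))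
    (by fun_prop) (ENNReal.ofReal (Real.exp r))
  have h2 : P E ≤ P {x | ENNReal.ofReal (Real.exp r) ≤ ENNReal.ofReal (Real.exp (f x))} :=
    measure_mono fun x hx => ENNReal.ofReal_le_ofReal (Real.exp_le_exp.2 (hE x hx))
  rw [Real.exp_sub, ENNReal.ofReal_div_of_pos (Real.exp_pos _),
    ENNReal.le_div_iff_mul_le (Or.inl (by simp [Real.exp_pos])) (Or.inl ENNReal.ofReal_ne_top),
    mul_comm]
  exact (mul_le_mul_right h2 _).trans (h1.trans h)

/-- A Bernstein bound for diagonal Gaussian quadratic forms. -/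
theorem quadratic_concentration {s b : Fin n → ℝ} {B r : ℝ} (hs : ∀ i, 0 < s i)
    (hb : ∀ i, |b i| ≤ B) (hB : 0 < B) (hr : 0 ≤ r) (hrB : r ≤ 2 * B) :
    (diagGaussian s).real {x | n * r ≤ |∑ i, b i * (x i ^ 2 / s i - 1)|} ≤
      2 * Real.exp (-(n * r ^ 2 / (16 * B ^ 2))) := by
  have key : ∀ b : Fin n → ℝ, (∀ i, |b i| ≤ B) →
      (diagGaussian s).real {x | n * r ≤ ∑ i, b i * (x i ^ 2 / s i - 1)} ≤
      Real.exp (-(n * r ^ 2 / (16 * B ^ 2))) := fun b hb => by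
    -- This parameter minimizes `4 n t² B² - t n r`; `r ≤ 2 * B` keeps it admissible.
    have ht : 0 ≤ r / (8 * B ^ 2) := by positivity
    have htB : r / (8 * B ^ 2) * B ≤ 1 / 4 := by
      have : r / (8 * B ^ 2) * B = r / (8 * B) := by field_simp
      rw [this, div_le_iff₀ (by positivity)]; linarith
    have := measureReal_le_of_exp_lintegral (by fun_prop)
      (lintegral_exp_quadratic_le hs hb ht htB)
      (r := r / (8 * B ^ 2) * (n * r))
      (E := {x | n * r ≤ ∑ i, b i * (x i ^ 2 / s i - 1)})
      (fun x hx => mul_le_mul_of_nonneg_left hx ht)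
    refine this.trans (le_of_eq ?_)
    congr 1
    field_simp
    ring
  have hsub : {x : Fin n → ℝ | n * r ≤ |∑ i, b i * (x i ^ 2 / s i - 1)|} ⊆
      {x | n * r ≤ ∑ i, b i * (x i ^ 2 / s i - 1)} ∪
      {x | n * r ≤ ∑ i, -b i * (x i ^ 2 / s i - 1)} := fun x hx => by
    rcases le_abs.1 (show n * r ≤ |∑ i, b i * (x i ^ 2 / s i - 1)| from hx) with h | h
    · exact Or.inl h
    · refine Or.inr ?_
      simp only [Set.mem_ofPred_eq, neg_mul, Finset.sum_neg_distrib]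
      exact h
  have h1 := key b hb
  have h2 := key (fun i => -b i) (fun i => by rw [abs_neg]; exact hb i)
  calc _ ≤ _ := measureReal_mono hsub
    _ ≤ _ := measureReal_union_le _ _
    _ ≤ _ := by linarith

end

/-! ### Concentration of the maximum likelihood estimate -/

section
variable {a σ : ℝ}

theorem path_congr (a : ℝ) {z z' : ℕ → ℝ} {k : ℕ} (h : ∀ j < k, z j = z' j) :
    path a z k = path a z' k := by
  induction k with
  | zero => rfl
  | succ k ih =>
    simp only [path]
    rw [ih fun j hj => h j (hj.trans k.lt_succ_self), h k k.lt_succ_self]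

/-- The innovation `z k` is independent of the past. -/
theorem lintegral_innovation_step (σ : ℝ) (k : ℕ) {F : (ℕ → ℝ) → ℝ → ℝ≥0∞}
    (hF : Measurable (Function.uncurry F))
    (hdep : ∀ z z' y, (∀ j < k, z j = z' j) → F z y = F z' y) :
    ∫⁻ z, F z (z k) ∂(innovationLaw σ) =
      ∫⁻ z, ∫⁻ y, F z y ∂(gaussianReal 0 (σ ^ 2).toNNReal) ∂(innovationLaw σ) := by
  -- Restricting to the first `k` innovations and padding by zero leaves `F` unchanged, so
  -- independence of finite blocks applies.
  set r : (ℕ → ℝ) → (Finset.range k → ℝ) := fun z j => z j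
  set ext : (Finset.range k → ℝ) → (ℕ → ℝ) := fun w j => if h : j ∈ Finset.range k then w ⟨j, h⟩
    else 0
  have hr : Measurable r := measurable_pi_lambda _ fun j => measurable_pi_apply _
  have hext : Measurable ext := measurable_pi_lambda _ fun j => by
    by_cases h : j ∈ Finset.range k
    · simp only [ext, h, dite_true]; exact measurable_pi_apply _
    · simp only [ext, h, dite_false]; exact measurable_const
  have hFe : ∀ z y, F z y = F (ext (r z)) y := fun z y => hdep _ _ _ fun j hj => by
    simp [ext, r, hj]
  have hind : IndepFun r (fun z : ℕ → ℝ => z k) (innovationLaw σ) := by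
    have h : iIndepFun (fun (i : ℕ) (z : ℕ → ℝ) => z i) (innovationLaw σ) :=
      iIndepFun_infinitePi (X := fun _ x => x) (fun i => by fun_prop)
    have h2 := h.indepFun_finset (Finset.range k) {k} (by simp) (fun i => measurable_pi_apply i)
    have h3 := h2.comp measurable_id (measurable_pi_apply
      (⟨k, Finset.mem_singleton_self k⟩ : ({k} : Finset ℕ)))
    exact h3
  have hlaw : (innovationLaw σ).map (fun z => z k) = gaussianReal 0 (σ ^ 2).toNNReal :=
    Measure.infinitePi_map_eval _ _
  have hprod := (indepFun_iff_map_prod_eq_prod_map_map hr.aemeasurable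
    (measurable_pi_apply k).aemeasurable).1 hind
  rw [hlaw] at hprod
  have hG : Measurable fun p : (Finset.range k → ℝ) × ℝ => F (ext p.1) p.2 :=
    hF.comp ((hext.comp measurable_fst).prodMk measurable_snd)
  have : IsProbabilityMeasure ((innovationLaw σ).map r) :=
    Measure.isProbabilityMeasure_map hr.aemeasurable
  calc ∫⁻ z, F z (z k) ∂(innovationLaw σ)
      = ∫⁻ z, (fun p : (Finset.range k → ℝ) × ℝ => F (ext p.1) p.2) (r z, z k)
          ∂(innovationLaw σ) := lintegral_congr fun z => hFe z _
    _ = ∫⁻ p, F (ext p.1) p.2 ∂((innovationLaw σ).map fun z => (r z, z k)) :=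
        (lintegral_map hG (hr.prodMk (measurable_pi_apply k))).symm
    _ = ∫⁻ w, ∫⁻ y, F (ext w) y ∂(gaussianReal 0 (σ ^ 2).toNNReal) ∂((innovationLaw σ).map r) := by
        rw [hprod, lintegral_prod _ hG.aemeasurable]
    _ = _ := by
        rw [lintegral_map hG.lintegral_prod_right' hr]
        exact lintegral_congr fun z => lintegral_congr fun y => (hFe z y).symm

/-- The score `∑ U_{k} Z_{k+1}`. -/
def score (a : ℝ) (n : ℕ) (z : ℕ → ℝ) : ℝ := ∑ k ∈ Finset.range n, path a z k * z k

/-- The energy `∑ U_k²`. -/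
def energy (a : ℝ) (n : ℕ) (z : ℕ → ℝ) : ℝ := ∑ k ∈ Finset.range n, path a z k ^ 2

theorem measurable_score (a : ℝ) (n : ℕ) : Measurable (score a n) :=
  Finset.measurable_sum _ fun k _ => (measurable_path a k).mul (measurable_pi_apply k)

theorem measurable_energy (a : ℝ) (n : ℕ) : Measurable (energy a n) :=
  Finset.measurable_sum _ fun k _ => (measurable_path a k).pow_const 2

/-- An exponential martingale: given the past, the new score term is centered Gaussian, and the
energy term cancels its log-moment generating function exactly. -/
theorem lintegral_exp_score (a σ t : ℝ) (n : ℕ) :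
    ∫⁻ z, ENNReal.ofReal (Real.exp (t * score a n z - t ^ 2 * σ ^ 2 / 2 * energy a n z))
      ∂(innovationLaw σ) = 1 := by
  induction n with
  | zero => simp [score, energy]
  | succ n ih =>
    have hs := measurable_score a n
    have he := measurable_energy a n
    have hp := measurable_path a n
    have := lintegral_innovation_step σ n (F := fun z y => ENNReal.ofReal (Real.exp
      (t * (score a n z + path a z n * y) - t ^ 2 * σ ^ 2 / 2 * (energy a n z + path a z n ^ 2))))
      (by
        refine (Real.measurable_exp.comp ?_).ennreal_ofReal
        exact (((hs.comp measurable_fst).add ((hp.comp measurable_fst).mul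
          measurable_snd)).const_mul t).sub (((he.comp measurable_fst).add
          ((hp.comp measurable_fst).pow_const 2)).const_mul _))
      (fun z z' y h => by
        have h1 : ∀ k ≤ n, path a z k = path a z' k := fun k hk =>
          path_congr a fun j hj => h j (hj.trans_le hk)
        have h2 : score a n z = score a n z' := Finset.sum_congr rfl fun k hk => by
          rw [h1 k (Finset.mem_range.1 hk).le, h k (Finset.mem_range.1 hk)]
        have h3 : energy a n z = energy a n z' := Finset.sum_congr rfl fun k hk => by
          rw [h1 k (Finset.mem_range.1 hk).le]
        rw [h1 n le_rfl, h2, h3])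
    simp only [score, energy, Finset.sum_range_succ] at this ih ⊢
    rw [this, ← ih]
    refine lintegral_congr fun z => ?_
    have e : ∀ y : ℝ, t * (∑ k ∈ Finset.range n, path a z k * z k + path a z n * y) -
        t ^ 2 * σ ^ 2 / 2 * (∑ k ∈ Finset.range n, path a z k ^ 2 + path a z n ^ 2) =
        -0 * y ^ 2 + (t * path a z n) * y + (t * ∑ k ∈ Finset.range n, path a z k * z k -
        t ^ 2 * σ ^ 2 / 2 * (∑ k ∈ Finset.range n, path a z k ^ 2 + path a z n ^ 2)) :=
      fun y => by ring
    simp_rw [e]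
    rw [lintegral_exp_gaussianReal (sq_nonneg σ) (by norm_num)]
    congr 2
    simp
    ring

/-- The bound is the fixed point of the second-moment recursion `x ↦ a ^ 2 * x + σ ^ 2`. -/
theorem lintegral_path_sq_le (ha0 : 0 ≤ a) (ha1 : a < 1) (σ : ℝ) (n : ℕ) :
    ∫⁻ z, ENNReal.ofReal (path a z n ^ 2) ∂(innovationLaw σ) ≤
      ENNReal.ofReal (σ ^ 2 / (1 - a ^ 2)) := by
  have ha : 0 < 1 - a ^ 2 := by nlinarith
  induction n with
  | zero => simp [path]
  | succ n ih =>
    have hp := measurable_path a n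
    have := lintegral_innovation_step σ n
      (F := fun z y => ENNReal.ofReal ((a * path a z n + y) ^ 2))
      ((((hp.comp measurable_fst).const_mul a).add measurable_snd).pow_const 2).ennreal_ofReal
      (fun z z' y h => by rw [path_congr a h])
    simp only [path]
    rw [this]
    have e : ∀ z, ∫⁻ y, ENNReal.ofReal ((a * path a z n + y) ^ 2)
        ∂(gaussianReal 0 (σ ^ 2).toNNReal) =
        ENNReal.ofReal (a ^ 2) * ENNReal.ofReal (path a z n ^ 2) + ENNReal.ofReal (σ ^ 2) :=
      fun z => by
      have h1 : ∀ y, (a * path a z n + y) ^ 2 = (y - -(a * path a z n)) ^ 2 := fun y => by ring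
      simp_rw [h1]
      rw [← ofReal_integral_eq_lintegral_ofReal (integrable_sq_sub_gaussianReal _ _ _)
        (ae_of_all _ fun y => sq_nonneg _), integral_sq_sub_gaussianReal,
        ← ENNReal.ofReal_mul (sq_nonneg a), ← ENNReal.ofReal_add (by positivity) (sq_nonneg σ),
        Real.coe_toNNReal _ (sq_nonneg σ)]
      congr 1
      ring
    simp_rw [e]
    rw [lintegral_add_right _ measurable_const, lintegral_const_mul _ (by fun_prop)]
    calc _ ≤ ENNReal.ofReal (a ^ 2) * ENNReal.ofReal (σ ^ 2 / (1 - a ^ 2)) +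
          ENNReal.ofReal (σ ^ 2) := by gcongr; simp
      _ = ENNReal.ofReal (σ ^ 2 / (1 - a ^ 2)) := by
          rw [← ENNReal.ofReal_mul (sq_nonneg a), ← ENNReal.ofReal_add
            (mul_nonneg (sq_nonneg a) (div_nonneg (sq_nonneg σ) ha.le)) (sq_nonneg σ)]
          congr 1
          field_simp
          ring

/-- Squaring the recursion and telescoping; it transfers concentration of the squared innovations to
the energy. -/
theorem energy_identity (a : ℝ) (n : ℕ) (z : ℕ → ℝ) :
    (1 - a ^ 2) * energy a n z =
      ∑ k ∈ Finset.range n, z k ^ 2 + 2 * a * score a n z - path a z n ^ 2 := by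
  induction n with
  | zero => simp [energy, score, path]
  | succ n ih =>
    simp only [energy, score, Finset.sum_range_succ] at ih ⊢
    simp only [path]
    linear_combination ih

theorem mle_sourceVec (a : ℝ) (n : ℕ) (z : ℕ → ℝ) (h : energy a n z ≠ 0) :
    mle (sourceVec a n z) - a = score a n z / energy a n z := by
  rcases n with _ | m
  · simp [energy] at h
  -- Since `U₀ = 0`, a zero term can be prepended, turning the sums in the estimator into sums over
  -- `range (m + 1)`.
  have key : ∀ f : ℕ → ℝ, f 0 = 0 →
      (∑ i : Fin (m + 1), if (i : ℕ) + 1 < m + 1 then f (i + 1) else 0) =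
      ∑ k ∈ Finset.range (m + 1), f k := fun f hf => by
    rw [Finset.sum_range_succ', hf, add_zero, Fin.sum_univ_eq_sum_range
      (fun i => if i + 1 < m + 1 then f (i + 1) else 0), Finset.sum_range_succ]
    simp only [lt_self_iff_false, if_false, add_zero]
    exact Finset.sum_congr rfl fun i hi => if_pos (by simpa using hi)
  have h1 : (∑ i : Fin (m + 1), if h : (i : ℕ) + 1 < m + 1 then
      sourceVec a (m + 1) z i * sourceVec a (m + 1) z ⟨i + 1, h⟩ else 0) =
      ∑ k ∈ Finset.range (m + 1), path a z k * path a z (k + 1) := by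
    rw [← key (fun k => path a z k * path a z (k + 1)) (by simp [path])]
    refine Finset.sum_congr rfl fun i _ => ?_
    by_cases hi : (i : ℕ) + 1 < m + 1
    · rw [dif_pos hi, if_pos hi]; rfl
    · rw [dif_neg hi, if_neg hi]
  have h2 : (∑ i : Fin (m + 1), if (i : ℕ) + 1 < m + 1 then sourceVec a (m + 1) z i ^ 2 else 0) =
      energy a (m + 1) z := by
    rw [energy, ← key (fun k => path a z k ^ 2) (by simp [path])]
    rfl
  have h3 : ∑ k ∈ Finset.range (m + 1), path a z k * path a z (k + 1) =
      a * energy a (m + 1) z + score a (m + 1) z := by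
    rw [energy, score, Finset.mul_sum, ← Finset.sum_add_distrib]
    exact Finset.sum_congr rfl fun k _ => by simp only [path]; ring
  rw [mle, h1, h2, h3]
  field_simp
  ring

/-- Chernoff with the parameter `±η / σ ^ 2`: on the event the exponent is at least `η ^ 2 / (2 * σ
^ 2)` times the energy, so only a lower bound on the energy is used. -/
theorem score_tail (hσ : 0 < σ) {η v : ℝ} (n : ℕ) :
    (innovationLaw σ).real {z | v ≤ energy a n z ∧ η * energy a n z ≤ |score a n z| ∧ 0 ≤ η} ≤
      2 * Real.exp (-(η ^ 2 * v / (2 * σ ^ 2))) := by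
  have key : ∀ τ : ℝ, τ = 1 ∨ τ = -1 → (innovationLaw σ).real
      {z | v ≤ energy a n z ∧ η * energy a n z ≤ τ * score a n z ∧ 0 ≤ η} ≤
      Real.exp (-(η ^ 2 * v / (2 * σ ^ 2))) := fun τ hτ => by
    have hτ2 : τ ^ 2 = 1 := by rcases hτ with rfl | rfl <;> norm_num
    have h1 := lintegral_exp_score a σ (τ * (η / σ ^ 2)) n
    rw [← ENNReal.ofReal_one, ← Real.exp_zero] at h1
    have := measureReal_le_of_exp_lintegral (r := η ^ 2 * v / (2 * σ ^ 2))
      (((measurable_score a n).const_mul _).sub ((measurable_energy a n).const_mul _)) h1.le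
      (E := {z | v ≤ energy a n z ∧ η * energy a n z ≤ τ * score a n z ∧ 0 ≤ η}) ?_
    · rwa [zero_sub] at this
    · rintro z ⟨hz1, hz2, hη⟩
      have e : (τ * (η / σ ^ 2)) * score a n z - (τ * (η / σ ^ 2)) ^ 2 * σ ^ 2 / 2 * energy a n z =
          η / σ ^ 2 * (τ * score a n z) - η ^ 2 / (2 * σ ^ 2) * energy a n z := by
        rw [mul_pow, hτ2]; field_simp
      rw [Pi.sub_apply, e]
      have h3 : η / σ ^ 2 * (η * energy a n z) ≤ η / σ ^ 2 * (τ * score a n z) := by gcongr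
      have h4 : η ^ 2 / (2 * σ ^ 2) * v ≤ η ^ 2 / (2 * σ ^ 2) * energy a n z := by gcongr
      have e2 : η / σ ^ 2 * (η * energy a n z) = 2 * (η ^ 2 / (2 * σ ^ 2) * energy a n z) := by
        field_simp
      rw [mul_div_right_comm]
      linarith
  have hsub : {z | v ≤ energy a n z ∧ η * energy a n z ≤ |score a n z| ∧ 0 ≤ η} ⊆
      {z | v ≤ energy a n z ∧ η * energy a n z ≤ 1 * score a n z ∧ 0 ≤ η} ∪
      {z | v ≤ energy a n z ∧ η * energy a n z ≤ -1 * score a n z ∧ 0 ≤ η} := by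
    rintro z ⟨h1, h2, h3⟩
    rcases le_abs.1 h2 with h | h
    · exact Or.inl ⟨h1, by rwa [one_mul], h3⟩
    · exact Or.inr ⟨h1, by rwa [neg_one_mul], h3⟩
  calc _ ≤ _ := measureReal_mono hsub
    _ ≤ _ := measureReal_union_le _ _
    _ ≤ _ := by linarith [key 1 (Or.inl rfl), key (-1) (Or.inr rfl)]

/-- Here a small energy limits the compensator, making a very negative score unlikely. This lets the
energy bound use the score without circularity. -/
theorem score_lower_tail (hσ : 0 < σ) {ε v : ℝ} (hε : 0 ≤ ε) (hv : 0 < v) (n : ℕ) :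
    (innovationLaw σ).real {z | energy a n z ≤ n * v ∧ score a n z ≤ -(n * ε)} ≤
      Real.exp (-(n * (ε ^ 2 / (2 * σ ^ 2 * v)))) := by
  have h1 := lintegral_exp_score a σ (-(ε / (σ ^ 2 * v))) n
  rw [← ENNReal.ofReal_one, ← Real.exp_zero] at h1
  have := measureReal_le_of_exp_lintegral (r := n * (ε ^ 2 / (2 * σ ^ 2 * v)))
    (((measurable_score a n).const_mul _).sub ((measurable_energy a n).const_mul _)) h1.le
    (E := {z | energy a n z ≤ n * v ∧ score a n z ≤ -(n * ε)}) ?_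
  · rwa [zero_sub] at this
  · rintro z ⟨hz1, hz2⟩
    have e : -(ε / (σ ^ 2 * v)) * score a n z -
        (-(ε / (σ ^ 2 * v))) ^ 2 * σ ^ 2 / 2 * energy a n z =
        ε / (σ ^ 2 * v) * (-score a n z) - ε ^ 2 / (2 * σ ^ 2 * v ^ 2) * energy a n z := by
      field_simp
    rw [Pi.sub_apply, e]
    have h3 : ε / (σ ^ 2 * v) * (n * ε) ≤ ε / (σ ^ 2 * v) * (-score a n z) := by
      gcongr; linarith
    have h4 : ε ^ 2 / (2 * σ ^ 2 * v ^ 2) * energy a n z ≤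
      ε ^ 2 / (2 * σ ^ 2 * v ^ 2) * (n * v) := by gcongr
    have e2 : n * (ε ^ 2 / (2 * σ ^ 2 * v)) = ε / (σ ^ 2 * v) * (n * ε) -
      ε ^ 2 / (2 * σ ^ 2 * v ^ 2) * (n * v) := by field_simp; ring
    linarith

theorem exists_energy_tail (ha0 : 0 ≤ a) (ha1 : a < 1) (hσ : 0 < σ) :
    ∃ C : ℝ, 0 ≤ C ∧ ∀ n : ℕ, 0 < n →
      (innovationLaw σ).real {z | energy a n z < n * (σ ^ 2 / (2 * (1 - a ^ 2)))} ≤ C / n := by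
  have ha : 0 < 1 - a ^ 2 := by nlinarith
  obtain ⟨C, hC0, hC⟩ := exists_moment_concentration 1
  set v := σ ^ 2 / (2 * (1 - a ^ 2)) with hv
  have hv0 : 0 < v := by positivity
  set δ := (σ ^ 2 / 16) ^ 2 / (2 * σ ^ 2 * v) with hδ
  have hδ0 : 0 < δ := by positivity
  refine ⟨16 * C + 8 / (1 - a ^ 2) + 1 / δ, by positivity, fun n hn => ?_⟩
  have hn' : (0 : ℝ) < n := by exact_mod_cast hn
  set D1 : Set (ℕ → ℝ) := (fun z (i : Fin n) => z i) ⁻¹' {x : Fin n → ℝ | (1 / 4 : ℝ) ≤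
    |(1 / (n : ℝ)) * ∑ i, (x i ^ 2 / σ ^ 2) ^ 1 - ((2 * 1 - 1)‼ : ℕ)|} with hD1
  set D2 : Set (ℕ → ℝ) := {z | n * σ ^ 2 / 8 ≤ path a z n ^ 2} with hD2
  set D3 : Set (ℕ → ℝ) := {z | energy a n z ≤ n * v ∧ score a n z ≤ -(n * (σ ^ 2 / 16))} with hD3
  -- In units of `n σ²` the identity leaves `3/4 - 1/8 - 2/16 = 1/2` off the three bad events, which
  -- is the threshold. Chebyshev, Markov and Chernoff bound these events by `O(1/n)`.
  have hsub : {z | energy a n z < n * v} ⊆ D1 ∪ (D2 ∪ D3) := by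
    intro z hz
    by_contra hcon
    simp only [Set.mem_union, not_or] at hcon
    obtain ⟨h1, h2, h3⟩ := hcon
    have hz' : energy a n z < n * v := hz
    have h1' : |(1 / (n : ℝ)) * ∑ i : Fin n, (z i ^ 2 / σ ^ 2) ^ 1 - ((2 * 1 - 1)‼ : ℕ)| < 1 / 4 :=
      not_le.1 h1
    have h2' : path a z n ^ 2 < n * σ ^ 2 / 8 := not_le.1 h2
    have h3' : -(n * (σ ^ 2 / 16)) < score a n z := not_le.1 fun h => h3 ⟨hz'.le, h⟩
    have h4 : n * σ ^ 2 * (3 / 4) < ∑ k ∈ Finset.range n, z k ^ 2 := by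
      have h5 := (abs_lt.1 h1').1
      simp only [pow_one, ← Finset.sum_div] at h5
      rw [Finset.sum_range fun k => z k ^ 2]
      norm_num at h5
      rw [← div_eq_inv_mul, div_div] at h5
      have h6 : 3 / 4 < (∑ i : Fin n, z i ^ 2) / (σ ^ 2 * n) := by linarith
      rw [lt_div_iff₀ (by positivity)] at h6
      linarith
    have h5 := energy_identity a n z
    have h6 : (1 - a ^ 2) * energy a n z < (1 - a ^ 2) * (n * v) := by gcongr
    have h7 : (1 - a ^ 2) * (n * v) = n * σ ^ 2 / 2 := by rw [hv]; field_simp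
    have h8 : a * -(n * (σ ^ 2 / 16)) ≤ a * score a n z := by gcongr
    have h9 : a * (n * (σ ^ 2 / 16)) ≤ 1 * (n * (σ ^ 2 / 16)) := by gcongr
    linarith
  have p1 : (innovationLaw σ).real D1 ≤ 16 * C / n := by
    have := hC n (fun _ => σ ^ 2) (fun _ => by positivity) (1 / 4) (by norm_num) hn
    rw [← innovationLaw_map_fin, measureReal_def, Measure.map_apply (by
      exact measurable_pi_lambda _ fun i => measurable_pi_apply _)
      (measurableSet_le measurable_const (by fun_prop))] at this
    refine this.trans (le_of_eq ?_)
    field_simp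
    norm_num
  have p2 : (innovationLaw σ).real D2 ≤ 8 / (1 - a ^ 2) / n := by
    refine ENNReal.toReal_le_of_le_ofReal (by positivity) ?_
    have h1 := mul_meas_ge_le_lintegral (μ := innovationLaw σ)
      (f := fun z => ENNReal.ofReal (path a z n ^ 2))
      ((measurable_path a n).pow_const 2).ennreal_ofReal (ENNReal.ofReal (n * σ ^ 2 / 8))
    have h2 : innovationLaw σ D2 ≤ innovationLaw σ {z | ENNReal.ofReal (n * σ ^ 2 / 8) ≤
        ENNReal.ofReal (path a z n ^ 2)} :=
      measure_mono fun z hz => ENNReal.ofReal_le_ofReal hz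
    have e : 8 / (1 - a ^ 2) / n = (σ ^ 2 / (1 - a ^ 2)) / (n * σ ^ 2 / 8) := by field_simp
    rw [e, ENNReal.ofReal_div_of_pos (by positivity),
      ENNReal.le_div_iff_mul_le (Or.inl (by simp; positivity)) (Or.inl ENNReal.ofReal_ne_top),
      mul_comm]
    exact (mul_le_mul_right h2 _).trans (h1.trans (lintegral_path_sq_le ha0 ha1 σ n))
  have p3 : (innovationLaw σ).real D3 ≤ 1 / δ / n := by
    refine (score_lower_tail hσ (by positivity) hv0 n).trans ?_
    rw [← hδ, Real.exp_neg, div_div, one_div]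
    refine inv_anti₀ (by positivity) ?_
    have := Real.add_one_le_exp (n * δ)
    linarith
  calc (innovationLaw σ).real {z | energy a n z < n * v}
      ≤ (innovationLaw σ).real (D1 ∪ (D2 ∪ D3)) := measureReal_mono hsub
    _ ≤ (innovationLaw σ).real D1 + ((innovationLaw σ).real D2 + (innovationLaw σ).real D3) :=
        (measureReal_union_le _ _).trans (by gcongr; exact measureReal_union_le _ _)
    _ ≤ 16 * C / n + (8 / (1 - a ^ 2) / n + 1 / δ / n) := by gcongr
    _ = _ := by ring

/-- The error probability of the maximum likelihood estimate. -/
theorem exists_mle_tail (ha0 : 0 ≤ a) (ha1 : a < 1) (hσ : 0 < σ) :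
    ∃ C : ℝ, 0 ≤ C ∧ ∀ n : ℕ, 0 < n → ∀ η : ℝ, 0 ≤ η →
      (innovationLaw σ).real {z | η < |mle (sourceVec a n z) - a|} ≤
        2 * Real.exp (-(n * η ^ 2 / (4 * (1 - a ^ 2)))) + C / n := by
  have ha : 0 < 1 - a ^ 2 := by nlinarith
  obtain ⟨C, hC0, hC⟩ := exists_energy_tail ha0 ha1 hσ
  refine ⟨C, hC0, fun n hn η hη => ?_⟩
  have hn' : (0 : ℝ) < n := by exact_mod_cast hn
  set v := σ ^ 2 / (2 * (1 - a ^ 2)) with hv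
  have hv0 : 0 < v := by positivity
  have hsub : {z | η < |mle (sourceVec a n z) - a|} ⊆
      {z | n * v ≤ energy a n z ∧ η * energy a n z ≤ |score a n z| ∧ 0 ≤ η} ∪
      {z | energy a n z < n * v} := by
    intro z hz
    rcases lt_or_ge (energy a n z) (n * v) with h | h
    · exact Or.inr h
    · have h0 : 0 < energy a n z := lt_of_lt_of_le (by positivity) h
      have hz' : η < |mle (sourceVec a n z) - a| := hz
      rw [mle_sourceVec a n z h0.ne', abs_div, abs_of_pos h0, lt_div_iff₀ h0] at hz'
      exact Or.inl ⟨h, hz'.le, hη⟩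
  have h1 := score_tail (a := a) hσ (η := η) (v := n * v) n
  -- Taking `v` as half the stationary variance gives exactly the exponent of `kappa 2 a`.
  have e : η ^ 2 * (n * v) / (2 * σ ^ 2) = n * η ^ 2 / (4 * (1 - a ^ 2)) := by
    rw [hv]; field_simp; norm_num
  rw [e] at h1
  calc _ ≤ _ := measureReal_mono hsub
    _ ≤ _ := measureReal_union_le _ _
    _ ≤ _ := add_le_add h1 (hC n hn)

end

/-! ### The sequence `η_n` -/

theorem etaSeq_nonneg (α : ℝ) (n : ℕ) : 0 ≤ etaSeq α n := Real.sqrt_nonneg _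

theorem eventually_one_le_log_log : ∀ᶠ n : ℕ in atTop, 1 ≤ Real.log (Real.log n) :=
  (Real.tendsto_log_atTop.comp (Real.tendsto_log_atTop.comp
    tendsto_natCast_atTop_atTop)).eventually_ge_atTop 1

theorem eventually_mul_etaSeq_sq {α : ℝ} (hα : 0 < α) :
    ∀ᶠ n : ℕ in atTop, n * etaSeq α n ^ 2 = α * Real.log (Real.log n) := by
  filter_upwards [eventually_one_le_log_log, eventually_gt_atTop 0] with n h1 h2
  have : (0 : ℝ) < n := by exact_mod_cast h2
  rw [etaSeq, Real.sq_sqrt (by positivity)]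
  field_simp

theorem tendsto_etaSeq (α : ℝ) : Tendsto (etaSeq α) atTop (𝓝 0) := by
  have h1 : (fun x : ℝ => Real.log (Real.log x)) =o[atTop] fun x : ℝ => x :=
    (Real.isLittleO_log_id_atTop.comp_tendsto Real.tendsto_log_atTop).trans
      Real.isLittleO_log_id_atTop
  have h2 := (h1.tendsto_div_nhds_zero.comp tendsto_natCast_atTop_atTop).const_mul α
  have h3 := (Real.continuous_sqrt.tendsto 0).comp (by simpa using h2)
  rw [Real.sqrt_zero] at h3
  refine h3.congr fun n => ?_
  simp [etaSeq, mul_div_assoc]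

/-- This absorbs the eigenvalue localization error into `η_n`. -/
theorem eventually_inv_le_etaSeq {α : ℝ} (hα : 0 < α) :
    ∀ᶠ n : ℕ in atTop, 1 / ((n : ℝ) + 1) ≤ etaSeq α n := by
  filter_upwards [eventually_one_le_log_log, eventually_gt_atTop 0,
    tendsto_natCast_atTop_atTop.eventually_ge_atTop (1 / α)] with n h1 h2 h3
  have h2' : (0 : ℝ) < n := by exact_mod_cast h2
  refine Real.le_sqrt_of_sq_le ?_
  have h4 : 1 ≤ α * n := by rwa [div_le_iff₀' hα] at h3
  rw [div_pow, one_pow, div_le_div_iff₀ (by positivity) h2']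
  calc 1 * (n : ℝ) ≤ (α * n) * n * 1 := by nlinarith
    _ = α * 1 * (n * n) := by ring
    _ ≤ α * Real.log (Real.log n) * ((n : ℝ) + 1) ^ 2 := by gcongr; nlinarith

theorem eventually_exp_neg_etaSeq {α : ℝ} (hα : 0 < α) (k : ℝ) :
    ∀ᶠ n : ℕ in atTop,
      Real.exp (-(k * (n * etaSeq α n ^ 2))) = (Real.log n ^ (k * α))⁻¹ := by
  filter_upwards [eventually_mul_etaSeq_sq hα,
    (Real.tendsto_log_atTop.comp tendsto_natCast_atTop_atTop).eventually_gt_atTop 0] with n h1 h2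
  have h2' : 0 < Real.log (n : ℝ) := h2
  rw [h1, Real.exp_neg, Real.rpow_def_of_pos h2']
  congr 2
  ring

theorem eventually_inv_le_inv_log_rpow (k : ℝ) :
    ∀ᶠ n : ℕ in atTop, 1 / (n : ℝ) ≤ (Real.log n ^ k)⁻¹ := by
  have h1 := (isLittleO_log_rpow_rpow_atTop k one_pos).comp_tendsto
    (tendsto_natCast_atTop_atTop (R := ℝ))
  filter_upwards [h1.bound one_pos, eventually_gt_atTop 0,
    (Real.tendsto_log_atTop.comp tendsto_natCast_atTop_atTop).eventually_gt_atTop 0]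
    with n h2 h3 h4
  have h4' : 0 < Real.log (n : ℝ) := h4
  have h3' : (0 : ℝ) < n := by exact_mod_cast h3
  simp only [Function.comp, Real.rpow_one, Real.norm_eq_abs, one_mul,
    abs_of_pos h3', abs_of_pos (Real.rpow_pos_of_pos h4' k)] at h2
  rw [one_div]
  exact inv_anti₀ (Real.rpow_pos_of_pos h4' k) h2

/-! ### Uniform stability of the slope -/

theorem IsEigendecomposition.variance_pos {n : ℕ} {a σ : ℝ} {S : Matrix (Fin n) (Fin n) ℝ}
    {μ : Fin n → ℝ} (h : IsEigendecomposition a n S μ) (hσ : 0 < σ) (i : Fin n) :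
    0 < σ ^ 2 / μ i :=
  div_pos (by positivity) (h.pos i)

theorem IsEigendecomposition.variance_le {n : ℕ} {a σ : ℝ} {S : Matrix (Fin n) (Fin n) ℝ}
    {μ : Fin n → ℝ} (h : IsEigendecomposition a n S μ) (ha0 : 0 ≤ a) (ha1 : a < 1) (i : Fin n) :
    σ ^ 2 / μ i ≤ σ ^ 2 / (1 - a) ^ 2 := by
  have : 0 < 1 - a := by linarith
  have := h.le_eigenvalue ha0 ha1 i
  gcongr

theorem waterfill_le {n : ℕ} {s : Fin n → ℝ} {l M : ℝ} (hl : 0 < l) (hM : 0 ≤ M)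
    (hs : ∀ i, s i ≤ M) (i : Fin n) : waterfill s l i ≤ M := by
  have : 0 < 1 / (2 * l) := by positivity
  exact max_le (by linarith [hs i]) hM

/-- The slopes of the rate-distortion function and of the conditional relative entropy
minimization problem of the proxy vector are `B η_n`-close, uniformly over the decorrelations. -/
theorem exists_uniform_slope {a σ d : ℝ} (ha0 : 0 ≤ a) (ha1 : a < 1) (hσ : 0 < σ) (hd : 0 < d)
    (hdm : d < dMax a σ) :
    ∃ B : ℝ, 0 < B ∧ ∀ α : ℝ, 0 < α → ∀ᶠ n : ℕ in atTop,
      ∀ (S : Matrix (Fin n) (Fin n) ℝ) (μ : Fin n → ℝ), IsEigendecomposition a n S μ →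
        ∃ l : ℝ, 0 < l ∧
          avgDist (fun i => σ ^ 2 / μ i) (waterfill (fun i => σ ^ 2 / μ i) l) l = d ∧
          0 < (1 / (n : ℝ)) * ∑ i, waterfill (fun i => σ ^ 2 / μ i) l i ∧
          HasNegSlopeAt (nthRDF (diagGaussian fun i => σ ^ 2 / μ i)) d l ∧
          ∀ u : Fin n → ℝ, |mle u - a| ≤ etaSeq α n →
            (∀ i, 0 ≤ proxyVar σ u i ∧ |proxyVar σ u i - σ ^ 2 / μ i| ≤ B * etaSeq α n) ∧
            ∃ l' : ℝ, 0 < l' ∧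
              avgDist (proxyVar σ u) (waterfill (fun i => σ ^ 2 / μ i) l) l' = d ∧
              |l' - l| ≤ B * etaSeq α n := by
  have ha : 0 < 1 - a := by linarith
  set M : ℝ := σ ^ 2 / (1 - a) ^ 2 with hM
  have hM0 : 0 < M := by positivity
  -- Half of the gap absorbs the `M / n` error of the mean variance; the other half bounds the mean
  -- of the water-filling from below.
  set c : ℝ := (dMax a σ - d) / 2 with hc
  have hc0 : 0 < c := by rw [hc]; linarith
  -- The rate of `avgDist_sub_ge` with `L = 1 / d`, a bound on `2 * l` because `d ≤ 1 / (2 * l)`.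
  set k : ℝ := 2 * c ^ 2 / (1 + 2 * (1 / d) * M) ^ 2 with hk
  have hk0 : 0 < k := by positivity
  set A : ℝ := σ ^ 2 * 4 / (1 - a) ^ 4 * (4 + 2 * Real.pi) with hA
  have hA0 : 0 < A := by have := Real.pi_pos; positivity
  refine ⟨A + A / k, by positivity, fun α hα => ?_⟩
  have hη := tendsto_etaSeq α
  filter_upwards [eventually_gt_atTop 0, eventually_inv_le_etaSeq hα,
    hη.eventually_le_const (show 0 < (1 - a) / 2 by positivity),
    hη.eventually_le_const (show 0 < k / A / (4 * M) by positivity),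
    (tendsto_const_div_atTop_nhds_zero_nat M).eventually_le_const hc0] with n hn h1 h2 h3 h4 S μ h
  have hη0 := etaSeq_nonneg α n
  have hs : ∀ i, 0 ≤ σ ^ 2 / μ i := fun i => (h.variance_pos hσ i).le
  have hsM : ∀ i, σ ^ 2 / μ i ≤ M := fun i => h.variance_le ha0 ha1 i
  have hmean : d + c ≤ (1 / (n : ℝ)) * ∑ i, σ ^ 2 / μ i := by
    have := h.dMax_le (σ := σ) ha0 ha1 hn
    rw [hc] at h4 ⊢
    linarith
  obtain ⟨l, hl, hld, hl1, hl2, hslope⟩ := exists_waterLevel hn hs hsM hd (by linarith)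
  have hw : c ≤ (1 / (n : ℝ)) * ∑ i, waterfill (fun i => σ ^ 2 / μ i) l i := by
    rw [mean_waterfill hl, hld]; linarith
  have hlM : 1 / (4 * M) ≤ l / 2 := by
    rw [div_le_iff₀ (by positivity)] at hl2 ⊢
    linarith
  have hlL : 2 * l ≤ 1 / d := by
    rw [le_div_iff₀ (by positivity)] at hl1 ⊢
    linarith
  refine ⟨l, hl, hld, hc0.trans_le hw, hslope, fun u hu => ?_⟩
  have hp : ∀ i, 0 ≤ proxyVar σ u i ∧ |proxyVar σ u i - σ ^ 2 / μ i| ≤ A * etaSeq α n := by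
    intro i
    obtain ⟨q1, q2⟩ := h.abs_proxyVar_sub_le (σ := σ) ha0 ha1 (hu.trans h2) i
    refine ⟨q1, q2.trans ?_⟩
    rw [hA, mul_assoc (σ ^ 2 * 4 / (1 - a) ^ 4)]
    have : 2 * Real.pi / ((n : ℝ) + 1) ≤ 2 * Real.pi * etaSeq α n := by
      rw [← mul_one_div]
      have := Real.pi_pos
      gcongr
    gcongr
    linarith
  have hAk : A * etaSeq α n / k ≤ l / 2 := by
    refine le_trans ?_ hlM
    calc A * etaSeq α n / k ≤ A * (k / A / (4 * M)) / k := by gcongr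
      _ = 1 / (4 * M) := by field_simp
  obtain ⟨l', hl', hl'd, hll⟩ := exists_slope_perturbation hn (fun i => (hp i).1)
    (fun i => waterfill_nonneg _ _ i) (fun i => waterfill_le hl hM0.le hsM i) hc0 hw hl hlL
    (fun i => (hp i).2) hAk
  refine ⟨fun i => ⟨(hp i).1, (hp i).2.trans ?_⟩, l', hl', hl'd.trans hld, hll.trans ?_⟩
  · have : 0 ≤ A / k * etaSeq α n := by positivity
    linarith
  · have : 0 ≤ A * etaSeq α n := by positivity
    rw [add_mul, div_mul_eq_mul_div, hk]
    linarith

/-! ### The typical set -/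

/-- `avgDist` is the Gaussian mean of the conditional distortion, so the difference is a centered
quadratic form. -/
theorem sum_condDist_sub_avgDist {n : ℕ} {s : Fin n → ℝ} (hs : ∀ i, 0 < s i) (ν x : Fin n → ℝ)
    (l : ℝ) :
    (1 / (n : ℝ)) * ∑ i, condDist l (ν i) (x i) - avgDist s ν l =
      (1 / (n : ℝ)) * ∑ i, s i / (1 + 2 * l * ν i) ^ 2 * (x i ^ 2 / s i - 1) := by
  rw [avgDist, ← mul_sub, ← Finset.sum_sub_distrib]
  congr 1
  refine Finset.sum_congr rfl fun i _ => ?_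
  have := (hs i).ne'
  rw [condDist, mul_sub, mul_one, div_mul_div_comm, mul_comm (s i), mul_div_mul_right _ _ this]
  ring

/-- The empirical proxy distortion is close to the distortion when the slopes are close. -/
theorem abs_mean_condDist_sub_le {n : ℕ} {s ν x : Fin n → ℝ} {l l' M e r : ℝ} (hn : 0 < n)
    (hs : ∀ i, 0 < s i) (hsM : ∀ i, s i ≤ M) (hν : ∀ i, 0 ≤ ν i) (hνM : ∀ i, ν i ≤ M)
    (hl : 0 ≤ l) (hl' : 0 ≤ l') (hM : 0 ≤ M) (he : |l' - l| ≤ e)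
    (hx : (1 / (n : ℝ)) * ∑ i, x i ^ 2 / s i ≤ 3)
    (hr : |∑ i, s i / (1 + 2 * l * ν i) ^ 2 * (x i ^ 2 / s i - 1)| ≤ n * r) :
    |(1 / (n : ℝ)) * ∑ i, condDist l' (ν i) (x i) - avgDist s ν l| ≤ 14 * M ^ 2 * e + r := by
  have hn' : (0 : ℝ) < n := by exact_mod_cast hn
  have h1 : |(1 / (n : ℝ)) * ∑ i, condDist l' (ν i) (x i) -
      (1 / (n : ℝ)) * ∑ i, condDist l (ν i) (x i)| ≤ 14 * M ^ 2 * e := by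
    rw [← mul_sub, ← Finset.sum_sub_distrib, abs_mul, abs_of_pos (by positivity : 0 < 1 / (n : ℝ))]
    have h2 : ∀ i, |condDist l' (ν i) (x i) - condDist l (ν i) (x i)| ≤
        e * (4 * M ^ 2 * (x i ^ 2 / s i) + 2 * M ^ 2) := fun i => by
      refine (abs_condDist_sub_le hl hl' (hν i) (hνM i)).trans ?_
      have h3 : x i ^ 2 ≤ M * (x i ^ 2 / s i) := by
        rw [mul_div_assoc', le_div_iff₀ (hs i), mul_comm]
        exact mul_le_mul_of_nonneg_right (hsM i) (sq_nonneg _)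
      have h4 : 4 * M * x i ^ 2 ≤ 4 * M * (M * (x i ^ 2 / s i)) := by gcongr
      have h5 : 0 ≤ x i ^ 2 / s i := div_nonneg (sq_nonneg _) (hs i).le
      have h6 : 4 * M * x i ^ 2 + 2 * M ^ 2 ≤ 4 * M ^ 2 * (x i ^ 2 / s i) + 2 * M ^ 2 := by
        nlinarith
      exact mul_le_mul he h6 (by positivity) ((abs_nonneg _).trans he)
    have he0 : 0 ≤ e := (abs_nonneg _).trans he
    calc 1 / (n : ℝ) * |∑ i, (condDist l' (ν i) (x i) - condDist l (ν i) (x i))|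
        ≤ 1 / (n : ℝ) * ∑ i, e * (4 * M ^ 2 * (x i ^ 2 / s i) + 2 * M ^ 2) := by
          gcongr
          exact (Finset.abs_sum_le_sum_abs _ _).trans (Finset.sum_le_sum fun i _ => h2 i)
      _ = e * (4 * M ^ 2 * (1 / (n : ℝ) * ∑ i, x i ^ 2 / s i) + 2 * M ^ 2) := by
          rw [← Finset.mul_sum, Finset.sum_add_distrib, ← Finset.mul_sum, Finset.sum_const,
            Finset.card_univ, Fintype.card_fin, nsmul_eq_mul]
          field_simp
      -- The moment bound `3` gives the constant `4 * 3 + 2 = 14`.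
      _ ≤ e * (4 * M ^ 2 * 3 + 2 * M ^ 2) := by gcongr
      _ = 14 * M ^ 2 * e := by ring
  have h2 : |(1 / (n : ℝ)) * ∑ i, condDist l (ν i) (x i) - avgDist s ν l| ≤ r := by
    rw [sum_condDist_sub_avgDist hs, abs_mul, abs_of_pos (by positivity : 0 < 1 / (n : ℝ)),
      one_div_mul_eq_div, div_le_iff₀ hn', mul_comm r]
    exact hr
  exact (abs_sub_le _ _ _).trans (add_le_add h1 h2)

/-- Typicality asks for some achieving output law and some version of the distortion, so the
explicit test channels suffice here without uniqueness. -/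
theorem mem_typicalSet {n : ℕ} {a σ d α p l l' M e r : ℝ} {S : Matrix (Fin n) (Fin n) ℝ}
    {μ u : Fin n → ℝ} (hn : 0 < n) (h : IsEigendecomposition a n S μ) (hσ : 0 < σ)
    (hsM : ∀ i, σ ^ 2 / μ i ≤ M) (hM : 0 ≤ M) (hl : 0 < l) (hl' : 0 < l')
    (hld : avgDist (fun i => σ ^ 2 / μ i) (waterfill (fun i => σ ^ 2 / μ i) l) l = d)
    (hl'd : avgDist (proxyVar σ u) (waterfill (fun i => σ ^ 2 / μ i) l) l' = d)
    (hu : |mle u - a| ≤ etaSeq α n) (hp0 : ∀ i, 0 ≤ proxyVar σ u i) (he : |l' - l| ≤ e)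
    (hmom : ∀ k ∈ Finset.Icc 1 3, |(1 / (n : ℝ)) *
      ∑ i, (decorr S u i ^ 2 / (σ ^ 2 / μ i)) ^ k - ((2 * k - 1)‼ : ℕ)| ≤ 2)
    (hr : |∑ i, σ ^ 2 / μ i / (1 + 2 * l * waterfill (fun i => σ ^ 2 / μ i) l i) ^ 2 *
      (decorr S u i ^ 2 / (σ ^ 2 / μ i) - 1)| ≤ n * r)
    (hp : 14 * M ^ 2 * e + r ≤ p * etaSeq α n) :
    u ∈ typicalSet a σ d α p S μ := by
  have hs : ∀ i, 0 < σ ^ 2 / μ i := h.variance_pos hσ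
  refine ⟨hu, ⟨diagGaussian (waterfill (fun i => σ ^ 2 / μ i) l),
    fun i => condDist l' (waterfill (fun i => σ ^ 2 / μ i) l i), ?_, ?_, ?_⟩, hmom⟩
  · rw [decorrLaw_eq h, ← hld]
    exact (nthRDF_avgDist hn hl fun i => (hs i).le).2
  · refine ⟨testChannel l' (waterfill (fun i => σ ^ 2 / μ i) l), ?_, fun i => ?_⟩
    · have := (crem_avgDist hn hl'.le hp0 fun i => waterfill_nonneg (fun i => σ ^ 2 / μ i) l i).2
      rwa [hl'd] at this
    · exact isCondDistortion_testChannel (s := proxyVar σ u) hl'.le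
        (fun i => waterfill_nonneg (fun i => σ ^ 2 / μ i) l i) i
  · refine le_trans ?_ hp
    have h1 : (1 / (n : ℝ)) * ∑ i, decorr S u i ^ 2 / (σ ^ 2 / μ i) ≤ 3 := by
      have := (abs_le.1 (hmom 1 (by simp))).2
      norm_num at this
      norm_num
      linarith
    have h2 := abs_mean_condDist_sub_le hn hs hsM
      (fun i => waterfill_nonneg (fun i => σ ^ 2 / μ i) l i)
      (fun i => waterfill_le hl hM hsM i) hl.le hl'.le hM he h1 hr
    rwa [hld] at h2

theorem measurableSet_abs_sum_ge {n : ℕ} (b s : Fin n → ℝ) (r : ℝ) :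
    MeasurableSet {x : Fin n → ℝ | r ≤ |∑ i, b i * (x i ^ 2 / s i - 1)|} :=
  measurableSet_le measurable_const (by fun_prop)

theorem measurableSet_moment_ge {n : ℕ} (s : Fin n → ℝ) (k : ℕ) (c r : ℝ) :
    MeasurableSet {x : Fin n → ℝ | r ≤ |(1 / (n : ℝ)) * ∑ i, (x i ^ 2 / s i) ^ k - c|} :=
  measurableSet_le measurable_const (by fun_prop)

theorem innovationLaw_real_decorr {n : ℕ} {a σ : ℝ} {S : Matrix (Fin n) (Fin n) ℝ}
    {μ : Fin n → ℝ} (h : IsEigendecomposition a n S μ) {E : Set (Fin n → ℝ)}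
    (hE : MeasurableSet E) :
    (innovationLaw σ).real {z | decorr S (sourceVec a n z) ∈ E} =
      (diagGaussian fun i => σ ^ 2 / μ i).real E := by
  rw [← innovationLaw_map_decorr h, measureReal_def, measureReal_def, Measure.map_apply
    (show Measurable fun z => decorr S (sourceVec a n z) from
      (measurable_decorr S).comp (measurable_sourceVec a n)) hE]
  rfl

theorem exists_typicalSet_prob {a σ d B : ℝ} (ha0 : 0 ≤ a) (ha1 : a < 1) (hσ : 0 < σ)
    (hB : ∀ α : ℝ, 0 < α → ∀ᶠ n : ℕ in atTop,
      ∀ (S : Matrix (Fin n) (Fin n) ℝ) (μ : Fin n → ℝ), IsEigendecomposition a n S μ →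
        ∃ l : ℝ, 0 < l ∧
          avgDist (fun i => σ ^ 2 / μ i) (waterfill (fun i => σ ^ 2 / μ i) l) l = d ∧
          ∀ u : Fin n → ℝ, |mle u - a| ≤ etaSeq α n →
            (∀ i, 0 ≤ proxyVar σ u i) ∧ ∃ l' : ℝ, 0 < l' ∧
              avgDist (proxyVar σ u) (waterfill (fun i => σ ^ 2 / μ i) l) l' = d ∧
              |l' - l| ≤ B * etaSeq α n)
    {α p : ℝ} (hα : 0 < α)
    (hp : 14 * (σ ^ 2 / (1 - a) ^ 2) ^ 2 * B +
      4 * (σ ^ 2 / (1 - a) ^ 2) * Real.sqrt (kappa 2 a) ≤ p) :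
    ∃ A : ℝ, 0 < A ∧ ∀ᶠ n : ℕ in atTop,
      ∀ (S : Matrix (Fin n) (Fin n) ℝ) (μ : Fin n → ℝ), IsEigendecomposition a n S μ →
        1 - A / Real.log n ^ (kappa 2 a * α) ≤
          (innovationLaw σ).real {z | sourceVec a n z ∈ typicalSet a σ d α p S μ} := by
  have ha : 0 < 1 - a := by linarith
  have ha2 : 0 < 1 - a ^ 2 := by nlinarith
  set M : ℝ := σ ^ 2 / (1 - a) ^ 2 with hM
  have hM0 : 0 < M := by positivity
  set κ : ℝ := kappa 2 a with hκ
  have hκ' : κ = 1 / (4 * (1 - a ^ 2)) := by rw [hκ, kappa]; field_simp; norm_num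
  have hκ0 : 0 < κ := by rw [hκ']; positivity
  -- Chosen so that the Bernstein exponent `n (q η)² / (16 M²)` equals `κ n η²`, matching the MLE
  -- rate.
  set q : ℝ := 4 * M * Real.sqrt κ with hq
  have hq0 : 0 < q := by have := Real.sqrt_pos.2 hκ0; positivity
  obtain ⟨C, hC0, hC⟩ := exists_mle_tail ha0 ha1 hσ
  choose D hD0 hD using exists_moment_concentration
  refine ⟨4 + C + D 1 + D 2 + D 3,
    by have := hD0 1; have := hD0 2; have := hD0 3; positivity, ?_⟩
  filter_upwards [hB α hα, eventually_gt_atTop 0, eventually_exp_neg_etaSeq hα κ,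
    eventually_inv_le_inv_log_rpow (κ * α),
    (tendsto_etaSeq α).eventually_le_const (show 0 < 2 * M / q by positivity)]
    with n hBn hn h1 h2 h3 S μ h
  have hn' : (0 : ℝ) < n := by exact_mod_cast hn
  obtain ⟨l, hl, hld, hu⟩ := hBn S μ h
  have hη0 := etaSeq_nonneg α n
  set η := etaSeq α n with hη
  set s : Fin n → ℝ := fun i => σ ^ 2 / μ i with hsdef
  have hs : ∀ i, 0 < s i := h.variance_pos hσ
  have hsM : ∀ i, s i ≤ M := fun i => h.variance_le ha0 ha1 i
  set b : Fin n → ℝ := fun i => s i / (1 + 2 * l * waterfill s l i) ^ 2 with hb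
  have hbM : ∀ i, |b i| ≤ M := fun i => by
    have h4 : 1 ≤ 1 + 2 * l * waterfill s l i := by
      have := waterfill_nonneg s l i
      have : 0 ≤ 2 * l * waterfill s l i := by positivity
      linarith
    have := (hs i).le
    rw [abs_of_nonneg (by positivity)]
    exact (div_le_self this (one_le_pow₀ h4)).trans (hsM i)
  set X : (ℕ → ℝ) → Fin n → ℝ := fun z => decorr S (sourceVec a n z) with hX
  set E0 : Set (ℕ → ℝ) := {z | η < |mle (sourceVec a n z) - a|} with hE0
  set E1 : Set (ℕ → ℝ) := {z | X z ∈ {x : Fin n → ℝ |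
    n * (q * η) ≤ |∑ i, b i * (x i ^ 2 / s i - 1)|}} with hE1
  set E2 : ℕ → Set (ℕ → ℝ) := fun k => {z | X z ∈ {x : Fin n → ℝ |
    2 ≤ |(1 / (n : ℝ)) * ∑ i, (x i ^ 2 / s i) ^ k - ((2 * k - 1)‼ : ℕ)|}} with hE2
  set T : Set (ℕ → ℝ) := {z | sourceVec a n z ∈ typicalSet a σ d α p S μ} with hT
  -- Covering the whole space and using subadditivity avoids any measurability question for the
  -- typical set.
  have hcover : Set.univ ⊆ T ∪ (E0 ∪ (E1 ∪ (E2 1 ∪ (E2 2 ∪ E2 3)))) := by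
    intro z _
    by_contra hcon
    simp only [Set.mem_union, not_or] at hcon
    obtain ⟨g, g0, g1, g21, g22, g23⟩ := hcon
    have g0' : |mle (sourceVec a n z) - a| ≤ η := not_lt.1 g0
    obtain ⟨hp0, l', hl', hl'd, hll⟩ := hu _ g0'
    refine g (mem_typicalSet hn h hσ hsM hM0.le hl hl' hld hl'd g0' hp0 hll ?_
      (not_le.1 g1).le ?_)
    · intro k hk
      obtain ⟨hk1, hk3⟩ := Finset.mem_Icc.1 hk
      interval_cases k
      · exact (not_le.1 g21).le
      · exact (not_le.1 g22).le
      · exact (not_le.1 g23).le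
    · calc 14 * M ^ 2 * (B * η) + q * η = (14 * M ^ 2 * B + q) * η := by ring
        _ ≤ p * η := by gcongr
  have p0 : (innovationLaw σ).real E0 ≤ 2 * (Real.log n ^ (κ * α))⁻¹ + C * (1 / n) := by
    have := hC n hn η hη0
    rw [← h1, mul_one_div]
    convert this using 4
    rw [hκ']
    ring
  have p1 : (innovationLaw σ).real E1 ≤ 2 * (Real.log n ^ (κ * α))⁻¹ := by
    rw [hE1, innovationLaw_real_decorr h (measurableSet_abs_sum_ge b s _), ← h1]
    have hqη : q * η ≤ 2 * M := by rwa [le_div_iff₀' hq0] at h3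
    refine (quadratic_concentration hs hbM hM0 (by positivity) hqη).trans (le_of_eq ?_)
    congr 3
    rw [hq, mul_pow, mul_pow, Real.sq_sqrt hκ0.le]
    field_simp
    ring
  have p2 : ∀ k, (innovationLaw σ).real (E2 k) ≤ D k * (1 / n) := fun k => by
    simp only [hE2]
    rw [innovationLaw_real_decorr h (measurableSet_moment_ge s k _ _)]
    refine (hD k n s hs 2 two_pos hn).trans ?_
    rw [mul_one_div]
    have := hD0 k
    gcongr
    linarith
  have hone : (1 : ℝ) ≤ (innovationLaw σ).real T + ((innovationLaw σ).real E0 +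
      ((innovationLaw σ).real E1 + ((innovationLaw σ).real (E2 1) +
      ((innovationLaw σ).real (E2 2) + (innovationLaw σ).real (E2 3))))) := by
    rw [← probReal_univ (μ := innovationLaw σ)]
    refine (measureReal_mono hcover).trans ?_
    iterate 5 refine (measureReal_union_le _ _).trans (add_le_add_right ?_ _)
    exact le_rfl
  set w := (Real.log n ^ (κ * α))⁻¹ with hw
  have q0 : C * (1 / n) ≤ C * w := by gcongr
  have q1 : ∀ k, D k * (1 / n) ≤ D k * w := fun k => by have := hD0 k; gcongr
  have := p2 1; have := p2 2; have := p2 3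
  have := q1 1; have := q1 2; have := q1 3
  rw [div_eq_mul_inv, ← hw]
  linarith

end GaussMarkov

/-! ### Assembly of the theorem. -/

theorem theorem12 :
    ∃ c : ℝ, 0 < c ∧
    ∀ a σ d θ : ℝ, 0 ≤ a → a < 1 → 0 < σ → 0 < d → d < GaussMarkov.dMax a σ →
      GaussMarkov.IsWaterLevel a σ d θ →
    ∃ p₀ : ℝ, 0 < p₀ ∧ ∀ α : ℝ, 0 < α → ∀ p : ℝ, p₀ ≤ p →
      (∃ A₁ : ℝ, 0 < A₁ ∧ ∀ᶠ n : ℕ in atTop,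
        ∀ (S : Matrix (Fin n) (Fin n) ℝ) (μ : Fin n → ℝ),
          GaussMarkov.IsEigendecomposition a n S μ →
          1 - A₁ / Real.log n ^ (GaussMarkov.kappa c a * α) ≤
            (GaussMarkov.innovationLaw σ).real
              {z | GaussMarkov.sourceVec a n z ∈ GaussMarkov.typicalSet a σ d α p S μ}) ∧
      ∃ A₂ : ℝ, 0 < A₂ ∧
        (∀ᶠ n : ℕ in atTop,
          ∀ (S : Matrix (Fin n) (Fin n) ℝ) (μ : Fin n → ℝ),
            GaussMarkov.IsEigendecomposition a n S μ →
            ∀ u ∈ GaussMarkov.typicalSet a σ d α p S μ, ∀ i : Fin n,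
              |GaussMarkov.proxyVar σ u i - σ ^ 2 / μ i| ≤ A₂ * GaussMarkov.etaSeq α n) ∧
        (∀ᶠ n : ℕ in atTop,
          ∀ (S : Matrix (Fin n) (Fin n) ℝ) (μ : Fin n → ℝ),
            GaussMarkov.IsEigendecomposition a n S μ →
            ∀ u ∈ GaussMarkov.typicalSet a σ d α p S μ,
            ∀ Q : Measure (Fin n → ℝ),
              GaussMarkov.IsRDFAchieving (GaussMarkov.decorrLaw a σ S) d Q →
              ∃ lam lamHat : ℝ,
                GaussMarkov.HasNegSlopeAt
                  (fun t => GaussMarkov.nthRDF (GaussMarkov.sourceLaw a σ n) t) d lam ∧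
                GaussMarkov.HasNegSlopeAt
                  (fun t => GaussMarkov.crem (GaussMarkov.proxyLaw σ u) Q t) d lamHat ∧
                |lamHat - lam| ≤ 9 * A₂ / (4 * θ ^ 2) * GaussMarkov.etaSeq α n) := by
  refine ⟨2, two_pos, fun a σ d θ ha0 ha1 hσ hd hdm hθ => ?_⟩
  obtain ⟨B, hB0, hB⟩ := GaussMarkov.exists_uniform_slope ha0 ha1 hσ hd hdm
  have ha : 0 < 1 - a := by linarith
  have hθ0 : 0 < θ := hθ.1
  -- In `p₀`, the first term pays for the slope perturbation and the second for the quadratic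
  -- fluctuations. The factor `1 + 4 * θ ^ 2 / 9` in `A₂` makes both `A₂` and `9 * A₂ / (4 * θ ^ 2)`
  -- at least `B`.
  refine ⟨14 * (σ ^ 2 / (1 - a) ^ 2) ^ 2 * B +
    4 * (σ ^ 2 / (1 - a) ^ 2) * Real.sqrt (GaussMarkov.kappa 2 a), by positivity,
    fun α hα p hp => ⟨?_, B * (1 + 4 * θ ^ 2 / 9), by positivity, ?_, ?_⟩⟩
  · refine GaussMarkov.exists_typicalSet_prob ha0 ha1 hσ (fun α hα => ?_) hα hp
    filter_upwards [hB α hα] with n h S μ hS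
    obtain ⟨l, hl, hld, -, -, hu⟩ := h S μ hS
    exact ⟨l, hl, hld, fun u hu' => ⟨fun i => ((hu u hu').1 i).1, (hu u hu').2⟩⟩
  · filter_upwards [hB α hα] with n h S μ hS u hu i
    obtain ⟨l, -, -, -, -, hu'⟩ := h S μ hS
    refine (((hu' u hu.1).1 i).2).trans ?_
    have := GaussMarkov.etaSeq_nonneg α n
    gcongr
    exact le_mul_of_one_le_right hB0.le (by linarith [show 0 ≤ 4 * θ ^ 2 / 9 by positivity])
  · filter_upwards [hB α hα, eventually_gt_atTop 0] with n h hn S μ hS u hu Q hQ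
    obtain ⟨l, hl, hld, hpos, hslope, hu'⟩ := h S μ hS
    obtain ⟨hp1, l', hl', hl'd, hll⟩ := hu' u hu.1
    rw [GaussMarkov.decorrLaw_eq hS, ← hld] at hQ
    -- Uniqueness identifies the arbitrary `Q` with the water-filled law for which the CREM slope
    -- was computed.
    have hQ' := hQ.eq_diagGaussian hn hl fun i => (hS.variance_pos hσ i).le
    refine ⟨l, l', ?_, ?_, hll.trans ?_⟩
    · simpa only [GaussMarkov.nthRDF_sourceLaw hS] using hslope
    · rw [hQ']
      exact GaussMarkov.hasNegSlopeAt_crem hn (fun i => (hp1 i).1)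
        (fun i => GaussMarkov.waterfill_nonneg _ _ i) hpos hl' hl'd hd
    · have := GaussMarkov.etaSeq_nonneg α n
      gcongr
      rw [le_div_iff₀ (by positivity)]
      nlinarith
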